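/- Let $A\in\mathbb{R}^{n\times d}$ have rank $d\ge 1$, with rows $a_1,\dots,a_n$. The graph $G_A$ of $A$ has the columns $1,\dots,d$ as vertices, and two distinct columns are adjacent if and only if some row of $A$ is non-zero in both; the treewidth of $A$ is the treewidth of $G_A$. For $\epsilon\in(0,1)$, a vector $u\in\mathbb{R}^n_{\ge 0}$ is a $(1+\epsilon)$-approximate John ellipsoid of the polytope $\{x\in\mathbb{R}^d: |\langle a_i,x\rangle|\le 1,\ i=1,\dots,n\}$ if $\sum_i u_i=d$, $Q=\sum_i u_i a_i a_i^\top$ is positive definite, and $a_j^\top Q^{-1}a_j\le 1+\epsilon$ for all $j$. Fixed point iteration with $T'\ge 1$ iterates: $w_{1,i}=d/n$; for $1\le k<T'$, put $B_k=\sqrt{\mathrm{diag}(w_k)}\,A$ with rows $b_{k,i}^\top$, and $w_{k+1,i}=b_{k,i}^\top(B_k^\top B_k)^{-1}b_{k,i}$; the result is $u=\frac1{T'}\sum_{k=1}^{T'}w_k$. The machine is a random access machine with exact real numbers. Unit-cost operations: memory access, assignments, tests; $+,-,\times,/,\sqrt{\cdot}$ and comparison of reals; addition, subtraction and comparison of natural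 numbers. Its programs contain no constants other than natural numbers. Theorem. There are a single program and an absolute constant $C$ with the following property. Let $n,d,A$ be as above. (1) If $A$ has treewidth $\tau$, then $G_A$ has a tree decomposition of width $\tau$ with at most $d$ bags, whose nodes are numbered so that every node except the first has a neighbour with a smaller number. (2) Let $\epsilon\in(0,1)$, and let a tree decomposition of $G_A$ of width $\tau$, with at most $n$ bags and nodes numbered as in (1), be given. On input $\epsilon$, the matrix $A$ in compressed sparse row format, and this tree decomposition, the program halts after at most $$C\, n\,\max(\tau,1)^2\,\max(1,T),\qquad T=\epsilon^{-1}\log(n/d),$$ steps. Its output $u$ is a $(1+\epsilon)$-approximate John ellipsoid, and it is the result of the fixed point iteration with some number $T'$ of iterates, $1\le T'\le C\max(1,T)$. Each step of the iteration is given by one sparse Cholesky factorization and $n$ triangular solves: there is one order of the columns such that, with the columns of $A$ taken in this order, for every $k<T'$ the Cholesky factor $L_k$ of $B_k^\top B_k$ has at most $\tau+1$ non-zero entries in each column, and $w_{k+1,i}=\|y\|_2^2$ where $L_k y=b_{k,i}$. By (1), a tree decomposition as in (2) exists with $\tau$ the treewidth of $A$; with it the running time is $O(n\tau^2T)$ when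 $\tau\ge1$ and $T\ge1$. -/

import Mathlib

namespace JohnEllipsoid

open Matrix

noncomputable section

/-! ### Treewidth of a graph and of a matrix -/

/-- A tree decomposition of the graph `G` whose tree has the node set `ι`. -/
structure TreeDecomposition {V : Type} (G : SimpleGraph V) (ι : Type) where
  /-- The tree. -/
  tree : SimpleGraph ι
  isTree : tree.IsTree
  /-- The bags, one for each node of the tree. -/
  bag : ι → Finset V
  cover : ∀ v : V, ∃ t, v ∈ bag t
  edge_mem : ∀ u v : V, G.Adj u v → ∃ t, u ∈ bag t ∧ v ∈ bag t
  connected : ∀ v : V, (tree.induce {t | v ∈ bag t}).Connected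

namespace TreeDecomposition

variable {V : Type} {G : SimpleGraph V}

/-- The width: the largest size of a bag, minus one. -/
def width {ι : Type} [Fintype ι] (D : TreeDecomposition G ι) : ℕ :=
  (Finset.univ.sup fun t => (D.bag t).card) - 1

/-- The nodes are numbered from a root outwards: every node but node `0` has a neighbour with a
smaller number, which in a tree is unique: its parent. -/
def RootedOrder {N : ℕ} (D : TreeDecomposition G (Fin N)) : Prop :=
  ∀ k : Fin N, 0 < (k : ℕ) → ∃ j : Fin N, j < k ∧ D.tree.Adj j k

/-- The number of the parent of node `k` (and `0` for the root and for `k` out of range). -/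
def parent {N : ℕ} (D : TreeDecomposition G (Fin N)) (k : ℕ) : ℕ :=
  sInf {j : ℕ | ∃ (hj : j < N) (hk : k < N), j < k ∧ D.tree.Adj ⟨j, hj⟩ ⟨k, hk⟩}

end TreeDecomposition

/-- The treewidth of a graph: the least width of a (finite) tree decomposition. -/
def treewidth {V : Type} (G : SimpleGraph V) : ℕ :=
  sInf {w : ℕ | ∃ (N : ℕ) (D : TreeDecomposition G (Fin N)), D.width = w}

/-- The graph of a matrix: its vertices are the columns, and two columns are adjacent if and only
if some row has a non-zero entry in both. -/
def columnGraph {n d : ℕ} (A : Matrix (Fin n) (Fin d) ℝ) : SimpleGraph (Fin d) where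
  Adj i j := i ≠ j ∧ ∃ k : Fin n, A k i ≠ 0 ∧ A k j ≠ 0
  symm := ⟨fun _ _ h => ⟨h.1.symm, h.2.imp fun _ hk => ⟨hk.2, hk.1⟩⟩⟩
  loopless := ⟨fun _ h => h.1 rfl⟩

/-! ### The approximate John ellipsoid and the fixed point iteration -/

/-- `w` is a `(1 + ε)`-approximation of the John ellipsoid of
`{x | ∀ i, |⟪a i, x⟫| ≤ 1}`, where `a i` is the `i`-th row of `A`. Positive definiteness of
`Q = ∑ i, w i • a i (a i)ᵀ` is what gives the inverse of `Q` its meaning. -/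
def IsApproxJohn {n d : ℕ} (A : Matrix (Fin n) (Fin d) ℝ) (ε : ℝ) (w : Fin n → ℝ) : Prop :=
  (∀ i, 0 ≤ w i) ∧ ∑ i, w i = d ∧
    (Aᵀ * diagonal w * A).PosDef ∧
    ∀ j, A j ⬝ᵥ ((Aᵀ * diagonal w * A)⁻¹ *ᵥ A j) ≤ 1 + ε

/-- `L` is the Cholesky factor of `M`: lower triangular with positive diagonal, and `L Lᵀ = M`. -/
def IsCholesky {d : ℕ} (L M : Matrix (Fin d) (Fin d) ℝ) : Prop :=
  (∀ i j, i < j → L i j = 0) ∧ (∀ i, 0 < L i i) ∧ L * Lᵀ = M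

/-- The matrix `B = √W A`, where `W = diag w`. -/
def scaledMatrix {n d : ℕ} (A : Matrix (Fin n) (Fin d) ℝ) (w : Fin n → ℝ) :
    Matrix (Fin n) (Fin d) ℝ :=
  diagonal (fun i => √(w i)) * A

/-- `u` is the result of the fixed point iteration on `A` with `T` iterates `w 0, …, w (T - 1)`.
The iteration starts from `w 0 = d / n`, and each step makes

* one sparse Cholesky factorization of `Bᵀ B`, `B = √(diag (w k)) A`, with the columns taken in an
  order `π` that is the same for all steps and such that every column of the factor `L k` has at
  most `s` non-zero entries;
* for every row `b i` of `B`, one triangular solve `L k y = b i`, which gives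
  `w (k + 1) i = ‖y‖² = (b i)ᵀ (Bᵀ B)⁻¹ (b i)`.

The result is the average of the iterates. -/
def IsIterationOutput {n d : ℕ} (A : Matrix (Fin n) (Fin d) ℝ) (s T : ℕ) (u : Fin n → ℝ) : Prop :=
  ∃ (π : Equiv.Perm (Fin d)) (w : ℕ → Fin n → ℝ) (L : ℕ → Matrix (Fin d) (Fin d) ℝ),
    (∀ i, w 0 i = (d : ℝ) / n) ∧
    (∀ k, k + 1 < T →
      IsCholesky (L k) (((scaledMatrix A (w k))ᵀ * scaledMatrix A (w k)).submatrix π π) ∧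
      (∀ j, {i | L k i j ≠ 0}.ncard ≤ s) ∧
      ∀ i, ∃ y : Fin d → ℝ,
        L k *ᵥ y = (fun j => scaledMatrix A (w k) i (π j)) ∧ w (k + 1) i = y ⬝ᵥ y) ∧
    ∀ i, u i = (∑ k ∈ Finset.range T, w k i) / T

/-! ### A real random access machine

The machine has natural number and real variables and arrays, finitely many of which a program can
name. A program is a fixed finite text; it contains no real constants other than natural numbers.
Natural numbers (used for indices and control) can be added, subtracted and compared; reals can be
added, subtracted, multiplied, divided, compared, and their square roots taken. Every arithmetic
operation, comparison, memory access, assignment and test costs one unit of time. -/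

/-- The memory. -/
structure Store where
  /-- Natural number variables. -/
  nvar : ℕ → ℕ
  /-- Real variables. -/
  rvar : ℕ → ℝ
  /-- Natural number arrays: `narr a k` is entry `k` of array `a`. -/
  narr : ℕ → ℕ → ℕ
  /-- Real arrays. -/
  rarr : ℕ → ℕ → ℝ

/-- Natural number expressions. -/
inductive NExpr where
  | const (c : ℕ)
  | var (x : ℕ)
  | get (a : ℕ) (idx : NExpr)
  | add (e f : NExpr)
  | sub (e f : NExpr)

namespace NExpr

/-- The value (subtraction is truncated). -/
def eval (s : Store) : NExpr → ℕ
  | const c => c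
  | var x => s.nvar x
  | get a idx => s.narr a (idx.eval s)
  | add e f => e.eval s + f.eval s
  | sub e f => e.eval s - f.eval s

/-- The time for evaluation: the number of nodes. -/
def cost : NExpr → ℕ
  | const _ => 1
  | var _ => 1
  | get _ idx => idx.cost + 1
  | add e f => e.cost + f.cost + 1
  | sub e f => e.cost + f.cost + 1

end NExpr

/-- Real expressions. -/
inductive RExpr where
  | ofNat (e : NExpr)
  | var (x : ℕ)
  | get (a : ℕ) (idx : NExpr)
  | add (e f : RExpr)
  | sub (e f : RExpr)
  | mul (e f : RExpr)
  | div (e f : RExpr)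
  | sqrt (e : RExpr)

namespace RExpr

/-- The value (division by zero and square roots of negative numbers give zero). -/
def eval (s : Store) : RExpr → ℝ
  | ofNat e => (e.eval s : ℝ)
  | var x => s.rvar x
  | get a idx => s.rarr a (idx.eval s)
  | add e f => e.eval s + f.eval s
  | sub e f => e.eval s - f.eval s
  | mul e f => e.eval s * f.eval s
  | div e f => e.eval s / f.eval s
  | sqrt e => √(e.eval s)

/-- The time for evaluation: the number of nodes. -/
def cost : RExpr → ℕ
  | ofNat e => e.cost + 1
  | var _ => 1
  | get _ idx => idx.cost + 1
  | add e f => e.cost + f.cost + 1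
  | sub e f => e.cost + f.cost + 1
  | mul e f => e.cost + f.cost + 1
  | div e f => e.cost + f.cost + 1
  | sqrt e => e.cost + 1

end RExpr

/-- Tests. -/
inductive Test where
  | natLT (e f : NExpr)
  | natEQ (e f : NExpr)
  | realLT (e f : RExpr)

namespace Test

/-- Truth of a test. -/
def Holds (s : Store) : Test → Prop
  | natLT e f => e.eval s < f.eval s
  | natEQ e f => e.eval s = f.eval s
  | realLT e f => e.eval s < f.eval s

/-- The time for a test. -/
def cost : Test → ℕ
  | natLT e f => e.cost + f.cost + 1
  | natEQ e f => e.cost + f.cost + 1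
  | realLT e f => e.cost + f.cost + 1

end Test

/-- Programs. -/
inductive Program where
  | skip
  /-- `x := e` for a natural number variable. -/
  | setN (x : ℕ) (e : NExpr)
  /-- `x := e` for a real variable. -/
  | setR (x : ℕ) (e : RExpr)
  /-- `a[idx] := e` for a natural number array. -/
  | putN (a : ℕ) (idx e : NExpr)
  /-- `a[idx] := e` for a real array. -/
  | putR (a : ℕ) (idx : NExpr) (e : RExpr)
  | seq (p q : Program)
  | cond (b : Test) (p q : Program)
  | loop (b : Test) (p : Program)

namespace Store

/-- Assignment to a natural number variable. -/
def setN (s : Store) (x v : ℕ) : Store := { s with nvar := Function.update s.nvar x v }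

/-- Assignment to a real variable. -/
def setR (s : Store) (x : ℕ) (v : ℝ) : Store := { s with rvar := Function.update s.rvar x v }

/-- Assignment to an entry of a natural number array. -/
def putN (s : Store) (a k v : ℕ) : Store :=
  { s with narr := Function.update s.narr a (Function.update (s.narr a) k v) }

/-- Assignment to an entry of a real array. -/
def putR (s : Store) (a k : ℕ) (v : ℝ) : Store :=
  { s with rarr := Function.update s.rarr a (Function.update (s.rarr a) k v) }

end Store

/-- `Exec p s s' t`: started in `s`, the program `p` halts in `s'` after exactly `t` units of
time. -/
inductive Exec : Program → Store → Store → ℕ → Prop where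
  | skip (s : Store) : Exec .skip s s 1
  | setN (s : Store) (x : ℕ) (e : NExpr) :
      Exec (.setN x e) s (s.setN x (e.eval s)) (e.cost + 1)
  | setR (s : Store) (x : ℕ) (e : RExpr) :
      Exec (.setR x e) s (s.setR x (e.eval s)) (e.cost + 1)
  | putN (s : Store) (a : ℕ) (idx e : NExpr) :
      Exec (.putN a idx e) s (s.putN a (idx.eval s) (e.eval s)) (idx.cost + e.cost + 1)
  | putR (s : Store) (a : ℕ) (idx : NExpr) (e : RExpr) :
      Exec (.putR a idx e) s (s.putR a (idx.eval s) (e.eval s)) (idx.cost + e.cost + 1)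
  | seq {p q : Program} {s s' s'' : Store} {t t' : ℕ} :
      Exec p s s' t → Exec q s' s'' t' → Exec (.seq p q) s s'' (t + t')
  | cond_true {b : Test} {p q : Program} {s s' : Store} {t : ℕ} :
      b.Holds s → Exec p s s' t → Exec (.cond b p q) s s' (b.cost + t + 1)
  | cond_false {b : Test} {p q : Program} {s s' : Store} {t : ℕ} :
      ¬ b.Holds s → Exec q s s' t → Exec (.cond b p q) s s' (b.cost + t + 1)
  | loop_true {b : Test} {p : Program} {s s' s'' : Store} {t t' : ℕ} :
      b.Holds s → Exec p s s' t → Exec (.loop b p) s' s'' t' →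
        Exec (.loop b p) s s'' (b.cost + t + t' + 1)
  | loop_false {b : Test} {p : Program} {s : Store} :
      ¬ b.Holds s → Exec (.loop b p) s s (b.cost + 1)

/-! ### Input and output -/

/-- Where the `k`-th list starts when the lists of `l` are written one after the other. -/
def listStart {α : Type} (l : List (List α)) (k : ℕ) : ℕ := ((l.take k).map List.length).sum

open Classical in
/-- For each row of `A`, the columns of its non-zero entries, in increasing order. -/
def rowSupports {n d : ℕ} (A : Matrix (Fin n) (Fin d) ℝ) : List (List (Fin d)) :=
  (List.finRange n).map fun i => (List.finRange d).filter fun j => A i j ≠ 0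

open Classical in
/-- The non-zero entries of `A`, row by row. -/
def nonzeroEntries {n d : ℕ} (A : Matrix (Fin n) (Fin d) ℝ) : List ℝ :=
  (List.finRange n).flatMap fun i => ((List.finRange d).filter fun j => A i j ≠ 0).map (A i)

/-- The bags of a tree decomposition, each in increasing order. -/
def bagLists {d N : ℕ} {G : SimpleGraph (Fin d)} (D : TreeDecomposition G (Fin N)) :
    List (List (Fin d)) :=
  (List.finRange N).map fun t => (List.finRange d).filter fun j => j ∈ D.bag t

/-- The memory at the start. It holds `n`, `d`, the number `N` of bags and `ε` in variables; the
matrix `A` in compressed sparse row format (row starts, column indices, values); and the tree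
decomposition (parents of the nodes, bag starts, bags). Everything else is zero. -/
def inputStore {n d N : ℕ} (A : Matrix (Fin n) (Fin d) ℝ)
    (D : TreeDecomposition (columnGraph A) (Fin N)) (ε : ℝ) : Store where
  nvar
    | 0 => n
    | 1 => d
    | 2 => N
    | _ => 0
  rvar
    | 0 => ε
    | _ => 0
  narr
    | 0, k => listStart (rowSupports A) k
    | 1, k => ((rowSupports A).flatten.map Fin.val).getD k 0
    | 2, k => D.parent k
    | 3, k => listStart (bagLists D) k
    | 4, k => ((bagLists D).flatten.map Fin.val).getD k 0
    | _, _ => 0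
  rarr
    | 0, k => (nonzeroEntries A).getD k 0
    | _, _ => 0

/-- The output: the first `n` entries of the real array `1`. -/
def output (n : ℕ) (s : Store) (i : Fin n) : ℝ := s.rarr 1 i

end

end JohnEllipsoid

/-! Three facts carry the theorem: the iteration converges, elimination along a rooted tree
decomposition produces no fill-in outside the bags, and one step costs `O(n m²)` with `m` the width
plus one.

Convergence. Fix a non-zero row `a` with weights `w_k`, and put `r_k = aᵀ Q_k⁻¹ a`. Since `w_{k+1} =
w_k r_k` and `w_0 = d / n`, the product of `r_0, …, r_{T-1}` is `(n / d) w_T`, and `w_T ≤ 1` because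
it is a leverage score (`leverage_le_one`). By Cauchy-Schwarz, the form `aᵀ Q⁻¹ a` of the averaged
weights is at most the harmonic mean of the `r_k`, hence at most their geometric mean, so its `T`-th
power is at most `n / d` (`leverage_average_pow_le`). It is enough that `n / d ≤ (1 + ε) ^ T`, and
the least such `T ≥ 1` is of the required size because `log (1 + ε) ≥ ε / 2` (`exists_count`).

Fill-in. Number the tree from a root outwards, sort the vertices by the first bag that contains
them, and eliminate from the last to the first. The neighbours of `v` that are eliminated after `v`
then lie in the first bag of `v` (`RootedOrder.mem_bag_top`), and any two vertices of a bag count as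
neighbours. So every Schur complement keeps the pattern "some bag contains both", and column `v` of
the factor lives on one bag (`CholState.step`). The same fact bounds the support of a row of `A` by
`m`, and yields a decomposition with at most `d` bags (`RootedOrder.exists_small`).

Cost. A triangular solve for a single row may visit many columns of the factor. The program instead
computes the entries of `Q⁻¹` on the pattern, from the factor, in time `O(d m²)` (`InvState.step`).
The support of a row is a clique of the pattern, so these entries determine all the quadratic forms.
The solves of the statement are supplied by `isIterationOutput_average`, with the explicit solution
`Lᵀ Q⁻¹ b`. No time is spent on clearing `d × d` arrays: they are zero at the start, and a complete
elimination leaves the zero Schur complement behind. -/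

namespace JohnEllipsoid

open Matrix

noncomputable section

/-! ### Reasoning about programs -/

namespace Program

/-- The natural number variables that a program may change. -/
def wN : Program → List ℕ
  | setN x _ => [x]
  | seq p q => p.wN ++ q.wN
  | cond _ p q => p.wN ++ q.wN
  | loop _ p => p.wN
  | _ => []

/-- The real variables that a program may change. -/
def wR : Program → List ℕ
  | setR x _ => [x]
  | seq p q => p.wR ++ q.wR
  | cond _ p q => p.wR ++ q.wR
  | loop _ p => p.wR
  | _ => []

/-- The natural number arrays that a program may change. -/
def wNA : Program → List ℕ
  | putN x _ _ => [x]
  | seq p q => p.wNA ++ q.wNA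
  | cond _ p q => p.wNA ++ q.wNA
  | loop _ p => p.wNA
  | _ => []

/-- The real arrays that a program may change. -/
def wRA : Program → List ℕ
  | putR x _ _ => [x]
  | seq p q => p.wRA ++ q.wRA
  | cond _ p q => p.wRA ++ q.wRA
  | loop _ p => p.wRA
  | _ => []

end Program

/-- The stores `s` and `s'` agree on everything that `p` cannot change. -/
structure Frame (p : Program) (s s' : Store) : Prop where
  n : ∀ x, x ∉ p.wN → s'.nvar x = s.nvar x
  r : ∀ x, x ∉ p.wR → s'.rvar x = s.rvar x
  na : ∀ x, x ∉ p.wNA → s'.narr x = s.narr x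
  ra : ∀ x, x ∉ p.wRA → s'.rarr x = s.rarr x

theorem Frame.refl (p : Program) (s : Store) : Frame p s s :=
  ⟨fun _ _ => rfl, fun _ _ => rfl, fun _ _ => rfl, fun _ _ => rfl⟩

theorem Frame.trans {p : Program} {s s' s'' : Store} (h : Frame p s s') (h' : Frame p s' s'') :
    Frame p s s'' :=
  ⟨fun x hx => (h'.n x hx).trans (h.n x hx), fun x hx => (h'.r x hx).trans (h.r x hx),
    fun x hx => (h'.na x hx).trans (h.na x hx), fun x hx => (h'.ra x hx).trans (h.ra x hx)⟩

theorem Frame.mono {p q : Program} {s s' : Store} (h : Frame p s s') (hN : p.wN ⊆ q.wN)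
    (hR : p.wR ⊆ q.wR) (hNA : p.wNA ⊆ q.wNA) (hRA : p.wRA ⊆ q.wRA) : Frame q s s' :=
  ⟨fun x hx => h.n x fun h' => hx (hN h'), fun x hx => h.r x fun h' => hx (hR h'),
    fun x hx => h.na x fun h' => hx (hNA h'), fun x hx => h.ra x fun h' => hx (hRA h')⟩

theorem Frame.seq_left {p q : Program} {s s' : Store} (h : Frame p s s') :
    Frame (.seq p q) s s' :=
  h.mono (List.subset_append_left _ _) (List.subset_append_left _ _)
    (List.subset_append_left _ _) (List.subset_append_left _ _)

theorem Frame.seq_right {p q : Program} {s s' : Store} (h : Frame q s s') :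
    Frame (.seq p q) s s' :=
  h.mono (List.subset_append_right _ _) (List.subset_append_right _ _)
    (List.subset_append_right _ _) (List.subset_append_right _ _)

/-- The sets of written locations are computed from the program text. For a concrete program, that a
location is preserved is therefore a decidable statement, and most frame conditions below are closed
by `decide`. -/
theorem Exec.frame {p : Program} {s s' : Store} {t : ℕ} (h : Exec p s s' t) : Frame p s s' := by
  induction h with
  | skip s => exact Frame.refl _ _
  | setN s x e =>
    refine ⟨fun y hy => ?_, fun _ _ => rfl, fun _ _ => rfl, fun _ _ => rfl⟩
    simp only [Program.wN, List.mem_singleton] at hy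
    simp [Store.setN, hy]
  | setR s x e =>
    refine ⟨fun _ _ => rfl, fun y hy => ?_, fun _ _ => rfl, fun _ _ => rfl⟩
    simp only [Program.wR, List.mem_singleton] at hy
    simp [Store.setR, hy]
  | putN s x i e =>
    refine ⟨fun _ _ => rfl, fun _ _ => rfl, fun y hy => ?_, fun _ _ => rfl⟩
    simp only [Program.wNA, List.mem_singleton] at hy
    simp [Store.putN, hy]
  | putR s x i e =>
    refine ⟨fun _ _ => rfl, fun _ _ => rfl, fun _ _ => rfl, fun y hy => ?_⟩
    simp only [Program.wRA, List.mem_singleton] at hy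
    simp [Store.putR, hy]
  | seq _ _ h₁ h₂ => exact h₁.seq_left.trans h₂.seq_right
  | cond_true _ _ h =>
    exact h.mono (List.subset_append_left _ _) (List.subset_append_left _ _)
      (List.subset_append_left _ _) (List.subset_append_left _ _)
  | cond_false _ _ h =>
    exact h.mono (List.subset_append_right _ _) (List.subset_append_right _ _)
      (List.subset_append_right _ _) (List.subset_append_right _ _)
  | loop_true _ _ _ h₁ h₂ =>
    exact Frame.trans (h₁.mono (List.Subset.refl _) (List.Subset.refl _)
      (List.Subset.refl _) (List.Subset.refl _)) h₂
  | loop_false _ => exact Frame.refl _ _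

/-- Started in `s`, the program `p` halts within `c` units of time in a store that satisfies
`Q`. -/
def Runs (p : Program) (s : Store) (c : ℕ) (Q : Store → Prop) : Prop :=
  ∃ s' t, Exec p s s' t ∧ t ≤ c ∧ Q s'

namespace Runs

variable {p q : Program} {s : Store} {c c' : ℕ} {Q Q' : Store → Prop}

theorem frame (h : Runs p s c Q) : Runs p s c fun s' => Q s' ∧ Frame p s s' := by
  obtain ⟨s', t, h, ht, hQ⟩ := h
  exact ⟨s', t, h, ht, hQ, h.frame⟩

theorem mono (h : Runs p s c Q) (hc : c ≤ c') (hQ : ∀ s', Q s' → Q' s') : Runs p s c' Q' := by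
  obtain ⟨s', t, h, ht, h'⟩ := h
  exact ⟨s', t, h, ht.trans hc, hQ _ h'⟩

theorem seq (h : Runs p s c Q) (h' : ∀ s', Q s' → Frame p s s' → Runs q s' c' Q') :
    Runs (.seq p q) s (c + c') Q' := by
  obtain ⟨s', t, h, ht, hQ⟩ := h
  obtain ⟨s'', t', h', ht', hQ'⟩ := h' s' hQ h.frame
  exact ⟨s'', _, .seq h h', add_le_add ht ht', hQ'⟩

theorem skip (h : Q s) : Runs .skip s 1 Q := ⟨s, _, .skip s, le_rfl, h⟩

theorem setN {x : ℕ} {e : NExpr} (h : Q (s.setN x (e.eval s))) :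
    Runs (.setN x e) s (e.cost + 1) Q := ⟨_, _, .setN s x e, le_rfl, h⟩

theorem setR {x : ℕ} {e : RExpr} (h : Q (s.setR x (e.eval s))) :
    Runs (.setR x e) s (e.cost + 1) Q := ⟨_, _, .setR s x e, le_rfl, h⟩

theorem putN {a : ℕ} {i e : NExpr} (h : Q (s.putN a (i.eval s) (e.eval s))) :
    Runs (.putN a i e) s (i.cost + e.cost + 1) Q := ⟨_, _, .putN s a i e, le_rfl, h⟩

theorem putR {a : ℕ} {i : NExpr} {e : RExpr} (h : Q (s.putR a (i.eval s) (e.eval s))) :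
    Runs (.putR a i e) s (i.cost + e.cost + 1) Q := ⟨_, _, .putR s a i e, le_rfl, h⟩

theorem seq_setN {x : ℕ} {e : NExpr} (h : Runs q (s.setN x (e.eval s)) c Q) :
    Runs (.seq (.setN x e) q) s (e.cost + 1 + c) Q := by
  obtain ⟨s', t, h, ht, hQ⟩ := h
  exact ⟨s', _, .seq (.setN s x e) h, by omega, hQ⟩

theorem seq_setR {x : ℕ} {e : RExpr} (h : Runs q (s.setR x (e.eval s)) c Q) :
    Runs (.seq (.setR x e) q) s (e.cost + 1 + c) Q := by
  obtain ⟨s', t, h, ht, hQ⟩ := h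
  exact ⟨s', _, .seq (.setR s x e) h, by omega, hQ⟩

theorem seq_putN {a : ℕ} {i e : NExpr} (h : Runs q (s.putN a (i.eval s) (e.eval s)) c Q) :
    Runs (.seq (.putN a i e) q) s (i.cost + e.cost + 1 + c) Q := by
  obtain ⟨s', t, h, ht, hQ⟩ := h
  exact ⟨s', _, .seq (.putN s a i e) h, by omega, hQ⟩

theorem seq_putR {a : ℕ} {i : NExpr} {e : RExpr}
    (h : Runs q (s.putR a (i.eval s) (e.eval s)) c Q) :
    Runs (.seq (.putR a i e) q) s (i.cost + e.cost + 1 + c) Q := by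
  obtain ⟨s', t, h, ht, hQ⟩ := h
  exact ⟨s', _, .seq (.putR s a i e) h, by omega, hQ⟩

theorem cond {b : Test} (h : b.Holds s → Runs p s c Q) (h' : ¬ b.Holds s → Runs q s c Q) :
    Runs (.cond b p q) s (b.cost + c + 1) Q := by
  by_cases hb : b.Holds s
  · obtain ⟨s', t, h, ht, hQ⟩ := h hb
    exact ⟨s', _, .cond_true hb h, by omega, hQ⟩
  · obtain ⟨s', t, h, ht, hQ⟩ := h' hb
    exact ⟨s', _, .cond_false hb h, by omega, hQ⟩

/-- A loop whose body runs `m` times. -/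
theorem loop {b : Test} (m : ℕ) (I : ℕ → Store → Prop) (h₀ : I 0 s)
    (step : ∀ k < m, ∀ s', Frame p s s' → I k s' → b.Holds s' ∧ Runs p s' c (I (k + 1)))
    (hdone : ∀ s', Frame p s s' → I m s' → ¬ b.Holds s') :
    Runs (.loop b p) s (m * (c + b.cost + 1) + (b.cost + 1)) (I m) := by
  -- The induction is on the number `j` of runs that remain, since `Exec.loop_true` unrolls a loop
  -- from the front.
  suffices H : ∀ j ≤ m, ∀ s', Frame p s s' → I (m - j) s' →
      Runs (.loop b p) s' (j * (c + b.cost + 1) + (b.cost + 1)) (I m) by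
    exact H m le_rfl s (Frame.refl _ _) (by simpa using h₀)
  intro j
  induction j with
  | zero =>
    intro _ s' hf hI
    exact ⟨s', _, .loop_false (hdone s' hf hI), by omega, hI⟩
  | succ j ih =>
    intro hj s' hf hI
    obtain ⟨hb, s'', t, hE, ht, hI'⟩ := step (m - (j + 1)) (by omega) s' hf hI
    rw [show m - (j + 1) + 1 = m - j by omega] at hI'
    obtain ⟨s₃, t', hE', ht', hQ⟩ := ih (by omega) s'' (hf.trans hE.frame) hI'
    refine ⟨s₃, _, .loop_true hb hE hE', ?_, hQ⟩
    rw [add_mul]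
    omega

end Runs

/-- `while x < e do body; x := x + 1`. -/
def countLoop (x : ℕ) (e : NExpr) (body : Program) : Program :=
  .loop (.natLT (.var x) e) (.seq body (.setN x (.add (.var x) (.const 1))))

/-- A counting loop that runs through the `m` numbers from `lo` on. -/
theorem Runs.countLoop {x : ℕ} {e : NExpr} {body : Program} {s : Store} {c lo m : ℕ}
    (I : ℕ → Store → Prop) (hx : s.nvar x = lo)
    (he : ∀ s', Frame (countLoop x e body) s s' → e.eval s' = lo + m)
    (hbody : x ∉ body.wN) (h₀ : I 0 s)
    (step : ∀ k < m, ∀ s', Frame (JohnEllipsoid.countLoop x e body) s s' → s'.nvar x = lo + k →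
      I k s' → Runs body s' c fun s'' => I (k + 1) (s''.setN x (lo + k + 1))) :
    Runs (JohnEllipsoid.countLoop x e body) s (m * (c + e.cost + 7) + (e.cost + 3)) (I m) := by
  have H := Runs.loop (p := .seq body (.setN x (.add (.var x) (.const 1)))) (s := s) (c := c + 4)
    (b := .natLT (.var x) e) m (fun k s' => s'.nvar x = lo + k ∧ I k s') ⟨by simpa using hx, h₀⟩
    ?_ ?_
  · refine H.mono ?_ fun s' h => h.2
    simp only [Test.cost, NExpr.cost]
    gcongr ?_ * ?_ + ?_ <;> omega
  · intro k hk s' hf ⟨hxk, hI⟩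
    have hf' : Frame (JohnEllipsoid.countLoop x e body) s s' := ⟨hf.n, hf.r, hf.na, hf.ra⟩
    refine ⟨?_, ?_⟩
    · simp only [Test.Holds, NExpr.eval, hxk, he s' hf']
      omega
    · refine Runs.seq (c' := 4) (step k hk s' hf' hxk hI).frame ?_
      rintro s'' ⟨hI', hf''⟩ -
      refine Runs.setN ?_
      have : s''.nvar x = lo + k := (hf''.n x hbody).trans hxk
      simp only [NExpr.eval, this]
      exact ⟨by simp [Store.setN, add_assoc], hI'⟩
  · intro s' hf ⟨hxk, _⟩
    have hf' : Frame (JohnEllipsoid.countLoop x e body) s s' := ⟨hf.n, hf.r, hf.na, hf.ra⟩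
    simp only [Test.Holds, NExpr.eval, hxk, he s' hf']
    omega

/-- A counting loop that runs through a list. -/
theorem Runs.listLoop {β : Type} (l : List β) {x : ℕ} {e : NExpr} {body : Program} {s : Store}
    {c lo : ℕ} (I : List β → Store → Prop) (hx : s.nvar x = lo)
    (he : ∀ s', Frame (JohnEllipsoid.countLoop x e body) s s' → e.eval s' = lo + l.length)
    (hbody : x ∉ body.wN) (h₀ : I [] s)
    (step : ∀ k, ∀ hk : k < l.length, ∀ s', Frame (JohnEllipsoid.countLoop x e body) s s' →
      s'.nvar x = lo + k → I (l.take k) s' →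
      Runs body s' c fun s'' => I (l.take k ++ [l[k]]) (s''.setN x (lo + k + 1))) :
    Runs (JohnEllipsoid.countLoop x e body) s (l.length * (c + e.cost + 7) + (e.cost + 3))
      (I l) := by
  have H := Runs.countLoop (c := c) (m := l.length) (fun k s' => I (l.take k) s') hx he hbody
    (by simpa using h₀) ?_
  · simpa using H
  · intro k hk s' hf hxk hI
    have := step k hk s' hf hxk hI
    rwa [List.take_append_getElem hk] at this

section Elimination

/-! ### Symmetric elimination along a chordal pattern -/

/-- A symmetric sparsity pattern `P` without fill-in: the vertices are eliminated in the order
`ord (d - 1), …, ord 0`, and `bagOf v` is a clique of `P` that contains `v` and all the neighbours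
of `v` that are eliminated after `v`. -/
structure ElimPattern {d : ℕ} (ord : Equiv.Perm (Fin d)) (bagOf : Fin d → List (Fin d))
    (P : Fin d → Fin d → Prop) : Prop where
  nodup : ∀ v, (bagOf v).Nodup
  self_mem : ∀ v, v ∈ bagOf v
  share : ∀ v u w, u ∈ bagOf v → w ∈ bagOf v → P u w
  symm : ∀ u w, P u w → P w u
  later : ∀ v u, ord.symm u ≤ ord.symm v → P u v → u ∈ bagOf v

/-- The state of the Cholesky factorization of `M` when the vertices with position at least `m`
are eliminated: `X` is the remaining Schur complement, `L` holds the columns of the factor. -/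
structure CholState {d : ℕ} (ord : Equiv.Perm (Fin d)) (bagOf : Fin d → List (Fin d))
    (P : Fin d → Fin d → Prop) (M : Matrix (Fin d) (Fin d) ℝ) (m : ℕ)
    (X L : Matrix (Fin d) (Fin d) ℝ) : Prop where
  symm : ∀ u w, X u w = X w u
  row_zero : ∀ u w, m ≤ (ord.symm u : ℕ) → X u w = 0
  pos : ∀ x : Fin d → ℝ, x ≠ 0 → (∀ u, m ≤ (ord.symm u : ℕ) → x u = 0) → 0 < x ⬝ᵥ X *ᵥ x
  pat : ∀ u w, X u w ≠ 0 → P u w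
  diag : ∀ v, m ≤ (ord.symm v : ℕ) → 0 < L v v
  low : ∀ u v, m ≤ (ord.symm v : ℕ) → ord.symm v < ord.symm u → L u v = 0
  out : ∀ u v, u ∉ bagOf v → L u v = 0
  sum : ∀ u w, X u w + ∑ v, (if m ≤ (ord.symm v : ℕ) then L u v * L w v else 0) = M u w

variable {d : ℕ} {ord : Equiv.Perm (Fin d)} {bagOf : Fin d → List (Fin d)}
  {P : Fin d → Fin d → Prop} {M X L X' L' : Matrix (Fin d) (Fin d) ℝ} {m : ℕ}

/-- Only the zeros of `L` outside the bags matter: the other conditions on `L` concern eliminated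
columns, and there are none yet. Hence `L` may be the factor left over from the previous iteration
step. -/
theorem CholState.init (hM : M.PosDef) (hP : ∀ u w, M u w ≠ 0 → P u w)
    (hL : ∀ u v, u ∉ bagOf v → L u v = 0) : CholState ord bagOf P M d M L where
  symm u w := by simpa using (hM.1.apply w u)
  row_zero u _ h := absurd (ord.symm u).2 (by omega)
  pos x hx _ := by simpa using hM.dotProduct_mulVec_pos hx
  pat := hP
  diag v h := absurd (ord.symm v).2 (by omega)
  low _ v h := absurd (ord.symm v).2 (by omega)
  out := hL
  sum u w := by
    rw [Finset.sum_eq_zero, add_zero]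
    intro v _
    rw [if_neg (by have := (ord.symm v).2; omega)]

theorem CholState.diag_pos (h : CholState ord bagOf P M (m + 1) X L) {v : Fin d}
    (hv : (ord.symm v : ℕ) = m) : 0 < X v v := by
  have := h.pos (Pi.single v 1) (by simp) fun u hu => by
    rw [Pi.single_eq_of_ne]
    rintro rfl
    omega
  simpa [Matrix.mulVec_single_one] using this

/-- The quadratic form as a polynomial in the coordinate `v`. Its minimum over `a` is the quadratic
form of the Schur complement. -/
theorem dotProduct_mulVec_add_smul_single (hs : ∀ u w, X u w = X w u) (x : Fin d → ℝ) (v : Fin d)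
    (a : ℝ) :
    (x + a • Pi.single v 1) ⬝ᵥ X *ᵥ (x + a • Pi.single v 1) =
      x ⬝ᵥ X *ᵥ x + 2 * a * (x ⬝ᵥ X.col v) + a ^ 2 * X v v := by
  have h1 : X.col v = X *ᵥ Pi.single v 1 := by rw [Matrix.mulVec_single_one]
  have h2 : (Pi.single v 1 : Fin d → ℝ) ⬝ᵥ X *ᵥ x = x ⬝ᵥ X.col v := by
    rw [single_one_dotProduct, Matrix.mulVec, dotProduct_comm]
    congr 1
    ext u
    exact hs v u
  rw [mulVec_add, mulVec_smul, dotProduct_add, add_dotProduct, add_dotProduct, smul_dotProduct,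
    smul_dotProduct, h2, ← h1, dotProduct_smul, dotProduct_smul, single_one_dotProduct]
  simp only [smul_eq_mul, Matrix.col_apply]
  ring

/-- Eliminating `v` subtracts the outer product of the new column. That column vanishes outside
`bagOf v`, and `bagOf v` is a clique, so no entry outside the pattern appears. Vertices of the bag
that were eliminated earlier do no harm, because their rows in `X` are already zero. -/
theorem CholState.step (hE : ElimPattern ord bagOf P) (h : CholState ord bagOf P M (m + 1) X L)
    {v : Fin d} (hv : (ord.symm v : ℕ) = m)
    (hL : ∀ u w, L' u w = if w = v ∧ u ∈ bagOf v then X u v / √(X v v) else L u w)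
    (hX : ∀ u w, X' u w = X u w - if u ∈ bagOf v ∧ w ∈ bagOf v then L' u v * L' w v else 0) :
    CholState ord bagOf P M m X' L' := by
  have ha := h.diag_pos hv
  have hr : 0 < √(X v v) := Real.sqrt_pos.2 ha
  have hrr : √(X v v) * √(X v v) = X v v := Real.mul_self_sqrt ha.le
  -- A non-zero entry of column `v` belongs to a vertex that is not yet eliminated; being a
  -- neighbour of `v`, it is in the bag.
  have hmem : ∀ u, X u v ≠ 0 → u ∈ bagOf v := fun u hu => by
    refine hE.later v u ?_ (h.pat u v hu)
    by_contra hlt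
    exact hu (h.row_zero u v (by rw [not_le, Fin.lt_def] at hlt; omega))
  have hc : ∀ u, L' u v = X u v / √(X v v) := fun u => by
    rw [hL]
    by_cases hu : u ∈ bagOf v
    · rw [if_pos ⟨rfl, hu⟩]
    · rw [if_neg (fun h => hu h.2), h.out u v hu, not_not.1 (fun h' => hu (hmem u h')), zero_div]
  have hcm : ∀ u, L' u v ≠ 0 → u ∈ bagOf v := fun u hu =>
    hmem u fun h0 => hu (by rw [hc, h0, zero_div])
  have hne : ∀ u w, w ≠ v → L' u w = L u w := fun u w hw => by
    rw [hL, if_neg fun h => hw h.1]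
  have hX' : ∀ u w, X' u w = X u w - L' u v * L' w v := fun u w => by
    rw [hX]
    split_ifs with h'
    · rfl
    · by_cases hu : L' u v = 0
      · rw [hu, zero_mul]
      · by_cases hw : L' w v = 0
        · rw [hw, mul_zero]
        · exact absurd ⟨hcm u hu, hcm w hw⟩ h'
  have hle : ∀ u, m ≤ (ord.symm u : ℕ) → u = v ∨ m + 1 ≤ (ord.symm u : ℕ) := fun u hu => by
    rcases hu.eq_or_lt with h' | h'
    · left
      exact ord.symm.injective (Fin.ext (by omega))
    · exact Or.inr h'
  have hvv : L' v v = √(X v v) := by rw [hc, div_eq_iff hr.ne', hrr]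
  refine ⟨fun u w => by rw [hX', hX', h.symm, mul_comm], fun u w hu => ?_, fun x hx hx0 => ?_,
    fun u w huw => ?_, fun w hw => ?_, fun u w hw huw => ?_, fun u w hu => ?_, fun u w => ?_⟩
  · rw [hX']
    rcases hle u hu with rfl | hu
    · rw [hvv, hc, mul_div_cancel₀ _ hr.ne', h.symm w u, sub_self]
    · rw [h.row_zero u w hu, hc u, h.row_zero u v hu]
      simp
  · have hxv : x v = 0 := hx0 v hv.ge
    -- The multiple of the unit vector of `v` is the minimizing one, so the positive value obtained
    -- is exactly `x ⬝ᵥ X' *ᵥ x`.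
    have key := h.pos (x + (-(x ⬝ᵥ X.col v) / X v v) • Pi.single v 1) ?_ ?_
    · rw [dotProduct_mulVec_add_smul_single h.symm] at key
      have h1 : x ⬝ᵥ X' *ᵥ x = x ⬝ᵥ X *ᵥ x - (x ⬝ᵥ X.col v / √(X v v)) ^ 2 := by
        have : X' = X - vecMulVec (fun u => L' u v) (fun u => L' u v) := by
          ext u w
          rw [hX', Matrix.sub_apply, vecMulVec_apply]
        have h2 : x ⬝ᵥ (fun u => L' u v) = x ⬝ᵥ X.col v / √(X v v) := by
          simp only [dotProduct, Matrix.col_apply, hc, Finset.sum_div, mul_div_assoc]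
        rw [this, sub_mulVec, dotProduct_sub, vecMulVec_mulVec]
        rw [op_smul_eq_smul, dotProduct_smul, dotProduct_comm _ x, h2, smul_eq_mul, sq]
      rw [h1, div_pow, Real.sq_sqrt ha.le]
      convert key using 1
      field_simp
      ring
    · intro h0
      apply hx
      ext u
      by_cases hu : u = v
      · rw [hu, hxv]
        rfl
      · have := congrFun h0 u
        simpa [Pi.single_eq_of_ne hu] using this
    · intro u hu
      have huv : u ≠ v := by
        rintro rfl
        omega
      simp [hx0 u (by omega), Pi.single_eq_of_ne huv]
  · by_cases h0 : X u w = 0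
    · rw [hX', h0, zero_sub, neg_ne_zero] at huw
      exact hE.share v u w (hcm u (left_ne_zero_of_mul huw)) (hcm w (right_ne_zero_of_mul huw))
    · exact h.pat u w h0
  · rcases hle w hw with rfl | hw
    · rw [hvv]
      exact hr
    · have : w ≠ v := by
        rintro rfl
        omega
      rw [hne _ _ this]
      exact h.diag w hw
  · rcases hle w hw with rfl | hw
    · rw [hc, h.row_zero u w (by rw [Fin.lt_def] at huw; omega), zero_div]
    · have : w ≠ v := by
        rintro rfl
        omega
      rw [hne _ _ this]
      exact h.low u w hw huw
  · by_cases hw : w = v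
    · subst hw
      exact not_not.1 fun h0 => hu (hcm u h0)
    · rw [hne _ _ hw]
      exact h.out u w hu
  · rw [← h.sum u w, hX']
    have : ∀ y, (if m ≤ (ord.symm y : ℕ) then L' u y * L' w y else 0) =
        (if m + 1 ≤ (ord.symm y : ℕ) then L u y * L w y else 0) +
          if y = v then L' u v * L' w v else 0 := fun y => by
      by_cases hy : y = v
      · subst hy
        rw [if_pos hv.ge, if_neg (by omega), if_pos rfl, zero_add]
      · have : (ord.symm y : ℕ) ≠ m := fun h' => hy (ord.symm.injective (Fin.ext (by omega)))
        rw [if_neg hy, add_zero, hne _ _ hy, hne _ _ hy]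
        congr 1
        exact propext ⟨fun _ => by omega, fun _ => by omega⟩
    simp only [this, Finset.sum_add_distrib, Finset.sum_ite_eq', Finset.mem_univ, if_true]
    ring

/-- The properties of the complete sparse Cholesky factor, in terms of the elimination order. -/
theorem CholState.final (h : CholState ord bagOf P M 0 X L) : X = 0 ∧ L * Lᵀ = M := by
  refine ⟨?_, ?_⟩
  · ext u w
    exact h.row_zero u w (Nat.zero_le _)
  · ext u w
    have := h.sum u w
    rw [h.row_zero u w (Nat.zero_le _)] at this
    simpa [Matrix.mul_apply] using this

/-- Elimination as pure mathematics, without a machine. It supplies the factors that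
`IsIterationOutput` asks for. -/
theorem exists_cholState (hE : ElimPattern ord bagOf P) (hM : M.PosDef)
    (hP : ∀ u w, M u w ≠ 0 → P u w) : ∃ X L, CholState ord bagOf P M 0 X L := by
  suffices H : ∀ j ≤ d, ∃ X L, CholState ord bagOf P M (d - j) X L by
    simpa using H d le_rfl
  intro j
  induction j with
  | zero => exact fun _ => ⟨M, 0, CholState.init hM hP fun _ _ _ => rfl⟩
  | succ j ih =>
    intro hj
    obtain ⟨X, L, h⟩ := ih (by omega)
    rw [show d - j = d - (j + 1) + 1 by omega] at h
    exact ⟨_, _, h.step hE (v := ord ⟨d - (j + 1), by omega⟩) (by simp) (fun _ _ => rfl)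
      (fun _ _ => rfl)⟩

/-- The factor `L` with its rows and columns in the order of elimination. -/
theorem CholState.isCholesky (h : CholState ord bagOf P M 0 X L) :
    IsCholesky (L.submatrix (Fin.revPerm.trans ord) (Fin.revPerm.trans ord))
      (M.submatrix (Fin.revPerm.trans ord) (Fin.revPerm.trans ord)) := by
  refine ⟨fun i j hij => ?_, fun i => h.diag _ (Nat.zero_le _), ?_⟩
  · refine h.low _ _ (Nat.zero_le _) ?_
    simpa using hij
  · rw [transpose_submatrix, submatrix_mul_equiv, h.final.2]

theorem CholState.ncard_column_le (h : CholState ord bagOf P M 0 X L) {s : ℕ}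
    (hs : ∀ v, (bagOf v).length ≤ s) (j : Fin d) :
    {i | L.submatrix (Fin.revPerm.trans ord) (Fin.revPerm.trans ord) i j ≠ 0}.ncard ≤ s := by
  classical
  refine le_trans ?_ ((List.toFinset_card_le _).trans (hs (ord (Fin.rev j))))
  rw [← Set.ncard_coe_finset]
  refine Set.ncard_le_ncard_of_injOn (Fin.revPerm.trans ord) (fun i hi => ?_)
    (Equiv.injective _).injOn (Set.toFinite _)
  rw [Finset.mem_coe, List.mem_toFinset]
  by_contra h'
  exact hi (h.out _ _ h')

/-- With `M = L Lᵀ`, the matrix `M⁻¹ L` is the inverse of `Lᵀ`, which is triangular. -/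
theorem CholState.inv_mul (h : CholState ord bagOf P M 0 X L) (hM : M.PosDef) :
    (∀ u v, ord.symm u < ord.symm v → (M⁻¹ * L) u v = 0) ∧ ∀ v, (M⁻¹ * L) v v = 1 / L v v := by
  have hK : ∀ u w, ∑ k, (M⁻¹ * L) u k * L w k = if u = w then 1 else 0 := fun u w => by
    have : M⁻¹ * L * Lᵀ = 1 := by
      rw [Matrix.mul_assoc, h.final.2,
        Matrix.nonsing_inv_mul _ ((Matrix.isUnit_iff_isUnit_det _).1 hM.isUnit)]
    rw [← Matrix.one_apply, ← this]
    simp [Matrix.mul_apply]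
  have h0 : ∀ u v, ord.symm u < ord.symm v → (M⁻¹ * L) u v = 0 := by
    intro u
    -- Back substitution, starting from the largest position of `v`. In the entry `(u, v)` of `(M⁻¹
    -- L) Lᵀ = 1`, terms `k` positioned before `v` vanish by triangularity of `L`, and those after
    -- `v` by induction; the diagonal term alone remains.
    suffices H : ∀ j : ℕ, ∀ v, d - 1 - (ord.symm v : ℕ) = j → ord.symm u < ord.symm v →
        (M⁻¹ * L) u v = 0 from fun v => H _ v rfl
    intro j
    induction j using Nat.strong_induction_on with
    | _ j ih =>
      intro v hj huv
      have := hK u v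
      rw [if_neg (by rintro rfl; exact lt_irrefl _ huv), Finset.sum_eq_single v] at this
      · exact (mul_eq_zero.1 this).resolve_right (h.diag v (Nat.zero_le _)).ne'
      · intro k _ hk
        rcases lt_trichotomy (ord.symm k) (ord.symm v) with hlt | heq | hgt
        · rw [h.low v k (Nat.zero_le _) hlt, mul_zero]
        · exact absurd (ord.symm.injective heq) hk
        · rw [ih _ (by rw [Fin.lt_def] at hgt; have := (ord.symm k).2; omega) k rfl
            (huv.trans hgt), zero_mul]
      · simp
  refine ⟨h0, fun v => ?_⟩
  have := hK v v
  rw [if_pos rfl, Finset.sum_eq_single v] at this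
  · rw [eq_div_iff (h.diag v (Nat.zero_le _)).ne', this]
  · intro k _ hk
    rcases lt_trichotomy (ord.symm k) (ord.symm v) with hlt | heq | hgt
    · rw [h.low v k (Nat.zero_le _) hlt, mul_zero]
    · exact absurd (ord.symm.injective heq) hk
    · rw [h0 v k hgt, zero_mul]
  · simp

/-- The state of the computation of `M⁻¹`: `Z` agrees with `M⁻¹` on the pattern among the vertices
with position below `m`. -/
def InvState (ord : Equiv.Perm (Fin d)) (P : Fin d → Fin d → Prop) (M : Matrix (Fin d) (Fin d) ℝ)
    (m : ℕ) (Z : Matrix (Fin d) (Fin d) ℝ) : Prop :=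
  ∀ u w, (ord.symm u : ℕ) < m → (ord.symm w : ℕ) < m → P u w → Z u w = M⁻¹ u w

/-- Column `v` of `M⁻¹ L` is known: it is zero at positions below `m` and `1 / L v v` at `v`. Each
such entry is a sum over `k` in the bag of `v`, and all the entries of `M⁻¹` involved, except those
in row or column `v`, lie on the pattern at smaller positions. So the equations can be solved for
the entries `(u, v)` first and for `(v, v)` last. A bag may also contain vertices at larger
positions; the values written for these are arbitrary, and the invariant does not mention them yet.
-/
theorem InvState.step (hE : ElimPattern ord bagOf P) (h : CholState ord bagOf P M 0 X L)
    (hM : M.PosDef) {Z Z' : Matrix (Fin d) (Fin d) ℝ} (hZ : InvState ord P M m Z) {v : Fin d}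
    (hv : (ord.symm v : ℕ) = m) {g : Fin d → ℝ}
    (hg : ∀ u ∈ bagOf v, g u =
      (0 - ((bagOf v).map fun k => (if u = v ∨ k = v then 0 else Z u k) * L k v).sum) / L v v)
    (hd : Z' v v = (1 / L v v - ((bagOf v).map fun u => g u * L u v).sum) / L v v)
    (hc : ∀ u ∈ bagOf v, u ≠ v → Z' u v = g u ∧ Z' v u = g u)
    (ho : ∀ u w, u ≠ v → w ≠ v → Z' u w = Z u w) : InvState ord P M (m + 1) Z' := by
  have hLv := h.diag v (Nat.zero_le _)
  have hsum : ∀ f : Fin d → ℝ, ((bagOf v).map fun k => f k * L k v).sum = ∑ k, f k * L k v := by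
    intro f
    rw [← List.sum_toFinset _ (hE.nodup v)]
    refine Finset.sum_subset (Finset.subset_univ _) fun k _ hk => ?_
    rw [h.out k v (by simpa using hk), mul_zero]
  have hsplit : ∀ f : Fin d → ℝ, ∑ k, f k * L k v =
      f v * L v v + ∑ k, (if k = v then 0 else f k) * L k v := by
    intro f
    rw [← Finset.add_sum_erase _ _ (Finset.mem_univ v),
      ← Finset.add_sum_erase (f := fun k => (if k = v then 0 else f k) * L k v) _
        (Finset.mem_univ v), if_pos rfl, zero_mul, zero_add]
    congr 1
    refine Finset.sum_congr rfl fun k hk => ?_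
    rw [if_neg (Finset.ne_of_mem_erase hk)]
  have hlt : ∀ u, (ord.symm u : ℕ) < m + 1 → u = v ∨ (ord.symm u : ℕ) < m := fun u hu => by
    rcases Nat.lt_succ_iff_lt_or_eq.1 hu with h' | h'
    · exact Or.inr h'
    · exact Or.inl (ord.symm.injective (Fin.ext (by omega)))
  have hsym : ∀ u w, M⁻¹ u w = M⁻¹ w u := fun u w => by simpa using hM.inv.1.apply w u
  -- The masked factor is zero throughout when `u = v`, so the bag sum in `hd` loses its diagonal
  -- term without a case distinction in the program.
  have hgv : g v = 0 := by
    rw [hg v (hE.self_mem v)]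
    simp
  have hgu : ∀ u ∈ bagOf v, (ord.symm u : ℕ) < m → g u = M⁻¹ u v := fun u hu hum => by
    have huv : u ≠ v := by
      rintro rfl
      omega
    rw [hg u hu, hsum, div_eq_iff hLv.ne', zero_sub, neg_eq_iff_add_eq_zero, add_comm]
    have h0 := (h.inv_mul hM).1 u v (by rw [Fin.lt_def]; omega)
    rw [Matrix.mul_apply, hsplit] at h0
    refine Eq.trans (congrArg _ ?_) h0
    refine Finset.sum_congr rfl fun k _ => ?_
    by_cases hkL : L k v = 0
    · rw [hkL, mul_zero, mul_zero]
    · have hkb : k ∈ bagOf v := not_not.1 fun h' => hkL (h.out k v h')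
      by_cases hk : k = v
      · simp [hk]
      · rw [if_neg (by tauto), if_neg hk, hZ u k hum ?_ (hE.share v u k hu hkb)]
        rcases lt_trichotomy (ord.symm k) (ord.symm v) with h' | h' | h'
        · rw [Fin.lt_def] at h'
          omega
        · exact absurd (ord.symm.injective h') hk
        · exact absurd (h.low k v (Nat.zero_le _) h') hkL
  intro u w hu hw hP
  rcases hlt u hu with rfl | hu
  · rcases hlt w hw with rfl | hw
    · rw [hd, hsum, hsplit, hgv, div_eq_iff hLv.ne', ← (h.inv_mul hM).2 w,
        Matrix.mul_apply, hsplit]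
      rw [zero_mul, zero_add, add_sub_assoc, add_eq_left, sub_eq_zero]
      refine Finset.sum_congr rfl fun k _ => ?_
      by_cases hkL : L k w = 0
      · rw [hkL, mul_zero, mul_zero]
      · have hkb : k ∈ bagOf w := not_not.1 fun h' => hkL (h.out k w h')
        by_cases hk : k = w
        · rw [if_pos hk, if_pos hk]
        · rw [if_neg hk, if_neg hk, hgu k hkb ?_, hsym]
          rcases lt_trichotomy (ord.symm k) (ord.symm w) with h' | h' | h'
          · rw [Fin.lt_def] at h'
            omega
          · exact absurd (ord.symm.injective h') hk
          · exact absurd (h.low k w (Nat.zero_le _) h') hkL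
    · have hwv : w ≠ u := by
        rintro rfl
        omega
      have hwb := hE.later u w (by rw [Fin.le_def]; omega) (hE.symm _ _ hP)
      rw [(hc w hwb hwv).2, hgu w hwb hw, hsym]
  · have huv : u ≠ v := by
      rintro rfl
      omega
    rcases hlt w hw with rfl | hw
    · have hub := hE.later w u (by rw [Fin.le_def]; omega) hP
      rw [(hc u hub huv).1, hgu u hub hu]
    · have hwv : w ≠ v := by
        rintro rfl
        omega
      rw [ho u w huv hwv, hZ u w hu hw hP]

end Elimination

section FixedPoint

/-! ### The fixed point iteration -/

/-- The matrix `∑ i, w i • a i (a i)ᵀ`. -/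
def gram {n d : ℕ} (A : Matrix (Fin n) (Fin d) ℝ) (w : Fin n → ℝ) : Matrix (Fin d) (Fin d) ℝ :=
  Aᵀ * diagonal w * A

/-- The iterates of the fixed point iteration. -/
def iterate {n d : ℕ} (A : Matrix (Fin n) (Fin d) ℝ) : ℕ → Fin n → ℝ
  | 0 => fun _ => (d : ℝ) / n
  | k + 1 => fun i => iterate A k i * (A i ⬝ᵥ (gram A (iterate A k))⁻¹ *ᵥ A i)

variable {n d : ℕ} {A : Matrix (Fin n) (Fin d) ℝ} {w : Fin n → ℝ}

theorem gram_apply (A : Matrix (Fin n) (Fin d) ℝ) (w : Fin n → ℝ) (u v : Fin d) :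
    gram A w u v = ∑ i, w i * A i u * A i v := by
  rw [gram, Matrix.mul_assoc, Matrix.mul_apply]
  refine Finset.sum_congr rfl fun i _ => ?_
  rw [diagonal_mul, transpose_apply]
  ring

theorem dotProduct_gram_mulVec (A : Matrix (Fin n) (Fin d) ℝ) (w : Fin n → ℝ) (x : Fin d → ℝ) :
    x ⬝ᵥ gram A w *ᵥ x = ∑ i, w i * (A i ⬝ᵥ x) ^ 2 := by
  rw [gram, ← mulVec_mulVec, ← mulVec_mulVec, dotProduct_mulVec, vecMul_transpose]
  simp only [dotProduct, mulVec_diagonal]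
  refine Finset.sum_congr rfl fun i _ => ?_
  simp only [mulVec, dotProduct]
  ring

theorem gram_symm (A : Matrix (Fin n) (Fin d) ℝ) (w : Fin n → ℝ) : (gram A w).IsHermitian := by
  ext u v
  simp only [conjTranspose_apply, gram_apply, star_trivial]
  refine Finset.sum_congr rfl fun i _ => ?_
  ring

theorem eq_zero_of_mulVec_eq_zero (hA : A.rank = d) {x : Fin d → ℝ} (hx : A *ᵥ x = 0) : x = 0 := by
  have h := A.mulVecLin.finrank_range_add_finrank_ker
  rw [Module.finrank_fin_fun] at h
  have h' : Module.finrank ℝ (LinearMap.range A.mulVecLin) = d := hA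
  have : LinearMap.ker A.mulVecLin = ⊥ := Submodule.finrank_eq_zero.1 (by omega)
  have hmem : x ∈ LinearMap.ker A.mulVecLin := by simpa using hx
  rwa [this, Submodule.mem_bot] at hmem

/-- If the form vanishes at `x`, every row of positive weight is orthogonal to `x`; the remaining
rows are zero, so `A *ᵥ x = 0`, and full column rank gives `x = 0`. -/
theorem gram_posDef (hA : A.rank = d) (h0 : ∀ i, 0 ≤ w i) (h1 : ∀ i, A i ≠ 0 → 0 < w i) :
    (gram A w).PosDef := by
  rw [posDef_iff_dotProduct_mulVec]
  refine ⟨gram_symm A w, fun x hx => ?_⟩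
  rw [star_trivial, dotProduct_gram_mulVec]
  refine lt_of_le_of_ne (Finset.sum_nonneg fun i _ => mul_nonneg (h0 i) (sq_nonneg _)) fun h => ?_
  rw [eq_comm, Finset.sum_eq_zero_iff_of_nonneg fun i _ => mul_nonneg (h0 i) (sq_nonneg _)] at h
  refine hx (eq_zero_of_mulVec_eq_zero hA ?_)
  ext i
  rcases mul_eq_zero.1 (h i (Finset.mem_univ i)) with h' | h'
  · have : A i = 0 := by
      by_contra h2
      exact (h1 i h2).ne' h'
    simp [mulVec, this]
  · exact pow_eq_zero_iff two_ne_zero |>.1 h'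

theorem mulVec_inv_mulVec {M : Matrix (Fin d) (Fin d) ℝ} (hM : M.PosDef) (x : Fin d → ℝ) :
    M *ᵥ (M⁻¹ *ᵥ x) = x := by
  rw [mulVec_mulVec, mul_nonsing_inv _ ((isUnit_iff_isUnit_det _).1 hM.isUnit), one_mulVec]

/-- Cauchy-Schwarz for the inner products of `M` and `M⁻¹`. -/
theorem dotProduct_sq_le {M : Matrix (Fin d) (Fin d) ℝ} (hM : M.PosDef) (x y : Fin d → ℝ) :
    (x ⬝ᵥ y) ^ 2 ≤ (x ⬝ᵥ M⁻¹ *ᵥ x) * (y ⬝ᵥ M *ᵥ y) := by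
  have hs : ∀ z v : Fin d → ℝ, z ⬝ᵥ M *ᵥ v = v ⬝ᵥ M *ᵥ z := fun z v => by
    rw [dotProduct_mulVec, ← mulVec_transpose, dotProduct_comm]
    have h := hM.1
    rw [IsHermitian, conjTranspose_eq_transpose_of_trivial] at h
    rw [h]
  set z := M⁻¹ *ᵥ x with hz
  have hMz : M *ᵥ z = x := mulVec_inv_mulVec hM x
  by_cases hy : y = 0
  · simp [hy]
  have hpos : 0 < y ⬝ᵥ M *ᵥ y := by simpa using hM.dotProduct_mulVec_pos hy
  set b := y ⬝ᵥ M *ᵥ y with hb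
  have hyx : y ⬝ᵥ M *ᵥ z = x ⬝ᵥ y := by rw [hMz, dotProduct_comm]
  -- The vector is the residual of `z` after projection on `y` in the inner product of `M`, scaled
  -- by `b` to avoid a division.
  have h0 : 0 ≤ (b • z - (x ⬝ᵥ y) • y) ⬝ᵥ M *ᵥ (b • z - (x ⬝ᵥ y) • y) := by
    simpa using hM.posSemidef.dotProduct_mulVec_nonneg (b • z - (x ⬝ᵥ y) • y)
  rw [mulVec_sub, dotProduct_sub, sub_dotProduct, sub_dotProduct] at h0
  simp only [mulVec_smul, dotProduct_smul, smul_dotProduct, smul_eq_mul] at h0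
  rw [hs z y, hyx, ← hb, hMz, dotProduct_comm z x] at h0
  have : 0 ≤ b * ((x ⬝ᵥ z) * b - (x ⬝ᵥ y) ^ 2) := by
    linarith
  have := nonneg_of_mul_nonneg_right this hpos
  linarith

/-- With `z = Q⁻¹ a_i`, the value `q = zᵀ Q z` is a sum of non-negative terms of which the `i`-th is
`w i * q ^ 2`; divide by `q`. -/
theorem leverage_le_one (hM : (gram A w).PosDef) (h0 : ∀ i, 0 ≤ w i) (i : Fin n) :
    w i * (A i ⬝ᵥ (gram A w)⁻¹ *ᵥ A i) ≤ 1 := by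
  set q := A i ⬝ᵥ (gram A w)⁻¹ *ᵥ A i with hq
  have hq0 : 0 ≤ q := by simpa using hM.inv.posSemidef.dotProduct_mulVec_nonneg (A i)
  have h1 : w i * q ^ 2 ≤ q := by
    have h := dotProduct_gram_mulVec A w ((gram A w)⁻¹ *ᵥ A i)
    rw [mulVec_inv_mulVec hM, dotProduct_comm] at h
    exact (Finset.single_le_sum (f := fun j => w j * (A j ⬝ᵥ (gram A w)⁻¹ *ᵥ A i) ^ 2)
      (fun j _ => mul_nonneg (h0 j) (sq_nonneg _)) (Finset.mem_univ i)).trans h.ge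
  rcases hq0.eq_or_lt with h | h
  · rw [← h]
    simp
  · refine le_of_mul_le_mul_right ?_ h
    linarith

/-- The sum is the trace of `Q⁻¹ Q`. -/
theorem sum_leverage (hM : (gram A w).PosDef) :
    ∑ i, w i * (A i ⬝ᵥ (gram A w)⁻¹ *ᵥ A i) = d := by
  have h : ((gram A w)⁻¹ * gram A w).trace = d := by
    rw [nonsing_inv_mul _ ((isUnit_iff_isUnit_det _).1 hM.isUnit), trace_one, Fintype.card_fin]
  rw [← h, trace]
  simp only [diag_apply, mul_apply, gram_apply A w, dotProduct, mulVec, Finset.mul_sum]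
  rw [Finset.sum_comm]
  refine Finset.sum_congr rfl fun u _ => ?_
  rw [Finset.sum_comm]
  refine Finset.sum_congr rfl fun v _ => ?_
  refine Finset.sum_congr rfl fun i _ => ?_
  ring

theorem le_of_rank (hA : A.rank = d) : d ≤ n := by
  simpa [hA] using A.rank_le_card_height

/-- Zero rows of `A` are allowed, and their weight drops to zero after one step. Positivity on the
non-zero rows is all that `gram_posDef` requires. -/
theorem iterate_pos (hd : 0 < d) (hA : A.rank = d) (k : ℕ) :
    (∀ i, 0 ≤ iterate A k i) ∧ ∀ i, A i ≠ 0 → 0 < iterate A k i := by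
  induction k with
  | zero =>
    have hn : 0 < n := hd.trans_le (le_of_rank hA)
    have : (0 : ℝ) < (d : ℝ) / n := by positivity
    exact ⟨fun _ => this.le, fun _ _ => this⟩
  | succ k ih =>
    have hM := gram_posDef hA ih.1 ih.2
    refine ⟨fun i => mul_nonneg (ih.1 i) ?_, fun i hi => mul_pos (ih.2 i hi) ?_⟩
    · simpa using hM.inv.posSemidef.dotProduct_mulVec_nonneg (A i)
    · simpa using hM.inv.dotProduct_mulVec_pos hi

theorem iterate_posDef (hd : 0 < d) (hA : A.rank = d) (k : ℕ) : (gram A (iterate A k)).PosDef :=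
  gram_posDef hA (iterate_pos hd hA k).1 (iterate_pos hd hA k).2

theorem sum_iterate (hd : 0 < d) (hA : A.rank = d) (k : ℕ) : ∑ i, iterate A k i = d := by
  cases k with
  | zero =>
    have hn : 0 < n := hd.trans_le (le_of_rank hA)
    have : (n : ℝ) ≠ 0 := by positivity
    simp only [iterate, Finset.sum_const, Finset.card_univ, Fintype.card_fin, nsmul_eq_mul]
    field_simp
  | succ k => exact sum_leverage (iterate_posDef hd hA k)

/-- The average of the first `T` iterates. -/
def average (A : Matrix (Fin n) (Fin d) ℝ) (T : ℕ) (i : Fin n) : ℝ :=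
  (∑ k ∈ Finset.range T, iterate A k i) / T

theorem average_posDef (hd : 0 < d) (hA : A.rank = d) {T : ℕ} (hT : 1 ≤ T) :
    (gram A (average A T)).PosDef := by
  have hT' : (0 : ℝ) < T := by exact_mod_cast hT
  refine gram_posDef hA (fun i => div_nonneg (Finset.sum_nonneg fun k _ =>
    (iterate_pos hd hA k).1 i) hT'.le) fun i hi => div_pos (Finset.sum_pos (fun k _ =>
    (iterate_pos hd hA k).2 i hi) ⟨0, Finset.mem_range.2 hT⟩) hT'

theorem dotProduct_gram_average (A : Matrix (Fin n) (Fin d) ℝ) (T : ℕ) (y : Fin d → ℝ) :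
    y ⬝ᵥ gram A (average A T) *ᵥ y =
      (∑ k ∈ Finset.range T, y ⬝ᵥ gram A (iterate A k) *ᵥ y) / T := by
  simp only [dotProduct_gram_mulVec, average, Finset.sum_div, Finset.sum_mul]
  rw [Finset.sum_comm]
  refine Finset.sum_congr rfl fun k _ => Finset.sum_congr rfl fun i _ => ?_
  ring

/-- A number that is at most the harmonic mean is at most the geometric mean. -/
theorem pow_le_prod_of_mul_sum_inv_le {T : ℕ} (hT : 1 ≤ T) {q : ℝ} (hq : 0 ≤ q) {r : ℕ → ℝ}
    (hr : ∀ k, 0 < r k) (h : q * ∑ k ∈ Finset.range T, (r k)⁻¹ ≤ T) :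
    q ^ T ≤ ∏ k ∈ Finset.range T, r k := by
  have hT' : (0 : ℝ) < T := by exact_mod_cast hT
  have h2 : (T : ℝ) * (∏ k ∈ Finset.range T, (r k)⁻¹) ^ ((T : ℝ)⁻¹) ≤
      ∑ k ∈ Finset.range T, (r k)⁻¹ := by
    have := Real.geom_mean_le_arith_mean (Finset.range T) (fun _ => (1 : ℝ)) (fun k => (r k)⁻¹)
      (fun _ _ => zero_le_one) (by simpa using hT') fun k _ => (inv_pos.2 (hr k)).le
    simp only [Finset.sum_const, Finset.card_range, nsmul_eq_mul, mul_one, Real.rpow_one,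
      one_mul] at this
    rwa [le_div_iff₀ hT', mul_comm] at this
  have hpr : 0 < ∏ k ∈ Finset.range T, r k := Finset.prod_pos fun k _ => hr k
  have hpi : 0 < ∏ k ∈ Finset.range T, (r k)⁻¹ := Finset.prod_pos fun k _ => inv_pos.2 (hr k)
  have h3 : q * (∏ k ∈ Finset.range T, (r k)⁻¹) ^ ((T : ℝ)⁻¹) ≤ 1 := by
    have := (mul_le_mul_of_nonneg_left h2 hq).trans h
    refine le_of_mul_le_mul_left ?_ hT'
    linarith
  have h4 := pow_le_pow_left₀ (mul_nonneg hq (Real.rpow_nonneg hpi.le _)) h3 T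
  rw [mul_pow, Real.rpow_inv_natCast_pow hpi.le (by omega), one_pow, Finset.prod_inv_distrib,
    ← div_eq_mul_inv, div_le_one hpr] at h4
  exact h4

/-- The convexity of `log (a ᵀ Q⁻¹ a)` in `Q`, for the average of the iterates. -/
theorem leverage_average_pow_le (hd : 0 < d) (hA : A.rank = d) {T : ℕ} (hT : 1 ≤ T) {i : Fin n}
    (hi : A i ≠ 0) :
    (A i ⬝ᵥ (gram A (average A T))⁻¹ *ᵥ A i) ^ T ≤
      ∏ k ∈ Finset.range T, A i ⬝ᵥ (gram A (iterate A k))⁻¹ *ᵥ A i := by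
  have hT' : (0 : ℝ) < T := by exact_mod_cast hT
  have hM := average_posDef hd hA hT
  set q := A i ⬝ᵥ (gram A (average A T))⁻¹ *ᵥ A i with hq
  set r : ℕ → ℝ := fun k => A i ⬝ᵥ (gram A (iterate A k))⁻¹ *ᵥ A i with hr
  have hq0 : 0 < q := by simpa using hM.inv.dotProduct_mulVec_pos hi
  have hr0 : ∀ k, 0 < r k := fun k => by
    simpa using (iterate_posDef hd hA k).inv.dotProduct_mulVec_pos hi
  have h1 : q * (∑ k ∈ Finset.range T, (r k)⁻¹) ≤ T := by
    have h := dotProduct_gram_average A T ((gram A (average A T))⁻¹ *ᵥ A i)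
    rw [mulVec_inv_mulVec hM, dotProduct_comm, ← hq, eq_div_iff hT'.ne'] at h
    -- Cauchy-Schwarz for `a` and `z = Q⁻¹ a`, where `Q` is the averaged matrix: `q² ≤ r_k · zᵀ Q_k
    -- z`. The sum of the `zᵀ Q_k z` is `T · zᵀ Q z = T q`.
    have h2 : ∑ k ∈ Finset.range T, q ^ 2 * (r k)⁻¹ ≤ q * T := by
      rw [h]
      refine Finset.sum_le_sum fun k _ => ?_
      rw [← div_eq_mul_inv, div_le_iff₀ (hr0 k), mul_comm]
      exact dotProduct_sq_le (iterate_posDef hd hA k) _ _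
    rw [← Finset.mul_sum, sq, mul_assoc] at h2
    exact le_of_mul_le_mul_left h2 hq0
  exact pow_le_prod_of_mul_sum_inv_le hT hq0.le hr0 h1

theorem iterate_eq_prod (A : Matrix (Fin n) (Fin d) ℝ) (T : ℕ) (i : Fin n) :
    iterate A T i =
      (d : ℝ) / n * ∏ k ∈ Finset.range T, A i ⬝ᵥ (gram A (iterate A k))⁻¹ *ᵥ A i := by
  induction T with
  | zero => simp [iterate]
  | succ T ih =>
    rw [Finset.prod_range_succ, ← mul_assoc, ← ih]
    rfl

/-- The product of the `r_k` telescopes to `(n / d) w_T`, where `w_T` is the iterate after the last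
one that is averaged. It need not be computed; only the bound `w_T ≤ 1` is used. -/
theorem isApproxJohn_average (hd : 0 < d) (hA : A.rank = d) {T : ℕ} (hT : 1 ≤ T) {ε : ℝ}
    (hε : 0 < ε) (h : (n : ℝ) / d ≤ (1 + ε) ^ T) : IsApproxJohn A ε (average A T) := by
  have hT' : (0 : ℝ) < T := by exact_mod_cast hT
  have hd' : (0 : ℝ) < d := by exact_mod_cast hd
  have hn' : (0 : ℝ) < n := by exact_mod_cast hd.trans_le (le_of_rank hA)
  refine ⟨fun i => div_nonneg (Finset.sum_nonneg fun k _ => (iterate_pos hd hA k).1 i) hT'.le, ?_,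
    average_posDef hd hA hT, fun i => ?_⟩
  · simp only [average]
    rw [← Finset.sum_div, Finset.sum_comm]
    simp only [sum_iterate hd hA, Finset.sum_const, Finset.card_range, nsmul_eq_mul]
    field_simp
  · by_cases hi : A i = 0
    · rw [hi, zero_dotProduct]
      positivity
    · refine le_of_pow_le_pow_left₀ (n := T) (by omega) (by positivity) (le_trans ?_ h)
      refine (leverage_average_pow_le hd hA hT hi).trans ?_
      have h1 : iterate A T i ≤ 1 := by
        cases T with
        | zero => omega
        | succ k => exact leverage_le_one (iterate_posDef hd hA k) (iterate_pos hd hA k).1 i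
      rw [iterate_eq_prod] at h1
      rw [le_div_iff₀ hd']
      rw [div_mul_eq_mul_div, div_le_one hn'] at h1
      linarith

theorem transpose_mul_scaledMatrix (hw : ∀ i, 0 ≤ w i) :
    (scaledMatrix A w)ᵀ * scaledMatrix A w = gram A w := by
  ext u v
  rw [mul_apply, gram_apply]
  refine Finset.sum_congr rfl fun i _ => ?_
  simp only [scaledMatrix, transpose_apply, diagonal_mul]
  rw [mul_mul_mul_comm, Real.mul_self_sqrt (hw i), mul_assoc]

/-- The average of the iterates is the result of the fixed point iteration in the form that makes
the sparse Cholesky factorizations and triangular solves explicit. -/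
theorem isIterationOutput_average (hd : 0 < d) (hA : A.rank = d) {ord : Equiv.Perm (Fin d)}
    {bagOf : Fin d → List (Fin d)} {P : Fin d → Fin d → Prop} (hE : ElimPattern ord bagOf P)
    (hP : ∀ i u v, A i u ≠ 0 → A i v ≠ 0 → P u v) {s : ℕ} (hs : ∀ v, (bagOf v).length ≤ s)
    (T : ℕ) : IsIterationOutput A s T (average A T) := by
  have hpat : ∀ k u v, gram A (iterate A k) u v ≠ 0 → P u v := fun k u v h => by
    rw [gram_apply] at h
    obtain ⟨i, _, hi⟩ := Finset.exists_ne_zero_of_sum_ne_zero h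
    exact hP i u v (right_ne_zero_of_mul (left_ne_zero_of_mul hi)) (right_ne_zero_of_mul hi)
  choose X L hL using fun k => exists_cholState hE (iterate_posDef hd hA k) (hpat k)
  refine ⟨Fin.revPerm.trans ord, iterate A, fun k => (L k).submatrix (Fin.revPerm.trans ord)
    (Fin.revPerm.trans ord), fun _ => rfl, fun k _ => ⟨?_, (hL k).ncard_column_le hs, fun i => ?_⟩,
    fun i => rfl⟩
  · rw [transpose_mul_scaledMatrix (iterate_pos hd hA k).1]
    exact (hL k).isCholesky
  · have hM := iterate_posDef hd hA k
    set b := scaledMatrix A (iterate A k) i with hb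
    have hb' : b = √(iterate A k i) • A i := by
      ext j
      simp [hb, scaledMatrix, diagonal_mul]
    -- With `M = L Lᵀ`, the vector `y = Lᵀ M⁻¹ b` satisfies `L y = b` and `y ⬝ᵥ y = bᵀ M⁻¹ b`. The
    -- composition puts `y` in the order of elimination.
    refine ⟨((L k)ᵀ *ᵥ ((gram A (iterate A k))⁻¹ *ᵥ b)) ∘ (Fin.revPerm.trans ord), ?_, ?_⟩
    · rw [submatrix_mulVec_equiv]
      ext j
      simp only [Function.comp_apply, Equiv.self_comp_symm, Function.comp_assoc,
        Function.comp_id, mulVec_mulVec]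
      rw [← Matrix.mul_assoc, (hL k).final.2,
        mul_nonsing_inv _ ((isUnit_iff_isUnit_det _).1 hM.isUnit), one_mulVec]
    · rw [comp_equiv_dotProduct_comp_equiv, dotProduct_mulVec, vecMul_transpose, mulVec_mulVec,
        (hL k).final.2, mulVec_inv_mulVec hM, hb']
      simp only [mulVec_smul, dotProduct_smul, smul_dotProduct, smul_eq_mul]
      rw [← mul_assoc, Real.mul_self_sqrt ((iterate_pos hd hA k).1 i)]
      rfl

end FixedPoint

/-! ### Rooted tree decompositions and elimination orders -/

namespace TreeDecomposition

variable {d N : ℕ} {G : SimpleGraph (Fin d)}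

theorem card_bag_le {ι : Type} [Fintype ι] (D : TreeDecomposition G ι) (t : ι) :
    (D.bag t).card ≤ D.width + 1 := by
  have := Finset.le_sup (f := fun t => (D.bag t).card) (Finset.mem_univ t)
  rw [width]
  omega

theorem width_le {ι : Type} [Fintype ι] (D : TreeDecomposition G ι) {s : ℕ}
    (h : ∀ t, (D.bag t).card ≤ s + 1) : D.width ≤ s := by
  have : (Finset.univ.sup fun t => (D.bag t).card) ≤ s + 1 := Finset.sup_le fun t _ => h t
  rw [width]
  omega

/-- The nodes of a tree decomposition can be numbered from a root outwards. -/
theorem exists_rootedOrder (D : TreeDecomposition G (Fin N)) :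
    ∃ D' : TreeDecomposition G (Fin N), D'.RootedOrder ∧
      ∀ t, (D'.bag t).card ≤ D.width + 1 := by
  obtain ⟨r⟩ := D.isTree.connected.nonempty
  -- The nodes are sorted by their distance from `r`. The second node on a shortest walk from a node
  -- to `r` is strictly closer, so it gets a smaller number.
  let f : Fin N → ℕ := fun t => D.tree.dist t r
  let e : Equiv.Perm (Fin N) := Tuple.sort f
  have he : Monotone (f ∘ e) := Tuple.monotone_sort f
  have hlt : ∀ a b, f a < f b → e.symm a < e.symm b := fun a b hab => by
    by_contra h
    have := he (not_lt.1 h)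
    simp only [Function.comp_apply, Equiv.apply_symm_apply] at this
    omega
  refine ⟨{ tree := D.tree.comap e,
            isTree := (SimpleGraph.Iso.comap e D.tree).isTree_iff.2 D.isTree,
            bag := fun t => D.bag (e t), cover := fun v => ?_, edge_mem := fun u v huv => ?_,
            connected := fun v => ?_ }, fun k hk => ?_, fun t => D.card_bag_le _⟩
  · obtain ⟨t, ht⟩ := D.cover v
    exact ⟨e.symm t, by simpa using ht⟩
  · obtain ⟨t, ht⟩ := D.edge_mem u v huv
    exact ⟨e.symm t, by simpa using ht⟩
  · let i : (D.tree.comap e).induce {t | v ∈ D.bag (e t)} ≃g D.tree.induce {t | v ∈ D.bag t} :=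
      { toEquiv := e.subtypeEquiv fun _ => Iff.rfl
        map_rel_iff' := Iff.rfl }
    exact i.connected_iff.2 (D.connected v)
  · have hr : e k ≠ r := by
      intro h
      have h0 : f (e k) = 0 := by simp [f, h]
      have hk0 : e ⟨0, by omega⟩ = e k := by
        have h1 : f (e ⟨0, by omega⟩) ≤ f (e k) := he (Fin.mk_le_of_le_val (Nat.zero_le _))
        rw [h]
        exact D.isTree.connected.dist_eq_zero_iff.1 (show f _ = 0 by omega)
      have := e.injective hk0
      rw [← this] at hk
      exact lt_irrefl _ hk
    obtain ⟨p, hp⟩ := D.isTree.connected.exists_walk_length_eq_dist (e k) r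
    generalize hx : e k = x at p hr hp
    cases p with
    | nil => exact absurd rfl hr
    | @cons _ y _ hadj p =>
      subst hx
      refine ⟨e.symm y, ?_, ?_⟩
      · have := hlt y (e k) ((SimpleGraph.dist_le p).trans_lt (by
          rw [SimpleGraph.Walk.length_cons] at hp
          change _ < D.tree.dist (e k) r
          omega))
        simpa using this
      · simpa using hadj.symm

/-- In a rooted tree, the edges lead from the nodes to their parents. -/
theorem RootedOrder.exists_parent {D : TreeDecomposition G (Fin N)} (hD : D.RootedOrder) :
    ∃ par : Fin N → Fin N, (∀ k, par k ≤ k) ∧ (∀ k : Fin N, 0 < (k : ℕ) → par k < k) ∧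
      ∀ a b, D.tree.Adj a b → a < b → a = par b := by
  have hN : 0 < N := Fin.pos_iff_nonempty.2 D.isTree.connected.nonempty
  obtain ⟨M, rfl⟩ := Nat.exists_eq_succ_of_ne_zero hN.ne'
  have hD' : ∀ k : Fin (M + 1), ∃ j, j ≤ k ∧ (0 < (k : ℕ) → j < k ∧ D.tree.Adj j k) := fun k => by
    by_cases hk : 0 < (k : ℕ)
    · obtain ⟨j, hj, hjk⟩ := hD k hk
      exact ⟨j, hj.le, fun _ => ⟨hj, hjk⟩⟩
    · exact ⟨k, le_rfl, fun h => absurd h hk⟩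
  choose par hle hpar using hD'
  refine ⟨par, hle, fun k hk => (hpar k hk).1, fun a b hab hlt' => ?_⟩
  -- The edges to the parents are `M` distinct edges of a tree with `M + 1` nodes, so there are no
  -- others.
  let f : Fin M → D.tree.edgeSet :=
    fun k => ⟨s(par k.succ, k.succ), (hpar k.succ (Nat.succ_pos _)).2⟩
  have hlt : ∀ k : Fin M, par k.succ < k.succ := fun k => (hpar k.succ (Nat.succ_pos _)).1
  have hf : Function.Injective f := by
    intro k k' h
    have h' : s(par k.succ, k.succ) = s(par k'.succ, k'.succ) := congrArg Subtype.val h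
    rw [Sym2.eq_iff] at h'
    rcases h' with h' | h'
    · exact Fin.succ_injective _ h'.2
    · have h1 := hlt k
      have h2 := hlt k'
      rw [h'.1] at h1
      rw [← h'.2] at h2
      exact absurd (h1.trans h2) (lt_irrefl _)
  have hcard : Nat.card D.tree.edgeSet ≤ Nat.card (Fin M) := by
    have h1 := (SimpleGraph.isTree_iff_connected_and_card.1 D.isTree).2
    rw [Nat.card_eq_fintype_card (α := Fin _), Fintype.card_fin] at h1
    rw [Nat.card_eq_fintype_card (α := Fin _), Fintype.card_fin]
    omega
  obtain ⟨k, hk⟩ := (hf.bijective_of_nat_card_le hcard).2 ⟨s(a, b), hab⟩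
  have hk' : s(par k.succ, k.succ) = s(a, b) := congrArg Subtype.val hk
  rw [Sym2.eq_iff] at hk'
  rcases hk' with h | h
  · rw [← h.1, ← h.2]
  · have := hlt k
    rw [h.1, h.2] at this
    exact absurd (this.trans hlt') (lt_irrefl _)

/-- The node with the smallest number whose bag contains `v`. -/
def top (D : TreeDecomposition G (Fin N)) (v : Fin d) : Fin N :=
  (Finset.univ.filter fun t => v ∈ D.bag t).min' (by
    obtain ⟨t, ht⟩ := D.cover v
    exact ⟨t, by simpa using ht⟩)

theorem mem_bag_top (D : TreeDecomposition G (Fin N)) (v : Fin d) : v ∈ D.bag (D.top v) :=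
   (Finset.mem_filter.1 ((Finset.univ.filter fun t => v ∈ D.bag t).min'_mem _)).2

theorem top_le (D : TreeDecomposition G (Fin N)) {v : Fin d} {t : Fin N} (h : v ∈ D.bag t) :
    D.top v ≤ t :=
  Finset.min'_le _ _ (by simpa using h)

/-- A vertex in the bag of a node is in the bag of the parent, unless the node is the top node of
the vertex. -/
theorem mem_bag_parent (D : TreeDecomposition G (Fin N)) {par : Fin N → Fin N}
    (hle : ∀ k, par k ≤ k) (hpar : ∀ a b, D.tree.Adj a b → a < b → a = par b) {v : Fin d}
    {t : Fin N} (h : v ∈ D.bag t) (ht : t ≠ D.top v) : v ∈ D.bag (par t) := by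
  by_contra hcon
  have hreach := (D.connected v).preconnected ⟨t, h⟩ ⟨D.top v, D.mem_bag_top v⟩
  -- Inside the subtree of `v`, every node reached from `t` has `t` as an ancestor: the only step
  -- that could leave the descendants of `t` goes to `par t`, whose bag is assumed not to contain
  -- `v`. Applied to the top node this gives `t ≤ D.top v`.
  have key : ∀ x : {t | v ∈ D.bag t}, (D.tree.induce {t | v ∈ D.bag t}).Reachable ⟨t, h⟩ x →
      ∃ j, par^[j] x = t := by
    intro x hx
    rw [SimpleGraph.reachable_iff_reflTransGen] at hx
    induction hx with
    | refl => exact ⟨0, rfl⟩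
    | @tail b c _ hbc ih =>
      obtain ⟨j, hj⟩ := ih
      have hbc' : D.tree.Adj b c := hbc
      rcases lt_trichotomy (b : Fin N) c with hlt | heq | hgt
      · exact ⟨j + 1, by rw [Function.iterate_succ_apply, ← hpar _ _ hbc' hlt, hj]⟩
      · exact absurd heq hbc'.ne
      · have hc := hpar _ _ hbc'.symm hgt
        cases j with
        | zero =>
          rw [Function.iterate_zero_apply] at hj
          rw [hj] at hc
          exact absurd (hc ▸ c.2) hcon
        | succ j => exact ⟨j, by rw [hc, ← Function.iterate_succ_apply, hj]⟩
  obtain ⟨j, hj⟩ := key _ hreach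
  have := Function.iterate_le_id_of_le_id (f := par) hle j (D.top v)
  rw [hj] at this
  exact ht (le_antisymm this (D.top_le h))

/-- Starting from a common bag, climb towards the root until the top node of `v`. Neither vertex is
lost on the way, because all nodes before the end are larger than both top nodes. -/
theorem RootedOrder.mem_bag_top {D : TreeDecomposition G (Fin N)} (hD : D.RootedOrder)
    {u v : Fin d} {t : Fin N} (hu : u ∈ D.bag t) (hv : v ∈ D.bag t) (huv : D.top u ≤ D.top v) :
    u ∈ D.bag (D.top v) := by
  obtain ⟨par, hle, hlt, hpar⟩ := hD.exists_parent
  induction t using WellFoundedLT.induction with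
  | _ t ih =>
    by_cases ht : t = D.top v
    · exact ht ▸ hu
    · have htv := lt_of_le_of_ne (D.top_le hv) (Ne.symm ht)
      exact ih (par t) (hlt t (by rw [Fin.lt_def] at htv; omega))
        (D.mem_bag_parent hle hpar hu (huv.trans_lt htv).ne')
        (D.mem_bag_parent hle hpar hv ht)

/-- Two vertices have a common bag. -/
def Share (D : TreeDecomposition G (Fin N)) (u v : Fin d) : Prop := ∃ t, u ∈ D.bag t ∧ v ∈ D.bag t

/-- The bag of the top node of a vertex. -/
def topBag (D : TreeDecomposition G (Fin N)) (v : Fin d) : List (Fin d) :=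
  (List.finRange d).filter fun u => u ∈ D.bag (D.top v)

theorem mem_topBag {D : TreeDecomposition G (Fin N)} {u v : Fin d} :
    u ∈ D.topBag v ↔ u ∈ D.bag (D.top v) := by
  simp [topBag]

theorem length_filter_finRange (s : Finset (Fin d)) :
    ((List.finRange d).filter fun u => u ∈ s).length = s.card := by
  rw [← List.toFinset_card_of_nodup ((List.nodup_finRange d).filter _)]
  congr 1
  ext u
  simp

theorem length_topBag_le (D : TreeDecomposition G (Fin N)) (v : Fin d) :
    (D.topBag v).length ≤ D.width + 1 := by
  rw [topBag, length_filter_finRange]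
  exact D.card_bag_le _

/-- Sorting by top nodes, and eliminating from the end, is a perfect elimination order for the
chordal graph in which every bag is a clique. -/
theorem RootedOrder.elimPattern {D : TreeDecomposition G (Fin N)} (hD : D.RootedOrder)
    {ord : Equiv.Perm (Fin d)} (hord : Monotone (D.top ∘ ord)) :
    ElimPattern ord D.topBag D.Share where
  nodup v := (List.nodup_finRange d).filter _
  self_mem v := mem_topBag.2 (D.mem_bag_top v)
  share v u w hu hw := ⟨_, mem_topBag.1 hu, mem_topBag.1 hw⟩
  symm := fun _ _ ⟨t, h⟩ => ⟨t, h.symm⟩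
  later := fun v u h ⟨t, hu, hv⟩ => mem_topBag.2 (hD.mem_bag_top hu hv (by simpa using hord h))

end TreeDecomposition

/-- A numbering in which every number but the first has a parent with a smaller number is a
tree. -/
theorem isTree_of_parent {d : ℕ} (hd : 0 < d) (par : Fin d → Fin d)
    (hpar : ∀ k : Fin d, 0 < (k : ℕ) → par k < k) :
    (SimpleGraph.fromRel fun j k : Fin d => 0 < (k : ℕ) ∧ j = par k).IsTree := by
  set T := SimpleGraph.fromRel fun j k : Fin d => 0 < (k : ℕ) ∧ j = par k with hT
  have hconn : T.Connected := by
    have hreach : ∀ k, T.Reachable ⟨0, hd⟩ k := by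
      intro k
      induction k using WellFoundedLT.induction with
      | _ k ih =>
        by_cases hk : 0 < (k : ℕ)
        · refine (ih _ (hpar k hk)).trans (SimpleGraph.Adj.reachable ?_)
          rw [hT, SimpleGraph.fromRel_adj]
          exact ⟨(hpar k hk).ne, Or.inl ⟨hk, rfl⟩⟩
        · have : k = ⟨0, hd⟩ := Fin.ext (by simp only; omega)
          rw [this]
    have : Nonempty (Fin d) := ⟨⟨0, hd⟩⟩
    exact ⟨fun a b => (hreach a).symm.trans (hreach b)⟩
  rw [SimpleGraph.isTree_iff_connected_and_card]
  refine ⟨hconn, le_antisymm ?_ hconn.card_vert_le_card_edgeSet_add_one⟩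
  obtain ⟨M, rfl⟩ := Nat.exists_eq_succ_of_ne_zero hd.ne'
  have hadj : ∀ k : Fin M, T.Adj (par k.succ) k.succ := fun k => by
    rw [hT, SimpleGraph.fromRel_adj]
    exact ⟨(hpar _ (Nat.succ_pos _)).ne, Or.inl ⟨Nat.succ_pos _, rfl⟩⟩
  let f : Fin M → T.edgeSet := fun k => ⟨s(par k.succ, k.succ), hadj k⟩
  have hf : Function.Surjective f := by
    rintro ⟨e, he⟩
    induction e using Sym2.ind with
    | _ a b =>
      rw [SimpleGraph.mem_edgeSet, hT, SimpleGraph.fromRel_adj] at he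
      rcases he.2 with h | h
      · obtain ⟨k, rfl⟩ := Fin.exists_succ_eq.2 (Fin.pos_iff_ne_zero.1 (Fin.lt_def.2 h.1))
        exact ⟨k, Subtype.ext (congrArg (fun x => s(x, k.succ)) h.2.symm)⟩
      · obtain ⟨k, rfl⟩ := Fin.exists_succ_eq.2 (Fin.pos_iff_ne_zero.1 (Fin.lt_def.2 h.1))
        exact ⟨k, Subtype.ext ((congrArg (fun x => s(x, k.succ)) h.2.symm).trans Sym2.eq_swap)⟩
  have := Nat.card_le_card_of_surjective f hf
  rw [Nat.card_eq_fintype_card (α := Fin _), Fintype.card_fin] at this ⊢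
  omega

/-! ### Reduction to one bag for each vertex, and attainment of the treewidth -/

namespace TreeDecomposition

variable {d N : ℕ} {G : SimpleGraph (Fin d)}

/-- A rooted tree decomposition can be cut down to one bag for each vertex. -/
theorem RootedOrder.exists_small {D : TreeDecomposition G (Fin N)} (hD : D.RootedOrder)
    (hd : 0 < d) : ∃ D' : TreeDecomposition G (Fin d), D'.RootedOrder ∧ D'.width ≤ D.width := by
  classical
  let ord : Equiv.Perm (Fin d) := Tuple.sort D.top
  have hE : ElimPattern ord D.topBag D.Share := hD.elimPattern (Tuple.monotone_sort D.top)
  -- Node `k` receives the vertex at position `k` together with its neighbours that are eliminated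
  -- after it.
  let bag : Fin d → Finset (Fin d) := fun k =>
    (D.topBag (ord k)).toFinset.filter fun u => ord.symm u ≤ k
  have hbag : ∀ u k, u ∈ bag k ↔ u ∈ D.topBag (ord k) ∧ ord.symm u ≤ k := fun u k => by
    simp [bag]
  have hpar : ∀ k : Fin d, ∃ j, 0 < (k : ℕ) → j < k ∧
      ∀ u ∈ bag k, ord.symm u < k → u ∈ bag j := by
    intro k
    by_cases hk : 0 < (k : ℕ)
    · by_cases hne : (Finset.univ.filter fun j => j < k ∧ ord j ∈ bag k).Nonempty
      -- The parent is the last position before `k` that occurs in the bag. The other earlier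
      -- vertices of the bag share a bag with `ord j` and do not come after it, so they are in bag
      -- `j`.
      · obtain ⟨j, hj, hmax⟩ := Finset.exists_max_image _ id hne
        rw [Finset.mem_filter] at hj
        refine ⟨j, fun _ => ⟨hj.2.1, fun u hu huk => ?_⟩⟩
        have hle : ord.symm u ≤ j := hmax _ (by simpa using ⟨huk, hu⟩)
        rw [hbag]
        refine ⟨hE.later _ _ (by simpa using hle) ?_, hle⟩
        exact hE.share (ord k) _ _ ((hbag _ _).1 hu).1 ((hbag _ _).1 hj.2.2).1
      -- The bag consists of `ord k` alone, so there is no vertex to pass on and the node can be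
      -- attached to the root.
      · refine ⟨⟨0, hd⟩, fun _ => ⟨Fin.lt_def.2 hk, fun u hu huk => ?_⟩⟩
        exact absurd ⟨ord.symm u, by simpa using ⟨huk, hu⟩⟩ hne
    · exact ⟨k, fun h => absurd h hk⟩
  choose par hpar using hpar
  have hself : ∀ v, v ∈ bag (ord.symm v) := fun v => by
    rw [hbag]
    exact ⟨by simpa using hE.self_mem v, le_rfl⟩
  refine ⟨{ tree := _, isTree := isTree_of_parent hd par fun k hk => (hpar k hk).1, bag := bag,
            cover := fun v => ⟨_, hself v⟩, edge_mem := fun u v huv => ?_,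
            connected := fun v => ?_ },
    fun k hk => ⟨par k, (hpar k hk).1, ?_⟩, width_le _ fun k => ?_⟩
  · have hS : D.Share u v := D.edge_mem u v huv
    rcases le_total (ord.symm u) (ord.symm v) with h | h
    · exact ⟨ord.symm v, (hbag _ _).2 ⟨by simpa using hE.later v u h hS, h⟩, hself v⟩
    · exact ⟨ord.symm u, hself u,
        (hbag _ _).2 ⟨by simpa using hE.later u v h (hE.symm _ _ hS), h⟩⟩
  · set T := SimpleGraph.fromRel fun j k : Fin d => 0 < (k : ℕ) ∧ j = par k with hT
    have hreach : ∀ k (hk : v ∈ bag k), (T.induce {t | v ∈ bag t}).Reachable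
        ⟨ord.symm v, hself v⟩ ⟨k, hk⟩ := by
      intro k
      induction k using WellFoundedLT.induction with
      | _ k ih =>
        intro hk
        rcases ((hbag v k).1 hk).2.eq_or_lt with h | h
        · have : (⟨k, hk⟩ : {t | v ∈ bag t}) = ⟨ord.symm v, hself v⟩ := Subtype.ext h.symm
          rw [this]
        · have hk0 : 0 < (k : ℕ) := by
            rw [Fin.lt_def] at h
            omega
          obtain ⟨h1, h2⟩ := hpar k hk0
          refine (ih _ h1 (h2 v hk h)).trans (SimpleGraph.Adj.reachable ?_)
          rw [SimpleGraph.comap_adj, hT, SimpleGraph.fromRel_adj]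
          exact ⟨h1.ne, Or.inl ⟨hk0, rfl⟩⟩
    have : Nonempty {t | v ∈ bag t} := ⟨⟨_, hself v⟩⟩
    exact ⟨fun a b => (hreach a a.2).symm.trans (hreach b b.2)⟩
  · rw [SimpleGraph.fromRel_adj]
    exact ⟨(hpar k hk).1.ne, Or.inl ⟨hk, rfl⟩⟩
  · exact (Finset.card_filter_le _ _).trans
      ((List.toFinset_card_le _).trans (D.length_topBag_le _))

end TreeDecomposition

/-- Treewidth is attained by a rooted tree decomposition with at most one bag for each vertex. -/
theorem exists_treeDecomposition_width_eq {d : ℕ} (G : SimpleGraph (Fin d)) (hd : 0 < d) :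
    ∃ D : TreeDecomposition G (Fin d), D.RootedOrder ∧ D.width = treewidth G := by
  -- The decomposition with a single bag shows that the infimum defining the treewidth is attained,
  -- and is not the default value for an empty set.
  have hne : {w : ℕ | ∃ (N : ℕ) (D : TreeDecomposition G (Fin N)), D.width = w}.Nonempty :=
    ⟨_, 1, { tree := ⊥, isTree := by
               refine ⟨⟨fun a b => ?_⟩, ?_⟩
               · rw [Subsingleton.elim a b]
               · exact SimpleGraph.isAcyclic_bot
             bag := fun _ => Finset.univ
             cover := fun v => ⟨0, Finset.mem_univ v⟩
             edge_mem := fun u v _ => ⟨0, Finset.mem_univ u, Finset.mem_univ v⟩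
             connected := fun v => by
               have : Nonempty {t : Fin 1 | v ∈ (Finset.univ : Finset (Fin d))} :=
                 ⟨⟨0, Finset.mem_univ v⟩⟩
               refine ⟨fun a b => ?_⟩
               rw [Subsingleton.elim a b] }, rfl⟩
  obtain ⟨N, D, hD⟩ := Nat.sInf_mem hne
  obtain ⟨D₁, h₁, hw₁⟩ := D.exists_rootedOrder
  obtain ⟨D₂, h₂, hw₂⟩ := h₁.exists_small hd
  exact ⟨D₂, h₂, le_antisymm ((hw₂.trans (D₁.width_le hw₁)).trans hD.le)
    (Nat.sInf_le ⟨d, D₂, rfl⟩)⟩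

section Memory

/-! ### Matrices in memory -/

/-- The `d × d` matrix that is stored, row by row, in a real array. -/
def Store.mat (s : Store) (d a : ℕ) : Matrix (Fin d) (Fin d) ℝ := fun u v => s.rarr a (u * d + v)

theorem address_inj {d : ℕ} {u v u' v' : Fin d} (h : (u : ℕ) * d + v = u' * d + v') :
    u = u' ∧ v = v' := by
  have hd : 0 < d := u.pos
  have h1 : ((u : ℕ) * d + v) / d = u := by
    rw [mul_comm, Nat.mul_add_div hd, Nat.div_eq_of_lt v.2, add_zero]
  have h2 : ((u' : ℕ) * d + v') / d = u' := by
    rw [mul_comm, Nat.mul_add_div hd, Nat.div_eq_of_lt v'.2, add_zero]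
  have hu : (u : ℕ) = u' := by rw [← h1, ← h2, h]
  rw [hu] at h
  exact ⟨Fin.ext hu, Fin.ext (by omega)⟩

theorem Store.mat_putR {d : ℕ} (s : Store) (a : ℕ) (u v : Fin d) (x : ℝ) :
    (s.putR a (u * d + v) x).mat d a =
      fun u' v' => if u' = u ∧ v' = v then x else s.mat d a u' v' := by
  ext u' v'
  simp only [Store.mat, Store.putR, Function.update_self]
  by_cases h : u' = u ∧ v' = v
  · rw [h.1, h.2, Function.update_self, if_pos ⟨rfl, rfl⟩]
  · rw [Function.update_of_ne (fun h' => h (address_inj h')), if_neg h]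

theorem Store.mat_congr {s s' : Store} {a : ℕ} (d : ℕ) (h : s'.rarr a = s.rarr a) :
    s'.mat d a = s.mat d a := by
  ext u v
  simp only [Store.mat, h]

/-- In this form an accumulating loop has a sum of `Matrix.single` terms as its invariant, and
`sum_sum_single_apply` reads off the entries at the end. -/
theorem Store.mat_putR_add {d : ℕ} (s : Store) (a : ℕ) (u v : Fin d) (x : ℝ) :
    (s.putR a (u * d + v) (s.mat d a u v + x)).mat d a = s.mat d a + Matrix.single u v x := by
  rw [Store.mat_putR]
  ext u' v'
  rw [Matrix.add_apply, Matrix.single_apply]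
  by_cases h : u' = u ∧ v' = v
  · rw [if_pos h, if_pos ⟨h.1.symm, h.2.symm⟩, h.1, h.2]
  · rw [if_neg h, if_neg fun h' => h ⟨h'.1.symm, h'.2.symm⟩, add_zero]

theorem sum_sum_single_apply {d : ℕ} {l : List (Fin d)} (hl : l.Nodup) (f : Fin d → Fin d → ℝ)
    (u v : Fin d) :
    (l.map fun a => (l.map fun b => Matrix.single a b (f a b)).sum).sum u v =
      if u ∈ l ∧ v ∈ l then f u v else 0 := by
  simp only [← List.sum_toFinset _ hl, Matrix.sum_apply, Matrix.single_apply, ite_and,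
    Finset.sum_ite_irrel, Finset.sum_const_zero, Finset.sum_ite_eq', List.mem_toFinset]

open Classical in
/-- The columns of the non-zero entries of a row. -/
def rowSupport {n d : ℕ} (A : Matrix (Fin n) (Fin d) ℝ) (i : Fin n) : List (Fin d) :=
  (List.finRange d).filter fun j => A i j ≠ 0

theorem mem_rowSupport {n d : ℕ} {A : Matrix (Fin n) (Fin d) ℝ} {i : Fin n} {j : Fin d} :
    j ∈ rowSupport A i ↔ A i j ≠ 0 := by
  simp [rowSupport]

theorem nodup_rowSupport {n d : ℕ} (A : Matrix (Fin n) (Fin d) ℝ) (i : Fin n) :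
    (rowSupport A i).Nodup :=
  (List.nodup_finRange d).filter _

/-- The data that stay in memory during the iteration: the matrix in compressed sparse row format,
an elimination order, and for each vertex `v` the list `bagOf v`. -/
structure Static {n d : ℕ} (A : Matrix (Fin n) (Fin d) ℝ) (ord : Equiv.Perm (Fin d))
    (bagOf : Fin d → List (Fin d)) (s : Store) : Prop where
  n_eq : s.nvar 0 = n
  d_eq : s.nvar 1 = d
  row_next : ∀ i : Fin n, s.narr 0 ((i : ℕ) + 1) = s.narr 0 i + (rowSupport A i).length
  row_col : ∀ (i : Fin n) (k : ℕ) (hk : k < (rowSupport A i).length),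
    s.narr 1 (s.narr 0 i + k) = (rowSupport A i)[k]
  row_val : ∀ (i : Fin n) (k : ℕ) (hk : k < (rowSupport A i).length),
    s.rarr 0 (s.narr 0 i + k) = A i (rowSupport A i)[k]
  -- Array `7` holds the number of the top node plus one, so it points to the end of the bag of `v`,
  -- and one less points to its start.
  bag_next : ∀ v : Fin d, s.narr 3 (s.narr 7 v) = s.narr 3 (s.narr 7 v - 1) + (bagOf v).length
  bag_get : ∀ (v : Fin d) (k : ℕ) (hk : k < (bagOf v).length),
    s.narr 4 (s.narr 3 (s.narr 7 v - 1) + k) = (bagOf v)[k]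
  base : ∀ u : Fin d, s.narr 5 u = u * d
  ord_eq : ∀ q : Fin d, s.narr 6 q = ord q

/-- The program leaves the static data and the variables in `l` unchanged. -/
abbrev Program.Keeps (p : Program) (l : List ℕ) : Prop :=
  (∀ x ∈ 0 :: 1 :: l, x ∉ p.wN) ∧ p.wNA = [] ∧ 0 ∉ p.wRA

variable {n d : ℕ} {A : Matrix (Fin n) (Fin d) ℝ} {ord : Equiv.Perm (Fin d)}
  {bagOf : Fin d → List (Fin d)} {s s' : Store}

theorem Static.congr (h : Static A ord bagOf s) (h0 : s'.nvar 0 = s.nvar 0)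
    (h1 : s'.nvar 1 = s.nvar 1) (hn : s'.narr = s.narr) (hr : s'.rarr 0 = s.rarr 0) :
    Static A ord bagOf s' where
  n_eq := h0.trans h.n_eq
  d_eq := h1.trans h.d_eq
  row_next := by rw [hn]; exact h.row_next
  row_col := by rw [hn]; exact h.row_col
  row_val := by rw [hn, hr]; exact h.row_val
  bag_next := by rw [hn]; exact h.bag_next
  bag_get := by rw [hn]; exact h.bag_get
  base := by rw [hn]; exact h.base
  ord_eq := by rw [hn]; exact h.ord_eq

theorem Static.frame (h : Static A ord bagOf s) {p : Program} {l : List ℕ} (hf : Frame p s s')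
    (hp : p.Keeps l) : Static A ord bagOf s' :=
  h.congr (hf.n 0 (hp.1 0 (by simp))) (hf.n 1 (hp.1 1 (by simp)))
    (funext fun x => hf.na x (by rw [hp.2.1]; simp)) (hf.ra 0 hp.2.2)

/-- An entry of a matrix. -/
def at2 (a : ℕ) (i j : NExpr) : RExpr := .get a (.add (.get 5 i) j)

/-- Assignment to an entry of a matrix. -/
def put2 (a : ℕ) (i j : NExpr) (e : RExpr) : Program := .putR a (.add (.get 5 i) j) e

theorem Static.eval_at2 (h : Static A ord bagOf s) {i j : NExpr} {u v : Fin d}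
    (hi : i.eval s = u) (hj : j.eval s = v) (a : ℕ) : (at2 a i j).eval s = s.mat d a u v := by
  simp only [at2, RExpr.eval, NExpr.eval, hi, hj, h.base, Store.mat]

theorem Static.runs_put2 (h : Static A ord bagOf s) {i j : NExpr} {u v : Fin d}
    (hi : i.eval s = u) (hj : j.eval s = v) {a : ℕ} {e : RExpr} {Q : Store → Prop}
    (hQ : Q (s.putR a (u * d + v) (e.eval s))) :
    Runs (put2 a i j e) s (i.cost + j.cost + e.cost + 3) Q := by
  refine (Runs.putR ?_).mono (c := (NExpr.add (.get 5 i) j).cost + e.cost + 1) ?_ fun _ h => h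
  · simpa only [NExpr.eval, hi, hj, h.base] using hQ
  · simp only [NExpr.cost]
    omega

/-- A loop through the non-zero entries of the row in variable `5`. -/
def rowLoop (x : ℕ) (body : Program) : Program :=
  .seq (.setN x (.get 0 (.var 5))) (countLoop x (.get 0 (.add (.var 5) (.const 1))) body)

/-- A loop through the bag of the vertex in variable `9`. -/
def bagLoop (x : ℕ) (body : Program) : Program :=
  .seq (.setN x (.get 3 (.sub (.get 7 (.var 9)) (.const 1))))
    (countLoop x (.get 3 (.get 7 (.var 9))) body)

theorem Store.setN_nvar_self (s : Store) (x v : ℕ) : (s.setN x v).nvar x = v := by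
  simp [Store.setN]

theorem Store.setN_nvar_of_ne (s : Store) {x y : ℕ} (v : ℕ) (h : y ≠ x) :
    (s.setN x v).nvar y = s.nvar y := by
  simp [Store.setN, h]

/-- The invariant depends on the list of columns already treated, and not on addresses. It must hold
for every value of the counter `x`, so that the increment needs no attention. The overhead of `11`
in each round is `7` for the counting loop and `4` for the evaluation of the bound. -/
theorem Static.rowLoop (h : Static A ord bagOf s) {i : Fin n} (hi : s.nvar 5 = i) {x : ℕ}
    {body : Program} {c : ℕ} (I : List (Fin d) → Store → Prop) (hb : body.Keeps [5, x])
    (hx : x ≠ 0 ∧ x ≠ 1 ∧ x ≠ 5) (h₀ : ∀ v, I [] (s.setN x v))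
    (step : ∀ pre u s', u ∈ rowSupport A i → Frame (JohnEllipsoid.rowLoop x body) s s' →
      Static A ord bagOf s' → s'.nvar 5 = i → s'.narr 1 (s'.nvar x) = u →
      s'.rarr 0 (s'.nvar x) = A i u → I pre s' →
      Runs body s' c fun s'' => ∀ v, I (pre ++ [u]) (s''.setN x v)) :
    Runs (JohnEllipsoid.rowLoop x body) s ((rowSupport A i).length * (c + 11) + 10)
      (I (rowSupport A i)) := by
  have hframe : ∀ s', Frame (.seq body (.setN x (.add (.var x) (.const 1))))
      (s.setN x (s.narr 0 i)) s' → Static A ord bagOf s' ∧ s'.nvar 5 = i ∧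
        s'.narr = s.narr := by
    intro s' hf
    have hn : s'.narr = s.narr := funext fun y => hf.na y (by
      simp [Program.wNA, hb.2.1])
    have h5 : s'.nvar 5 = s.nvar 5 := (hf.n 5 (by
      simpa [Program.wN, hx.2.2.symm] using hb.1 5 (by simp))).trans
        (s.setN_nvar_of_ne _ hx.2.2.symm)
    refine ⟨h.congr ?_ ?_ hn (hf.ra 0 (by simpa [Program.wRA] using hb.2.2)), h5.trans hi, hn⟩
    · exact (hf.n 0 (by simpa [Program.wN, hx.1.symm] using hb.1 0 (by simp))).trans
        (s.setN_nvar_of_ne _ hx.1.symm)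
    · exact (hf.n 1 (by simpa [Program.wN, hx.2.1.symm] using hb.1 1 (by simp))).trans
        (s.setN_nvar_of_ne _ hx.2.1.symm)
  refine (Runs.seq_setN (c := _) (Q := I (rowSupport A i)) ?_).mono (c := 3 +
    ((rowSupport A i).length * (c + (NExpr.get 0 (.add (.var 5) (.const 1))).cost + 7) +
      ((NExpr.get 0 (.add (.var 5) (.const 1))).cost + 3))) ?_ fun _ h => h
  · simp only [NExpr.eval, hi]
    refine Runs.listLoop (rowSupport A i) (lo := s.narr 0 i) I (s.setN_nvar_self _ _) ?_
      (hb.1 x (by simp)) (h₀ _) ?_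
    · intro s' hf
      obtain ⟨hS, h5, hn⟩ := hframe s' ⟨hf.n, hf.r, hf.na, hf.ra⟩
      simp only [NExpr.eval, h5, hn, h.row_next]
    · intro k hk s' hf hxk hI
      obtain ⟨hS, h5, hn⟩ := hframe s' ⟨hf.n, hf.r, hf.na, hf.ra⟩
      refine (step _ _ s' (List.getElem_mem hk) ?_ hS h5 ?_ ?_ hI).mono le_rfl fun _ h => h _
      · have hf1 := (Exec.setN s x (.get 0 (.var 5))).frame.seq_left (q :=
          countLoop x (.get 0 (.add (.var 5) (.const 1))) body)
        simp only [NExpr.eval, hi] at hf1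
        exact hf1.trans hf.seq_right
      · rw [hxk, ← hS.row_col i k hk, hn]
      · rw [hxk, ← hS.row_val i k hk, hn]
  · simp only [NExpr.cost]
    have : (rowSupport A i).length * (c + (1 + 1 + 1 + 1) + 7) =
        (rowSupport A i).length * (c + 11) := by ring
    omega

theorem Static.bagLoop (h : Static A ord bagOf s) {i : Fin d} (hi : s.nvar 9 = i) {x : ℕ}
    {body : Program} {c : ℕ} (I : List (Fin d) → Store → Prop) (hb : body.Keeps [9, x])
    (hx : x ≠ 0 ∧ x ≠ 1 ∧ x ≠ 9) (h₀ : ∀ v, I [] (s.setN x v))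
    (step : ∀ pre u s', u ∈ bagOf i → Frame (JohnEllipsoid.bagLoop x body) s s' →
      Static A ord bagOf s' → s'.nvar 9 = i → s'.narr 4 (s'.nvar x) = u → I pre s' →
      Runs body s' c fun s'' => ∀ v, I (pre ++ [u]) (s''.setN x v)) :
    Runs (JohnEllipsoid.bagLoop x body) s ((bagOf i).length * (c + 11) + 12) (I (bagOf i)) := by
  have hframe : ∀ s', Frame (.seq body (.setN x (.add (.var x) (.const 1))))
      (s.setN x (s.narr 3 (s.narr 7 i - 1))) s' → Static A ord bagOf s' ∧ s'.nvar 9 = i ∧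
        s'.narr = s.narr := by
    intro s' hf
    have hn : s'.narr = s.narr := funext fun y => hf.na y (by
      simp [Program.wNA, hb.2.1])
    have h5 : s'.nvar 9 = s.nvar 9 := (hf.n 9 (by
      simpa [Program.wN, hx.2.2.symm] using hb.1 9 (by simp))).trans
        (s.setN_nvar_of_ne _ hx.2.2.symm)
    refine ⟨h.congr ?_ ?_ hn (hf.ra 0 (by simpa [Program.wRA] using hb.2.2)), h5.trans hi, hn⟩
    · exact (hf.n 0 (by simpa [Program.wN, hx.1.symm] using hb.1 0 (by simp))).trans
        (s.setN_nvar_of_ne _ hx.1.symm)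
    · exact (hf.n 1 (by simpa [Program.wN, hx.2.1.symm] using hb.1 1 (by simp))).trans
        (s.setN_nvar_of_ne _ hx.2.1.symm)
  refine (Runs.seq_setN (c := _) (Q := I (bagOf i)) ?_).mono (c := 6 +
    ((bagOf i).length * (c + (NExpr.get 3 (.get 7 (.var 9))).cost + 7) +
      ((NExpr.get 3 (.get 7 (.var 9))).cost + 3))) ?_ fun _ h => h
  · simp only [NExpr.eval, hi]
    refine Runs.listLoop (bagOf i) (lo := s.narr 3 (s.narr 7 i - 1)) I (s.setN_nvar_self _ _) ?_
      (hb.1 x (by simp)) (h₀ _) ?_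
    · intro s' hf
      obtain ⟨hS, h5, hn⟩ := hframe s' ⟨hf.n, hf.r, hf.na, hf.ra⟩
      simp only [NExpr.eval, h5, hn, h.bag_next]
    · intro k hk s' hf hxk hI
      obtain ⟨hS, h5, hn⟩ := hframe s' ⟨hf.n, hf.r, hf.na, hf.ra⟩
      refine (step _ _ s' (List.getElem_mem hk) ?_ hS h5 ?_ hI).mono le_rfl fun _ h => h _
      · have hf1 := (Exec.setN s x (.get 3 (.sub (.get 7 (.var 9)) (.const 1)))).frame.seq_left
          (q := countLoop x (.get 3 (.get 7 (.var 9))) body)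
        simp only [NExpr.eval, hi] at hf1
        exact hf1.trans hf.seq_right
      · rw [hxk, ← hS.bag_get i k hk, hn]
  · simp only [NExpr.cost]
    have : (bagOf i).length * (c + (1 + 1 + 1) + 7) ≤ (bagOf i).length * (c + 11) :=
      Nat.mul_le_mul le_rfl (by omega)
    omega

/-- A loop in which variable `5` runs through the numbers below the value of variable `y`. -/
def finLoop (y : ℕ) (body : Program) : Program :=
  .seq (.setN 5 (.const 0)) (countLoop 5 (.var y) body)

theorem Static.finLoop (h : Static A ord bagOf s) {N y : ℕ} {body : Program} {c : ℕ}
    (hy : s.nvar y = N) (hy5 : y ≠ 5) (I : ℕ → Store → Prop) (hb : body.Keeps [5, y])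
    (h₀ : I 0 (s.setN 5 0))
    (step : ∀ k : Fin N, ∀ s', Frame (JohnEllipsoid.finLoop y body) s s' → Static A ord bagOf s' →
      s'.nvar 5 = k → I k s' → Runs body s' c fun s'' => ∀ v, I (k + 1) (s''.setN 5 v)) :
    Runs (JohnEllipsoid.finLoop y body) s (N * (c + 8) + 6) (I N) := by
  refine (Runs.seq_setN (c := N * (c + 8) + 4) ?_).mono ?_ fun _ h => h
  · refine (Runs.countLoop (c := c) (m := N) (lo := 0) I (s.setN_nvar_self 5 0) ?_
      (hb.1 5 (by simp)) h₀ ?_).mono ?_ fun _ h => h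
    · intro s' hf
      rw [NExpr.eval, zero_add, ← hy]
      refine (hf.n y ?_).trans (s.setN_nvar_of_ne _ hy5)
      simpa [countLoop, Program.wN, hy5] using hb.1 y (by simp)
    · intro k hk s' hf hxk hI
      rw [zero_add] at hxk
      have hf' : Frame (JohnEllipsoid.finLoop y body) s s' :=
        (Exec.setN s 5 (.const 0)).frame.seq_left.trans hf.seq_right
      refine (step ⟨k, hk⟩ s' hf' ?_ hxk hI).mono le_rfl fun _ h => h _
      refine h.frame (l := []) hf' ⟨?_, ?_, ?_⟩
      · have h0 := hb.1 0 (by simp)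
        have h1 := hb.1 1 (by simp)
        simp [JohnEllipsoid.finLoop, countLoop, Program.wN, h0, h1]
      · simpa [JohnEllipsoid.finLoop, countLoop, Program.wNA] using hb.2.1
      · simpa [JohnEllipsoid.finLoop, countLoop, Program.wRA] using hb.2.2
    · simp only [NExpr.cost]
      rfl
  · simp only [NExpr.cost]
    omega

end Memory

section Factorization

/-! ### The parts of an iteration step -/

variable {n d : ℕ} {A : Matrix (Fin n) (Fin d) ℝ} {ord : Equiv.Perm (Fin d)}
  {bagOf : Fin d → List (Fin d)} {s s' : Store} {m : ℕ}

/-- The column of the current entry of `A`. -/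
abbrev colAt (x : ℕ) : NExpr := .get 1 (.var x)

/-- The current vertex of the bag. -/
abbrev vertexAt (x : ℕ) : NExpr := .get 4 (.var x)

/-- `X := X + w i • a i (a i)ᵀ`, with `X` in array `2` and `w` in array `3`. -/
def assembleRow : Program :=
  rowLoop 6 (rowLoop 7 (put2 2 (colAt 6) (colAt 7) (.add (at2 2 (colAt 6) (colAt 7))
    (.mul (.mul (.get 3 (.var 5)) (.get 0 (.var 6))) (.get 0 (.var 7))))))

theorem runs_assembleRow (h : Static A ord bagOf s) {i : Fin n} (hi : s.nvar 5 = i)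
    (hm : (rowSupport A i).length ≤ m) :
    Runs assembleRow s (m * (m * 40 + 21) + 10) fun s' => s'.mat d 2 = s.mat d 2 +
      ((rowSupport A i).map fun a => ((rowSupport A i).map fun b =>
        Matrix.single a b (s.rarr 3 i * A i a * A i b)).sum).sum := by
  refine (h.rowLoop hi (c := m * 40 + 10) (fun pre s' => s'.mat d 2 = s.mat d 2 +
    (pre.map fun a => ((rowSupport A i).map fun b =>
      Matrix.single a b (s.rarr 3 i * A i a * A i b)).sum).sum) (by decide)
    (by decide) ?_ ?_).mono ?_ fun _ h => h
  · intro v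
    simp only [List.map_nil, List.sum_nil, add_zero]
    rfl
  · intro pre a s₂ ha hf₂ h₂ hi₂ hc₂ hv₂ hI₂
    have hw₂ : s₂.rarr 3 = s.rarr 3 := hf₂.ra 3 (by decide)
    refine (h₂.rowLoop hi₂ (c := 29) (fun pre s' => s'.mat d 2 = s₂.mat d 2 + (pre.map fun b =>
      Matrix.single a b (s.rarr 3 i * A i a * A i b)).sum) (by decide)
      (by decide) ?_ ?_).mono ?_ ?_
    · intro v
      simp only [List.map_nil, List.sum_nil, add_zero]
      rfl
    · intro pre b s₃ hb hf₃ h₃ hi₃ hc₃ hv₃ hI₃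
      have h6 : s₃.nvar 6 = s₂.nvar 6 := hf₃.n 6 (by decide)
      have hn : s₃.narr 1 = s₂.narr 1 := hf₃.na 1 (by decide)
      have hr : s₃.rarr 0 = s₂.rarr 0 := hf₃.ra 0 (by decide)
      have hw₃ : s₃.rarr 3 = s₂.rarr 3 := hf₃.ra 3 (by decide)
      have ea : (colAt 6).eval s₃ = a := by
        simp only [NExpr.eval, h6, hn, hc₂]
      have eb : (colAt 7).eval s₃ = b := hc₃
      refine (h₃.runs_put2 ea eb ?_).mono (by decide) fun _ h => h
      intro v
      have : (RExpr.add (at2 2 (colAt 6) (colAt 7)) (.mul (.mul (.get 3 (.var 5))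
          (.get 0 (.var 6))) (.get 0 (.var 7)))).eval s₃ =
          s₃.mat d 2 a b + s.rarr 3 i * A i a * A i b := by
        rw [RExpr.eval, h₃.eval_at2 ea eb]
        simp only [RExpr.eval, NExpr.eval, hi₃, hv₃, h6, hr, hv₂, hw₃, hw₂]
      rw [this]
      refine Eq.trans (s₃.mat_putR_add 2 a b _) ?_
      rw [hI₃, List.map_append, List.sum_append, add_assoc]
      simp
    · have : (rowSupport A i).length * (29 + 11) ≤ m * 40 := Nat.mul_le_mul hm le_rfl
      omega
    · intro s' hs' v
      refine Eq.trans hs' ?_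
      rw [hI₂, List.map_append, List.sum_append, add_assoc]
      simp
  · have : (rowSupport A i).length * (m * 40 + 10 + 11) ≤ m * (m * 40 + 21) :=
      Nat.mul_le_mul hm le_rfl
    omega

/-- `X := X + ∑ i, w i • a i (a i)ᵀ`. -/
def assemble : Program := finLoop 0 assembleRow

theorem runs_assemble (h : Static A ord bagOf s) {w : Fin n → ℝ}
    (hw : ∀ i : Fin n, s.rarr 3 i = w i) (hX : s.mat d 2 = 0)
    (hm : ∀ i, (rowSupport A i).length ≤ m) :
    Runs assemble s (n * (m * (m * 40 + 21) + 18) + 6) fun s' => s'.mat d 2 = gram A w := by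
  refine (h.finLoop h.n_eq (by decide) (c := m * (m * 40 + 21) + 10)
    (fun k s' => s'.mat d 2 = (((List.finRange n).take k).map fun i =>
      ((rowSupport A i).map fun a => ((rowSupport A i).map fun b =>
        Matrix.single a b (w i * A i a * A i b)).sum).sum).sum) (by decide) ?_ ?_).mono ?_ ?_
  · simpa using (show (s.setN 5 0).mat d 2 = 0 from hX)
  · intro i s₁ hf₁ h₁ hi₁ hI₁
    have hw₁ : s₁.rarr 3 i = w i := by rw [hf₁.ra 3 (by decide), hw]
    refine (runs_assembleRow h₁ hi₁ (hm i)).mono le_rfl ?_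
    intro s' hs' v
    rw [hw₁] at hs'
    refine Eq.trans hs' ?_
    rw [hI₁, ← List.take_append_getElem (by simp), List.map_append, List.sum_append]
    simp
  · rw [add_assoc]
  · intro s' hs'
    rw [hs', List.take_of_length_le (by simp)]
    ext u v
    rw [gram_apply, ← List.ofFn_eq_map, List.sum_ofFn, Matrix.sum_apply]
    refine Finset.sum_congr rfl fun i _ => ?_
    rw [sum_sum_single_apply (nodup_rowSupport A i)]
    simp only [mem_rowSupport]
    split_ifs with h'
    · rfl
    · by_cases hu : A i u = 0
      · simp [hu]
      · have : A i v = 0 := by tauto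
        simp [this]

/-- The column `v` of the Cholesky factor, in array `4`, is computed from the column of the Schur
complement. The square root of the pivot is in variable `2`. -/
def pivotColumn : Program :=
  bagLoop 6 (put2 4 (vertexAt 6) (.var 9) (.div (at2 2 (vertexAt 6) (.var 9)) (.var 2)))

theorem runs_pivotColumn (h : Static A ord bagOf s) {v : Fin d} (hv : s.nvar 9 = v)
    (hm : (bagOf v).length ≤ m) :
    Runs pivotColumn s (m * 32 + 12) fun s' => s'.mat d 4 = fun u w =>
      if w = v ∧ u ∈ bagOf v then s.mat d 2 u v / s.rvar 2 else s.mat d 4 u w := by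
  refine (h.bagLoop hv (c := 21) (fun pre s' => s'.mat d 4 = fun u w =>
    if w = v ∧ u ∈ pre then s.mat d 2 u v / s.rvar 2 else s.mat d 4 u w)
    (by decide) (by decide) ?_ ?_).mono ?_ fun _ h => h
  · intro y
    simp only [List.not_mem_nil, and_false, if_false]
    rfl
  · intro pre u s₄ hu hf₄ h₄ h9₄ hu₄ hI₄
    have eu : (vertexAt 6).eval s₄ = u := hu₄
    have ev : (NExpr.var 9).eval s₄ = v := h9₄
    refine (h₄.runs_put2 eu ev ?_).mono (by decide) fun _ h => h
    intro y
    rw [RExpr.eval, h₄.eval_at2 eu ev, RExpr.eval, hf₄.r 2 (by decide),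
      Store.mat_congr d (hf₄.ra 2 (by decide))]
    refine Eq.trans (s₄.mat_putR 4 u v _) ?_
    rw [hI₄]
    ext u' w'
    simp only [List.mem_append, List.mem_singleton]
    by_cases h1 : u' = u ∧ w' = v
    · rw [if_pos h1, if_pos ⟨h1.2, Or.inr h1.1⟩, h1.1]
    · rw [if_neg h1]
      congr 1
      exact propext (by tauto)
  · have : (bagOf v).length * (21 + 11) ≤ m * 32 := Nat.mul_le_mul hm le_rfl
    omega

/-- The Schur complement is updated with the column `v` of the factor. -/
def schurUpdate : Program :=
  bagLoop 6 (bagLoop 7 (put2 2 (vertexAt 6) (vertexAt 7)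
    (.add (at2 2 (vertexAt 6) (vertexAt 7)) (.sub (.ofNat (.const 0))
      (.mul (at2 4 (vertexAt 6) (.var 9)) (at2 4 (vertexAt 7) (.var 9)))))))

/-- The subtraction is coded as the addition of `0 - …`, so that the rule for accumulation applies.
The double loop needs no comparison of positions: factor entries of vertices eliminated earlier are
zero. -/
theorem runs_schurUpdate (h : Static A ord bagOf s) {v : Fin d} (hv : s.nvar 9 = v)
    (hm : (bagOf v).length ≤ m) (hn : (bagOf v).Nodup) :
    Runs schurUpdate s (m * (m * 50 + 23) + 12) fun s' => ∀ u w, s'.mat d 2 u w =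
      s.mat d 2 u w - if u ∈ bagOf v ∧ w ∈ bagOf v then s.mat d 4 u v * s.mat d 4 w v else 0 := by
  refine (h.bagLoop hv (c := m * 50 + 12) (fun pre s' => s'.mat d 2 = s.mat d 2 +
    (pre.map fun a => ((bagOf v).map fun b =>
      Matrix.single a b (0 - s.mat d 4 a v * s.mat d 4 b v)).sum).sum) (by decide)
    (by decide) ?_ ?_).mono ?_ ?_
  · intro y
    simp only [List.map_nil, List.sum_nil, add_zero]
    rfl
  · intro pre a s₅ ha hf₅ h₅ h9₅ ha₅ hI₅
    have hL₅ : s₅.mat d 4 = s.mat d 4 := Store.mat_congr d (hf₅.ra 4 (by decide))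
    refine (h₅.bagLoop h9₅ (c := 39) (fun pre s' => s'.mat d 2 = s₅.mat d 2 +
      (pre.map fun b => Matrix.single a b (0 - s.mat d 4 a v * s.mat d 4 b v)).sum)
      (by decide) (by decide) ?_ ?_).mono ?_ ?_
    · intro y
      simp only [List.map_nil, List.sum_nil, add_zero]
      rfl
    · intro pre b s₆ hb hf₆ h₆ h9₆ hb₆ hI₆
      have hL₆ : s₆.mat d 4 = s₅.mat d 4 := Store.mat_congr d (hf₆.ra 4 (by decide))
      have ea : (vertexAt 6).eval s₆ = a := by
        simp only [NExpr.eval, hf₆.n 6 (by decide), hf₆.na 4 (by decide), ha₅]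
      have eb : (vertexAt 7).eval s₆ = b := hb₆
      have ev : (NExpr.var 9).eval s₆ = v := h9₆
      refine (h₆.runs_put2 ea eb ?_).mono (by decide) fun _ h => h
      intro y
      have : (RExpr.add (at2 2 (vertexAt 6) (vertexAt 7)) (.sub (.ofNat (.const 0))
          (.mul (at2 4 (vertexAt 6) (.var 9)) (at2 4 (vertexAt 7) (.var 9))))).eval s₆ =
          s₆.mat d 2 a b + (0 - s.mat d 4 a v * s.mat d 4 b v) := by
        simp only [RExpr.eval]
        rw [h₆.eval_at2 ea eb, h₆.eval_at2 ea ev, h₆.eval_at2 eb ev, hL₆, hL₅]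
        simp only [NExpr.eval, Nat.cast_zero]
      rw [this]
      refine Eq.trans (s₆.mat_putR_add 2 a b _) ?_
      rw [hI₆, List.map_append, List.sum_append, add_assoc]
      simp
    · have : (bagOf v).length * (39 + 11) ≤ m * 50 := Nat.mul_le_mul hm le_rfl
      omega
    · intro s' hs' y
      refine Eq.trans hs' ?_
      rw [hI₅, List.map_append, List.sum_append, add_assoc]
      simp
  · have : (bagOf v).length * (m * 50 + 12 + 11) ≤ m * (m * 50 + 23) :=
      Nat.mul_le_mul hm le_rfl
    omega
  · intro s' hs' u w
    rw [hs', Matrix.add_apply, sum_sum_single_apply hn, sub_eq_add_neg]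
    congr 1
    split_ifs
    · exact zero_sub _
    · exact neg_zero.symm

/-- One step of the elimination. -/
def eliminate : Program :=
  .seq (.setN 9 (.get 6 (.sub (.sub (.var 1) (.const 1)) (.var 5))))
    (.seq (.setR 2 (.sqrt (at2 2 (.var 9) (.var 9)))) (.seq pivotColumn schurUpdate))

/-- The loop counts upwards while positions are eliminated downwards, so round `k` treats position
`d - 1 - k`. -/
theorem runs_eliminate (h : Static A ord bagOf s) {v : Fin d} {k : Fin d} (hk : s.nvar 5 = k)
    (hv : v = ord (Fin.rev k)) (hm : (bagOf v).length ≤ m) (hn : (bagOf v).Nodup) :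
    Runs eliminate s (m * (m * 50 + 60) + 50) fun s' =>
      (∀ u w, s'.mat d 4 u w = if w = v ∧ u ∈ bagOf v then s.mat d 2 u v / √(s.mat d 2 v v) else
        s.mat d 4 u w) ∧
      ∀ u w, s'.mat d 2 u w = s.mat d 2 u w -
        if u ∈ bagOf v ∧ w ∈ bagOf v then s'.mat d 4 u v * s'.mat d 4 w v else 0 := by
  have e9 : (NExpr.get 6 (.sub (.sub (.var 1) (.const 1)) (.var 5))).eval s = v := by
    simp only [NExpr.eval, h.d_eq, hk]
    rw [hv, ← h.ord_eq, Fin.val_rev]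
    congr 1
    omega
  refine (Runs.seq_setN (c := _) (Runs.seq_setR
    (c := m * 32 + 12 + (m * (m * 50 + 23) + 12)) ?_)).mono ?_ fun _ h => h
  · rw [e9]
    set s₂ := s.setN 9 v with hs₂
    have h₂ : Static A ord bagOf s₂ := h.congr rfl rfl rfl rfl
    have h9₂ : s₂.nvar 9 = v := s.setN_nvar_self _ _
    have er : (RExpr.sqrt (at2 2 (.var 9) (.var 9))).eval s₂ = √(s.mat d 2 v v) := by
      have ev : (NExpr.var 9).eval s₂ = v := h9₂
      rw [RExpr.eval, h₂.eval_at2 ev ev]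
      rfl
    rw [er]
    set s₃ := s₂.setR 2 (√(s.mat d 2 v v)) with hs₃
    have h₃ : Static A ord bagOf s₃ := h₂.congr rfl rfl rfl rfl
    have h9₃ : s₃.nvar 9 = v := h9₂
    have hr₃ : s₃.rvar 2 = √(s.mat d 2 v v) := by simp [hs₃, Store.setR]
    refine (runs_pivotColumn h₃ h9₃ hm).seq fun s₄ hL₄ hf₄ => ?_
    have h₄ : Static A ord bagOf s₄ := h₃.frame (l := []) hf₄ (by decide)
    have h9₄ : s₄.nvar 9 = v := (hf₄.n 9 (by decide)).trans h9₃
    have hX₄ : s₄.mat d 2 = s.mat d 2 := Store.mat_congr d (hf₄.ra 2 (by decide))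
    refine (runs_schurUpdate h₄ h9₄ hm hn).frame.mono le_rfl fun s₅ ⟨hs₅, hf₅⟩ => ?_
    have hL₅ : s₅.mat d 4 = s₄.mat d 4 := Store.mat_congr d (hf₅.ra 4 (by decide))
    refine ⟨fun u w => ?_, fun u w => ?_⟩
    · rw [hL₅, hL₄, hr₃]
      rfl
    · rw [hs₅, hX₄, hL₅]
  · simp only [NExpr.cost, RExpr.cost, at2]
    have : m * (m * 50 + 60) = m * (m * 50 + 23) + m * 37 := by ring
    omega

/-- Cholesky factorization: the columns are eliminated one after the other. -/
def cholesky : Program := finLoop 1 eliminate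

theorem runs_cholesky {P : Fin d → Fin d → Prop} (h : Static A ord bagOf s)
    (hE : ElimPattern ord bagOf P) {M : Matrix (Fin d) (Fin d) ℝ} (hM : M.PosDef)
    (hP : ∀ u w, M u w ≠ 0 → P u w) (hX : s.mat d 2 = M)
    (hL : ∀ u v, u ∉ bagOf v → s.mat d 4 u v = 0) (hm : ∀ v, (bagOf v).length ≤ m) :
    Runs cholesky s (d * (m * (m * 50 + 60) + 58) + 6) fun s' =>
      CholState ord bagOf P M 0 (s'.mat d 2) (s'.mat d 4) := by
  refine (h.finLoop h.d_eq (by decide) (c := m * (m * 50 + 60) + 50)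
    (fun k s' => CholState ord bagOf P M (d - k) (s'.mat d 2) (s'.mat d 4)) (by decide)
    ?_ ?_).mono le_rfl ?_
  · have := CholState.init (ord := ord) hM hP hL
    rw [← hX] at this ⊢
    exact this
  · intro k s₁ hf₁ h₁ hk₁ hI₁
    have hposv : (ord.symm (ord (Fin.rev k)) : ℕ) = d - (k + 1) := by simp [Fin.val_rev]
    rw [show d - (k : ℕ) = d - (k + 1) + 1 by omega] at hI₁
    exact (runs_eliminate h₁ hk₁ rfl (hm _) (hE.nodup _)).mono le_rfl fun s' hs' _ =>
      hI₁.step hE hposv hs'.1 hs'.2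
  · intro s' hs'
    simpa using hs'

end Factorization

/-! ### Entries of the inverse on the pattern, and the new weights -/

section Inverse

variable {n d : ℕ} {A : Matrix (Fin n) (Fin d) ℝ} {ord : Equiv.Perm (Fin d)}
  {bagOf : Fin d → List (Fin d)} {s s' : Store} {m : ℕ}

theorem Static.putR (h : Static A ord bagOf s) {a : ℕ} (ha : a ≠ 0) (k : ℕ) (x : ℝ) :
    Static A ord bagOf (s.putR a k x) :=
  h.congr rfl rfl rfl (Function.update_of_ne ha.symm _ _)

/-- Row and column `v` of the inverse, in array `5`, are set to zero on the bag. -/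
def clearInverse : Program :=
  bagLoop 6 (.seq (put2 5 (vertexAt 6) (.var 9) (.ofNat (.const 0)))
    (put2 5 (.var 9) (vertexAt 6) (.ofNat (.const 0))))

/-- Array `5` still holds the inverse of the previous step. Clearing the row and column of `v` on
its bag produces the masked sum of `InvState.step`. -/
theorem runs_clearInverse (h : Static A ord bagOf s) {v : Fin d} (hv : s.nvar 9 = v)
    (hm : (bagOf v).length ≤ m) :
    Runs clearInverse s (m * 40 + 12) fun s' => s'.mat d 5 = fun a b =>
      if (b = v ∧ a ∈ bagOf v) ∨ (a = v ∧ b ∈ bagOf v) then 0 else s.mat d 5 a b := by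
  refine (h.bagLoop hv (c := 16) (fun pre s' => s'.mat d 5 = fun a b =>
      if (b = v ∧ a ∈ pre) ∨ (a = v ∧ b ∈ pre) then 0 else s.mat d 5 a b)
    (by decide) (by decide) ?_ ?_).mono ?_ fun _ h => h
  · intro y
    simp only [List.not_mem_nil, and_false, or_false, if_false]
    rfl
  · intro pre u s₁ hu hf₁ h₁ h9₁ hu₁ hI₁
    have eu : (vertexAt 6).eval s₁ = u := hu₁
    have ev : (NExpr.var 9).eval s₁ = v := h9₁
    refine (Runs.seq (c' := 8) (h₁.runs_put2 eu ev (Q := fun s' => s' = s₁.putR 5 (u * d + v) 0) ?_)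
      ?_).mono (by decide) fun _ h => h
    · simp [RExpr.eval, NExpr.eval]
    · rintro _ rfl -
      have h₂ := h₁.putR (a := 5) (by decide) (u * d + v) 0
      refine (h₂.runs_put2 (i := .var 9) (j := vertexAt 6) ev eu ?_).mono (by decide) fun _ h => h
      intro y
      refine Eq.trans ((s₁.putR 5 (u * d + v) 0).mat_putR 5 v u _) ?_
      rw [Store.mat_putR, hI₁]
      ext a b
      simp only [List.mem_append, List.mem_singleton, RExpr.eval, NExpr.eval, Nat.cast_zero,
        ← ite_or]
      congr 1
      exact propext (by tauto)
  · have : (bagOf v).length * (16 + 11) ≤ m * 40 := Nat.mul_le_mul hm (by omega)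
    omega

/-- The entries of the column `v` of the inverse outside of the diagonal are computed in
array `6`. -/
def inverseColumn : Program :=
  bagLoop 6 (.seq (.setR 2 (.ofNat (.const 0)))
    (.seq (bagLoop 7 (.setR 2 (.add (.var 2) (.mul (at2 5 (vertexAt 6) (vertexAt 7))
      (at2 4 (vertexAt 7) (.var 9))))))
    (.putR 6 (vertexAt 6) (.div (.sub (.ofNat (.const 0)) (.var 2)) (at2 4 (.var 9) (.var 9))))))

theorem runs_inverseColumn (h : Static A ord bagOf s) {v : Fin d} (hv : s.nvar 9 = v)
    (hm : (bagOf v).length ≤ m) :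
    Runs inverseColumn s (m * (m * 40 + 50) + 12) fun s' => ∀ u ∈ bagOf v, s'.rarr 6 u =
      (0 - ((bagOf v).map fun k => s.mat d 5 u k * s.mat d 4 k v).sum) / s.mat d 4 v v := by
  refine (h.bagLoop hv (c := m * 40 + 39) (fun pre s' => ∀ u ∈ pre, s'.rarr 6 ((u : Fin d) : ℕ) =
      (0 - ((bagOf v).map fun k => s.mat d 5 u k * s.mat d 4 k v).sum) / s.mat d 4 v v)
    (by decide) (by decide) ?_ ?_).mono ?_ fun _ h => h
  · intro y u hu
    exact absurd hu List.not_mem_nil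
  · intro pre u s₁ hu hf₁ h₁ h9₁ hu₁ hI₁
    have hZ₁ : s₁.mat d 5 = s.mat d 5 := Store.mat_congr d (hf₁.ra 5 (by decide))
    have hL₁ : s₁.mat d 4 = s.mat d 4 := Store.mat_congr d (hf₁.ra 4 (by decide))
    refine (Runs.seq_setR (c := m * 40 + 12 + 24) ?_).mono ?_ fun _ h => h
    · simp only [RExpr.eval, NExpr.eval, Nat.cast_zero]
      set s₂ := s₁.setR 2 0 with hs₂
      have h₂ : Static A ord bagOf s₂ := h₁.congr rfl rfl rfl rfl
      have h9₂ : s₂.nvar 9 = v := h9₁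
      refine Runs.seq (Q := fun s' => s'.rvar 2 =
        ((bagOf v).map fun k => s.mat d 5 u k * s.mat d 4 k v).sum)
        ((h₂.bagLoop h9₂ (c := 20) (fun pre s' => s'.rvar 2 =
          (pre.map fun k => s.mat d 5 u k * s.mat d 4 k v).sum)
          (by decide) (by decide) ?_ ?_).mono (c' := m * 40 + 12) ?_ fun _ h => h) ?_
      · intro y
        simp [Store.setN, hs₂, Store.setR]
      · intro pre k s₃ hk hf₃ h₃ h9₃ hk₃ hI₃
        have eu : (vertexAt 6).eval s₃ = u := by
          simp only [NExpr.eval, hf₃.n 6 (by decide), hf₃.na 4 (by decide)]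
          exact hu₁
        have ek : (vertexAt 7).eval s₃ = k := hk₃
        have ev : (NExpr.var 9).eval s₃ = v := h9₃
        have hZ₃ : s₃.mat d 5 = s₁.mat d 5 := Store.mat_congr d (hf₃.ra 5 (by decide))
        have hL₃ : s₃.mat d 4 = s₁.mat d 4 := Store.mat_congr d (hf₃.ra 4 (by decide))
        refine (Runs.setR ?_).mono (by decide) fun _ h => h
        intro y
        simp only [RExpr.eval]
        rw [h₃.eval_at2 eu ek, h₃.eval_at2 ek ev, hI₃, hZ₃, hZ₁, hL₃, hL₁]
        simp [Store.setN, Store.setR]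
      · have : (bagOf v).length * (20 + 11) ≤ m * 40 := Nat.mul_le_mul hm (by omega)
        omega
      · intro s₃ hs₃ hf₃
        have h₃ : Static A ord bagOf s₃ := h₂.frame (l := []) hf₃ (by decide)
        have eu : (vertexAt 6).eval s₃ = u := by
          simp only [NExpr.eval, hf₃.n 6 (by decide), hf₃.na 4 (by decide)]
          exact hu₁
        have ev : (NExpr.var 9).eval s₃ = v := (hf₃.n 9 (by decide)).trans h9₂
        have hL₃ : s₃.mat d 4 = s₁.mat d 4 := Store.mat_congr d (hf₃.ra 4 (by decide))
        have hg₃ : s₃.rarr 6 = s₁.rarr 6 := hf₃.ra 6 (by decide)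
        refine (Runs.putR ?_).mono (by decide) fun _ h => h
        intro y u' hu'
        simp only [RExpr.eval]
        rw [eu, h₃.eval_at2 ev ev, hL₃, hL₁, hs₃]
        simp only [Store.setN, Store.putR, Function.update_self, NExpr.eval, Nat.cast_zero]
        by_cases huu : u' = u
        · rw [huu, Function.update_self]
        · rw [Function.update_of_ne (fun h => huu (Fin.ext h)), hg₃]
          exact hI₁ u' ((List.mem_append.1 hu').resolve_right (by simpa using huu))
    · simp only [RExpr.cost, NExpr.cost]
      omega
  · have : (bagOf v).length * (m * 40 + 39 + 11) ≤ m * (m * 40 + 50) :=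
      Nat.mul_le_mul hm (by omega)
    omega

/-- The computed entries are stored in row and column `v` of the inverse; the numerator of the
diagonal entry is computed in variable `3`. -/
def storeInverse : Program :=
  bagLoop 6 (.seq (put2 5 (vertexAt 6) (.var 9) (.get 6 (vertexAt 6)))
    (.seq (put2 5 (.var 9) (vertexAt 6) (.get 6 (vertexAt 6)))
      (.setR 3 (.sub (.var 3) (.mul (.get 6 (vertexAt 6)) (at2 4 (vertexAt 6) (.var 9)))))))

theorem runs_storeInverse (h : Static A ord bagOf s) {v : Fin d} (hv : s.nvar 9 = v)
    (hm : (bagOf v).length ≤ m) :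
    Runs storeInverse s (m * 60 + 12) fun s' =>
      (s'.mat d 5 = fun a b => if b = v ∧ a ∈ bagOf v then s.rarr 6 a else
        if a = v ∧ b ∈ bagOf v then s.rarr 6 b else s.mat d 5 a b) ∧
      s'.rvar 3 = s.rvar 3 - ((bagOf v).map fun u : Fin d => s.rarr 6 u * s.mat d 4 u v).sum := by
  refine (h.bagLoop hv (c := 37) (fun pre s' =>
      (s'.mat d 5 = fun a b => if b = v ∧ a ∈ pre then s.rarr 6 a else
        if a = v ∧ b ∈ pre then s.rarr 6 b else s.mat d 5 a b) ∧
      s'.rvar 3 = s.rvar 3 - (pre.map fun u : Fin d => s.rarr 6 u * s.mat d 4 u v).sum)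
    (by decide) (by decide) ?_ ?_).mono ?_ fun _ h => h
  · intro y
    simp only [List.not_mem_nil, and_false, if_false, List.map_nil, List.sum_nil, sub_zero]
    exact ⟨rfl, rfl⟩
  · intro pre u s₁ hu hf₁ h₁ h9₁ hu₁ hI₁
    have eu : (vertexAt 6).eval s₁ = u := hu₁
    have ev : (NExpr.var 9).eval s₁ = v := h9₁
    have hg₁ : s₁.rarr 6 = s.rarr 6 := hf₁.ra 6 (by decide)
    have hL₁ : s₁.mat d 4 = s.mat d 4 := Store.mat_congr d (hf₁.ra 4 (by decide))
    refine (Runs.seq (c' := 26) (h₁.runs_put2 eu ev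
      (Q := fun s' => s' = s₁.putR 5 (u * d + v) (s.rarr 6 u)) ?_) ?_).mono (by decide)
      fun _ h => h
    · rw [RExpr.eval, eu, hg₁]
    · rintro _ rfl -
      set s₂ := s₁.putR 5 (u * d + v) (s.rarr 6 u) with hs₂
      have h₂ : Static A ord bagOf s₂ := h₁.putR (a := 5) (by decide) _ _
      have hg₂ : s₂.rarr 6 = s.rarr 6 := hg₁
      refine (Runs.seq (c' := 16) (h₂.runs_put2 (i := .var 9) (j := vertexAt 6) ev eu
        (Q := fun s' => s' = s₂.putR 5 (v * d + u) (s.rarr 6 u)) ?_) ?_).mono (by decide)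
        fun _ h => h
      · rw [RExpr.eval, hg₂]
        congr 2
      · rintro _ rfl -
        set s₃ := s₂.putR 5 (v * d + u) (s.rarr 6 u) with hs₃
        have h₃ : Static A ord bagOf s₃ := h₂.putR (a := 5) (by decide) _ _
        have eu₃ : (vertexAt 6).eval s₃ = u := hu₁
        have ev₃ : (NExpr.var 9).eval s₃ = v := h9₁
        have hg₃ : s₃.rarr 6 = s.rarr 6 := hg₁
        have hL₃ : s₃.mat d 4 = s.mat d 4 := hL₁
        refine (Runs.setR ?_).mono (by decide) fun _ h => h
        intro y
        refine ⟨?_, ?_⟩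
        · refine Eq.trans (s₂.mat_putR 5 v u (s.rarr 6 u)) ?_
          rw [hs₂, Store.mat_putR, hI₁.1]
          ext a b
          simp only [List.mem_append, List.mem_singleton]
          by_cases h1 : b = v <;> by_cases h2 : a = v <;> by_cases h3 : a = u <;>
            by_cases h4 : b = u <;> simp_all
        · simp only [RExpr.eval]
          rw [h₃.eval_at2 eu₃ ev₃, eu₃, hg₃, hL₃]
          have : s₃.rvar 3 = s₁.rvar 3 := rfl
          rw [this, hI₁.2]
          simp only [Store.setN, Store.setR, Function.update_self, List.map_append, List.sum_append,
            List.map_cons, List.map_nil, List.sum_cons, List.sum_nil, add_zero]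
          ring
  · have : (bagOf v).length * (37 + 11) ≤ m * 60 := Nat.mul_le_mul hm (by omega)
    omega

/-- One step of the computation of the entries of the inverse. -/
def extendInverse : Program :=
  .seq (.setN 9 (.get 6 (.var 5))) (.seq clearInverse (.seq inverseColumn
    (.seq (.setR 3 (.div (.ofNat (.const 1)) (at2 4 (.var 9) (.var 9))))
    (.seq storeInverse (put2 5 (.var 9) (.var 9) (.div (.var 3) (at2 4 (.var 9) (.var 9))))))))

theorem runs_extendInverse {P : Fin d → Fin d → Prop} (h : Static A ord bagOf s)
    (hE : ElimPattern ord bagOf P) {M X : Matrix (Fin d) (Fin d) ℝ} (hM : M.PosDef)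
    (hL : CholState ord bagOf P M 0 X (s.mat d 4)) {k : Fin d} (hk : s.nvar 5 = k)
    (hZ : InvState ord P M k (s.mat d 5)) (hm : ∀ v, (bagOf v).length ≤ m) :
    Runs extendInverse s (m * (m * 40 + 150) + 80) fun s' =>
      InvState ord P M (k + 1) (s'.mat d 5) := by
  set v := ord k with hv
  have e9 : (NExpr.get 6 (.var 5)).eval s = v := by
    simp only [NExpr.eval, hk, h.ord_eq, hv]
  refine (Runs.seq_setN (c := (m * 40 + 12) + ((m * (m * 40 + 50) + 12) + (9 + ((m * 60 + 12) +
    12)))) ?_).mono ?_ fun _ h => h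
  · rw [e9]
    set s₁ := s.setN 9 v with hs₁
    have h₁ : Static A ord bagOf s₁ := h.congr rfl rfl rfl rfl
    have h9₁ : s₁.nvar 9 = v := s.setN_nvar_self _ _
    refine (runs_clearInverse h₁ h9₁ (hm v)).seq fun s₂ hZ₂ hf₂ => ?_
    have h₂ : Static A ord bagOf s₂ := h₁.frame (l := []) hf₂ (by decide)
    have h9₂ : s₂.nvar 9 = v := (hf₂.n 9 (by decide)).trans h9₁
    have hL₂ : s₂.mat d 4 = s.mat d 4 := Store.mat_congr d (hf₂.ra 4 (by decide))
    refine (runs_inverseColumn h₂ h9₂ (hm v)).seq fun s₃ hg₃ hf₃ => ?_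
    have h₃ : Static A ord bagOf s₃ := h₂.frame (l := []) hf₃ (by decide)
    have h9₃ : s₃.nvar 9 = v := (hf₃.n 9 (by decide)).trans h9₂
    have hL₃ : s₃.mat d 4 = s.mat d 4 := (Store.mat_congr d (hf₃.ra 4 (by decide))).trans hL₂
    have hZ₃ : s₃.mat d 5 = s₂.mat d 5 := Store.mat_congr d (hf₃.ra 5 (by decide))
    refine (Runs.seq_setR (c := (m * 60 + 12) + 12) ?_).mono (by
      simp only [RExpr.cost, NExpr.cost, at2]
      omega) fun _ h => h
    have er : (RExpr.div (.ofNat (.const 1)) (at2 4 (.var 9) (.var 9))).eval s₃ =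
        1 / s.mat d 4 v v := by
      have ev : (NExpr.var 9).eval s₃ = v := h9₃
      rw [RExpr.eval, h₃.eval_at2 ev ev, hL₃]
      simp [RExpr.eval, NExpr.eval]
    rw [er]
    set s₄ := s₃.setR 3 (1 / s.mat d 4 v v) with hs₄
    have h₄ : Static A ord bagOf s₄ := h₃.congr rfl rfl rfl rfl
    have h9₄ : s₄.nvar 9 = v := h9₃
    have hL₄ : s₄.mat d 4 = s.mat d 4 := hL₃
    have hZ₄ : s₄.mat d 5 = s₂.mat d 5 := hZ₃
    have hr₄ : s₄.rvar 3 = 1 / s.mat d 4 v v := by simp [hs₄, Store.setR]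
    have hg₄ : s₄.rarr 6 = s₃.rarr 6 := rfl
    refine (runs_storeInverse h₄ h9₄ (hm v)).seq fun s₅ hs₅ hf₅ => ?_
    have h₅ : Static A ord bagOf s₅ := h₄.frame (l := []) hf₅ (by decide)
    have ev₅ : (NExpr.var 9).eval s₅ = v := (hf₅.n 9 (by decide)).trans h9₄
    have hL₅ : s₅.mat d 4 = s.mat d 4 := (Store.mat_congr d (hf₅.ra 4 (by decide))).trans hL₄
    refine (h₅.runs_put2 ev₅ ev₅ ?_).mono (by decide) fun _ h => h
    rw [RExpr.eval, h₅.eval_at2 ev₅ ev₅, RExpr.eval, hL₅, hs₅.2, hr₄, hg₄, hL₄]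
    -- The final assignment corrects the diagonal entry, which `storeInverse` had set to the
    -- meaningless value `g v`.
    refine hZ.step hE hL hM (v := v) (by simp [hv]) (g := fun u => s₃.rarr 6 u) ?_ ?_ ?_ ?_
    · intro u hu
      rw [hg₃ u hu, hL₂, hZ₂]
      congr 3
      refine List.map_congr_left fun k hk => ?_
      congr 1
      have : ((k = v ∧ u ∈ bagOf v) ∨ (u = v ∧ k ∈ bagOf v)) ↔ (u = v ∨ k = v) := by tauto
      simp only [this]
      rfl
    · rw [Store.mat_putR]
      simp
    · intro u hu huv
      rw [Store.mat_putR, hs₅.1, hg₄]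
      simp [huv, hu]
    · intro u w hu hw
      rw [Store.mat_putR, hs₅.1, hZ₄, hZ₂]
      simp only [hu, hw, false_and, if_false, or_self]
      rfl
  · simp only [NExpr.cost]
    have : m * (m * 40 + 150) = m * (m * 40 + 50) + m * 40 + m * 60 := by ring
    omega

/-- The computation of the entries of the inverse on the pattern. -/
def selectedInverse : Program := finLoop 1 extendInverse

theorem runs_selectedInverse {P : Fin d → Fin d → Prop} (h : Static A ord bagOf s)
    (hE : ElimPattern ord bagOf P) {M X : Matrix (Fin d) (Fin d) ℝ} (hM : M.PosDef)
    (hL : CholState ord bagOf P M 0 X (s.mat d 4)) (hm : ∀ v, (bagOf v).length ≤ m) :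
    Runs selectedInverse s (d * (m * (m * 40 + 150) + 88) + 6) fun s' =>
      ∀ u w, P u w → s'.mat d 5 u w = M⁻¹ u w := by
  refine (h.finLoop h.d_eq (by decide) (c := m * (m * 40 + 150) + 80)
    (fun k s' => InvState ord P M k (s'.mat d 5)) (by decide) ?_ ?_).mono le_rfl ?_
  · intro u w hu
    omega
  · intro k s₁ hf₁ h₁ hk₁ hI₁
    have hL₁ : s₁.mat d 4 = s.mat d 4 := Store.mat_congr d (hf₁.ra 4 (by decide))
    exact (runs_extendInverse h₁ hE hM (hL₁ ▸ hL) hk₁ hI₁ hm).mono le_rfl fun s' hs' _ => hs'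
  · intro s' hs' u w hP
    exact hs' u w (ord.symm u).2 (ord.symm w).2 hP

/-- The quadratic form of the row in variable `5` is computed in variable `2`. -/
def rowForm : Program :=
  .seq (.setR 2 (.ofNat (.const 0))) (rowLoop 6 (rowLoop 7 (.setR 2 (.add (.var 2)
    (.mul (.mul (.get 0 (.var 6)) (.get 0 (.var 7))) (at2 5 (colAt 6) (colAt 7)))))))

theorem runs_rowForm (h : Static A ord bagOf s) {i : Fin n} (hi : s.nvar 5 = i)
    (hm : (rowSupport A i).length ≤ m) :
    Runs rowForm s (m * (m * 40 + 21) + 13) fun s' => s'.rvar 2 =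
      ((rowSupport A i).map fun a => ((rowSupport A i).map fun b =>
        A i a * A i b * s.mat d 5 a b).sum).sum := by
  refine (Runs.seq_setR (c := m * (m * 40 + 21) + 10) ?_).mono (by
    simp only [RExpr.cost, NExpr.cost]
    omega) fun _ h => h
  simp only [RExpr.eval, NExpr.eval, Nat.cast_zero]
  set s₁ := s.setR 2 0 with hs₁
  have h₁ : Static A ord bagOf s₁ := h.congr rfl rfl rfl rfl
  have hi₁ : s₁.nvar 5 = i := hi
  refine (h₁.rowLoop hi₁ (c := m * 40 + 10) (fun pre s' => s'.rvar 2 =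
    (pre.map fun a => ((rowSupport A i).map fun b => A i a * A i b * s.mat d 5 a b).sum).sum)
    (by decide) (by decide) ?_ ?_).mono ?_ fun _ h => h
  · intro v
    simp [Store.setN, hs₁, Store.setR]
  · intro pre a s₂ ha hf₂ h₂ hi₂ hc₂ hv₂ hI₂
    have hZ₂ : s₂.mat d 5 = s₁.mat d 5 := Store.mat_congr d (hf₂.ra 5 (by decide))
    refine (h₂.rowLoop hi₂ (c := 22) (fun pre s' => s'.rvar 2 = s₂.rvar 2 +
      (pre.map fun b => A i a * A i b * s.mat d 5 a b).sum) (by decide)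
      (by decide) ?_ ?_).mono ?_ ?_
    · intro v
      simp [Store.setN]
    · intro pre b s₃ hb hf₃ h₃ hi₃ hc₃ hv₃ hI₃
      have h6 : s₃.nvar 6 = s₂.nvar 6 := hf₃.n 6 (by decide)
      have hr : s₃.rarr 0 = s₂.rarr 0 := hf₃.ra 0 (by decide)
      have ea : (colAt 6).eval s₃ = a := by
        simp only [NExpr.eval, h6, hf₃.na 1 (by decide), hc₂]
      have eb : (colAt 7).eval s₃ = b := hc₃
      have hZ₃ : s₃.mat d 5 = s₂.mat d 5 := Store.mat_congr d (hf₃.ra 5 (by decide))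
      refine (Runs.setR ?_).mono (by decide) fun _ h => h
      intro v
      simp only [RExpr.eval]
      rw [h₃.eval_at2 ea eb, hI₃, hZ₃, hZ₂]
      simp only [NExpr.eval, h6, hr, hv₂, hv₃]
      simp only [Store.setN, Store.setR, Function.update_self, List.map_append, List.sum_append,
        List.map_cons, List.map_nil, List.sum_cons, List.sum_nil, add_zero, add_assoc]
      rfl
    · have : (rowSupport A i).length * (22 + 11) ≤ m * 40 := Nat.mul_le_mul hm (by omega)
      omega
    · intro s' hs' v
      refine Eq.trans hs' ?_
      rw [hI₂]
      simp
  · have : (rowSupport A i).length * (m * 40 + 10 + 11) ≤ m * (m * 40 + 21) :=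
      Nat.mul_le_mul hm le_rfl
    omega

/-- The new weight of the row in variable `5` is computed, and added to the total weight in
array `1`. -/
def updateWeight : Program :=
  .seq rowForm (.seq (.putR 3 (.var 5) (.mul (.get 3 (.var 5)) (.var 2)))
    (.putR 1 (.var 5) (.add (.get 1 (.var 5)) (.get 3 (.var 5)))))

theorem runs_updateWeight (h : Static A ord bagOf s) {i : Fin n} (hi : s.nvar 5 = i)
    (hm : (rowSupport A i).length ≤ m) {M : Matrix (Fin d) (Fin d) ℝ}
    (hZ : ∀ u ∈ rowSupport A i, ∀ w ∈ rowSupport A i, s.mat d 5 u w = M u w) :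
    Runs updateWeight s (m * (m * 40 + 21) + 30) fun s' =>
      (∀ j : Fin n, s'.rarr 3 j = if j = i then s.rarr 3 i * (A i ⬝ᵥ M *ᵥ A i) else s.rarr 3 j) ∧
      ∀ j : Fin n, s'.rarr 1 j = if j = i then s.rarr 1 i + s.rarr 3 i * (A i ⬝ᵥ M *ᵥ A i) else
        s.rarr 1 j := by
  -- Outside the support of the row the coefficients vanish, so the entries of `M` on the support,
  -- which are the ones in memory, give the whole form.
  have hform : ((rowSupport A i).map fun a => ((rowSupport A i).map fun b =>
      A i a * A i b * s.mat d 5 a b).sum).sum = A i ⬝ᵥ M *ᵥ A i := by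
    have hsum : ∀ f : Fin d → ℝ, ((rowSupport A i).map fun a => A i a * f a).sum =
        ∑ a, A i a * f a := fun f => by
      rw [← List.sum_toFinset _ (nodup_rowSupport A i)]
      refine Finset.sum_subset (Finset.subset_univ _) fun k _ hk => ?_
      rw [List.mem_toFinset, mem_rowSupport, not_not] at hk
      rw [hk, zero_mul]
    rw [dotProduct, ← hsum]
    congr 1
    refine List.map_congr_left fun a ha => ?_
    rw [mulVec, dotProduct, Finset.sum_congr rfl fun b _ => mul_comm (M a b) (A i b), ← hsum,
      ← List.sum_map_mul_left]
    congr 1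
    refine List.map_congr_left fun b hb => ?_
    rw [hZ a ha b hb]
    ring
  refine (Runs.seq (c' := 6 + 6 + 5) (runs_rowForm h hi hm) fun s₁ hr₁ hf₁ => ?_).mono (by omega)
    fun _ h => h
  rw [hform] at hr₁
  have hi₁ : s₁.nvar 5 = i := (hf₁.n 5 (by decide)).trans hi
  have hw₁ : s₁.rarr 3 = s.rarr 3 := hf₁.ra 3 (by decide)
  have hu₁ : s₁.rarr 1 = s.rarr 1 := hf₁.ra 1 (by decide)
  refine (Runs.seq_putR (c := 8) (Runs.mono (Runs.putR ?_) (by decide) fun _ h => h)).mono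
    (by decide) fun _ h => h
  simp only [RExpr.eval, NExpr.eval, Store.putR, hi₁, hr₁, hw₁]
  refine ⟨fun j => ?_, fun j => ?_⟩
  · by_cases hj : j = i
    · simp [hj]
    · have : (j : ℕ) ≠ i := fun h => hj (Fin.ext h)
      simp [hj, this]
  · by_cases hj : j = i
    · simp [hj, hu₁]
    · have : (j : ℕ) ≠ i := fun h => hj (Fin.ext h)
      simp [hj, this, hu₁]

/-- The new weights are computed. -/
def updateWeights : Program := finLoop 0 updateWeight

/-- The weights can be overwritten in place: the new weight of a row depends on its own old weight
and on array `5`, which stays fixed. -/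
theorem runs_updateWeights (h : Static A ord bagOf s) (hm : ∀ i, (rowSupport A i).length ≤ m)
    {M : Matrix (Fin d) (Fin d) ℝ}
    (hZ : ∀ i, ∀ u ∈ rowSupport A i, ∀ w ∈ rowSupport A i, s.mat d 5 u w = M u w) :
    Runs updateWeights s (n * (m * (m * 40 + 21) + 38) + 6) fun s' =>
      (∀ i : Fin n, s'.rarr 3 i = s.rarr 3 i * (A i ⬝ᵥ M *ᵥ A i)) ∧
      ∀ i : Fin n, s'.rarr 1 i = s.rarr 1 i + s.rarr 3 i * (A i ⬝ᵥ M *ᵥ A i) := by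
  refine (h.finLoop h.n_eq (by decide) (c := m * (m * 40 + 21) + 30)
    (fun k s' => (∀ j : Fin n, s'.rarr 3 j = if (j : ℕ) < k then
        s.rarr 3 j * (A j ⬝ᵥ M *ᵥ A j) else s.rarr 3 j) ∧
      ∀ j : Fin n, s'.rarr 1 j = if (j : ℕ) < k then
        s.rarr 1 j + s.rarr 3 j * (A j ⬝ᵥ M *ᵥ A j) else s.rarr 1 j) (by decide) ?_ ?_).mono ?_ ?_
  · simp [Store.setN]
  · intro i s₁ hf₁ h₁ hi₁ hI₁
    have hZ₁ : s₁.mat d 5 = s.mat d 5 := Store.mat_congr d (hf₁.ra 5 (by decide))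
    refine (runs_updateWeight h₁ hi₁ (hm i) (hZ₁ ▸ hZ i)).mono le_rfl ?_
    intro s' hs' v
    refine ⟨fun j => (hs'.1 j).trans ?_, fun j => (hs'.2 j).trans ?_⟩
    · rw [hI₁.1, hI₁.1, if_neg (lt_irrefl _)]
      by_cases hj : j = i
      · subst hj
        simp
      · have : (j : ℕ) ≠ i := fun h => hj (Fin.ext h)
        rw [if_neg hj]
        congr 1
        exact propext (by omega)
    · rw [hI₁.2, hI₁.2, hI₁.1, if_neg (lt_irrefl _), if_neg (lt_irrefl _)]
      by_cases hj : j = i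
      · subst hj
        simp
      · have : (j : ℕ) ≠ i := fun h => hj (Fin.ext h)
        rw [if_neg hj]
        congr 1
        exact propext (by omega)
  · rw [add_assoc]
  · intro s' hs'
    simpa using hs'

end Inverse

/-! ### The iteration -/

section Iteration

variable {n d : ℕ} {A : Matrix (Fin n) (Fin d) ℝ} {ord : Equiv.Perm (Fin d)}
  {bagOf : Fin d → List (Fin d)} {s s' : Store} {m : ℕ}

/-- Lower order terms in a step count are absorbed into one multiple of `n m²`. -/
theorem mul_quadratic_add_le {k n m : ℕ} (hk : k ≤ n) (hn : 1 ≤ n) (hm : 1 ≤ m) (a b c e : ℕ) :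
    k * (m * (m * a + b) + c) + e ≤ (a + b + c + e) * (n * (m * m)) := by
  have h1 : m ≤ m * m := Nat.le_mul_of_pos_left m hm
  have h2 : 1 ≤ m * m := hm.trans h1
  have h3 : m * (m * a + b) + c ≤ (a + b + c) * (m * m) := by
    have hb : m * b ≤ m * m * b := Nat.mul_le_mul_right b h1
    have hc : 1 * c ≤ m * m * c := Nat.mul_le_mul_right c h2
    nlinarith
  have h4 : k * (m * (m * a + b) + c) ≤ n * ((a + b + c) * (m * m)) := Nat.mul_le_mul hk h3
  have h5 : 1 * e ≤ n * (m * m) * e := Nat.mul_le_mul_right e (Nat.mul_pos hn h2)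
  nlinarith

/-- One step of the fixed point iteration. -/
def iterationStep : Program :=
  .seq assemble (.seq cholesky (.seq selectedInverse updateWeights))

/-- The memory when the iterate `k` is computed. -/
structure IterState (A : Matrix (Fin n) (Fin d) ℝ) (bagOf : Fin d → List (Fin d)) (k : ℕ)
    (s : Store) : Prop where
  schur : s.mat d 2 = 0
  factor : ∀ u v, u ∉ bagOf v → s.mat d 4 u v = 0
  weight : ∀ i : Fin n, s.rarr 3 i = iterate A k i
  total : ∀ i : Fin n, s.rarr 1 i = ∑ j ∈ Finset.range (k + 1), iterate A j i

theorem runs_iterationStep {P : Fin d → Fin d → Prop} (h : Static A ord bagOf s)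
    (hE : ElimPattern ord bagOf P) (hd : 0 < d) (hA : A.rank = d)
    (hP : ∀ i u v, A i u ≠ 0 → A i v ≠ 0 → P u v) (hm₀ : 1 ≤ m)
    (hm : ∀ v, (bagOf v).length ≤ m) (hm' : ∀ i, (rowSupport A i).length ≤ m) {k : ℕ}
    (hs : IterState A bagOf k s) :
    Runs iterationStep s (700 * (n * (m * m))) (IterState A bagOf (k + 1)) := by
  have hM := iterate_posDef hd hA k
  have hpat : ∀ u v, gram A (iterate A k) u v ≠ 0 → P u v := fun u v h => by
    rw [gram_apply] at h
    obtain ⟨i, _, hi⟩ := Finset.exists_ne_zero_of_sum_ne_zero h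
    exact hP i u v (right_ne_zero_of_mul (left_ne_zero_of_mul hi)) (right_ne_zero_of_mul hi)
  refine ((runs_assemble h hs.weight hs.schur hm').seq fun s₁ hX₁ hf₁ => ?_).mono
    (c := (n * (m * (m * 40 + 21) + 18) + 6) + ((d * (m * (m * 50 + 60) + 58) + 6) +
      ((d * (m * (m * 40 + 150) + 88) + 6) + (n * (m * (m * 40 + 21) + 38) + 6)))) ?_ fun _ h => h
  · have h₁ : Static A ord bagOf s₁ := h.frame (l := []) hf₁ (by decide)
    have hL₁ : s₁.mat d 4 = s.mat d 4 := Store.mat_congr d (hf₁.ra 4 (by decide))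
    refine (runs_cholesky h₁ hE hM hpat hX₁ (hL₁ ▸ hs.factor) hm).seq fun s₂ hC₂ hf₂ => ?_
    have h₂ : Static A ord bagOf s₂ := h₁.frame (l := []) hf₂ (by decide)
    refine (runs_selectedInverse h₂ hE hM hC₂ hm).seq fun s₃ hZ₃ hf₃ => ?_
    have h₃ : Static A ord bagOf s₃ := h₂.frame (l := []) hf₃ (by decide)
    refine (runs_updateWeights h₃ hm' (M := (gram A (iterate A k))⁻¹) fun i u hu w hw =>
      hZ₃ u w (hP i u w (mem_rowSupport.1 hu) (mem_rowSupport.1 hw))).frame.mono le_rfl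
      fun s₄ ⟨hs₄, hf₄⟩ => ?_
    have hw : ∀ i : Fin n, s₃.rarr 3 i = iterate A k i := fun i => by
      rw [hf₃.ra 3 (by decide), hf₂.ra 3 (by decide), hf₁.ra 3 (by decide), hs.weight]
    have ht : s₃.rarr 1 = s.rarr 1 := by
      rw [hf₃.ra 1 (by decide), hf₂.ra 1 (by decide), hf₁.ra 1 (by decide)]
    refine ⟨?_, ?_, fun i => ?_, fun i => ?_⟩
    -- The complete elimination has reduced the Schur complement to zero, as the next assembly
    -- requires.
    · rw [Store.mat_congr d (hf₄.ra 2 (by decide)), Store.mat_congr d (hf₃.ra 2 (by decide)),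
        hC₂.final.1]
    · rw [Store.mat_congr d (hf₄.ra 4 (by decide)), Store.mat_congr d (hf₃.ra 4 (by decide))]
      exact hC₂.out
    · rw [hs₄.1, hw]
      rfl
    · rw [hs₄.2, hw, ht, hs.total, Finset.sum_range_succ _ (k + 1)]
      rfl
  · have hdn := le_of_rank hA
    have hn : 1 ≤ n := Nat.one_le_iff_ne_zero.2 (by omega)
    -- The four parts contribute the coefficients `85`, `174`, `284` and `105`, together `648 ≤
    -- 700`.
    have h1 := mul_quadratic_add_le le_rfl hn hm₀ 40 21 18 6
    have h2 := mul_quadratic_add_le hdn hn hm₀ 50 60 58 6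
    have h3 := mul_quadratic_add_le hdn hn hm₀ 40 150 88 6
    have h4 := mul_quadratic_add_le le_rfl hn hm₀ 40 21 38 6
    omega

/-- The fixed point iteration, with the number of iterates in variable `3`. -/
def iteration : Program :=
  .seq (.setN 8 (.const 1)) (.seq (countLoop 8 (.var 3) iterationStep)
    (finLoop 0 (.putR 1 (.var 5) (.div (.get 1 (.var 5)) (.ofNat (.var 3))))))

theorem runs_iteration {P : Fin d → Fin d → Prop} (h : Static A ord bagOf s)
    (hE : ElimPattern ord bagOf P) (hd : 0 < d) (hA : A.rank = d)
    (hP : ∀ i u v, A i u ≠ 0 → A i v ≠ 0 → P u v) (hm₀ : 1 ≤ m)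
    (hm : ∀ v, (bagOf v).length ≤ m) (hm' : ∀ i, (rowSupport A i).length ≤ m) {T : ℕ}
    (hT : s.nvar 3 = T) (hT' : 1 ≤ T) (hs : IterState A bagOf 0 s) :
    Runs iteration s (T * (800 * (n * (m * m)))) fun s' => ∀ i, output n s' i = average A T i := by
  refine (Runs.seq_setN (c := ((T - 1) * (700 * (n * (m * m)) + 1 + 7) + 4) +
    (n * (8 + 8) + 6)) ?_).mono ?_ fun _ h => h
  · set s₁ := s.setN 8 1 with hs₁
    have h₁ : Static A ord bagOf s₁ := h.congr rfl rfl rfl rfl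
    have hT₁ : s₁.nvar 3 = T := hT
    refine Runs.seq (Q := IterState A bagOf (T - 1)) ?_ fun s₂ hs₂ hf₂ => ?_
    -- The first iterate is already in memory, so `T` iterates take `T - 1` steps; the counter
    -- starts from `1`.
    · refine (Runs.countLoop (c := 700 * (n * (m * m))) (m := T - 1) (lo := 1)
        (IterState A bagOf) (s.setN_nvar_self 8 1) ?_ (by decide) ⟨hs.1, hs.2, hs.3, hs.4⟩
        ?_).mono ?_ fun _ h => h
      · intro s' hf
        rw [NExpr.eval, hf.n 3 (by decide), hT₁]
        omega
      · intro k hk s' hf hk' hI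
        have h' : Static A ord bagOf s' := h₁.frame (l := []) hf (by decide)
        exact (runs_iterationStep h' hE hd hA hP hm₀ hm hm' hI).mono le_rfl fun s'' h =>
          ⟨h.1, h.2, h.3, h.4⟩
      · simp only [NExpr.cost]
        rfl
    · have h₂ : Static A ord bagOf s₂ := h₁.frame (l := []) hf₂ (by decide)
      have hT₂ : s₂.nvar 3 = T := (hf₂.n 3 (by decide)).trans hT₁
      refine (h₂.finLoop h₂.n_eq (by decide) (c := 8) (fun k s' => ∀ i : Fin n, s'.rarr 1 i =
        if (i : ℕ) < k then average A T i else s₂.rarr 1 i) (by decide) ?_ ?_).mono le_rfl ?_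
      · simp [Store.setN]
      · intro i s₃ hf₃ h₃ hi₃ hI₃
        refine (Runs.putR ?_).mono (by decide) fun _ h => h
        intro y j
        simp only [RExpr.eval, NExpr.eval, hi₃, hf₃.n 3 (by decide), hT₂, hI₃, Store.setN,
          Store.putR, Function.update_self, lt_irrefl, if_false]
        by_cases hj : j = i
        · subst hj
          rw [Function.update_self, if_pos (Nat.lt_succ_self _), hs₂.total,
            Nat.sub_add_cancel hT']
          rfl
        · have hne : (j : ℕ) ≠ i := fun h => hj (Fin.ext h)
          rw [Function.update_of_ne hne, hI₃]
          congr 1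
          exact propext (by omega)
      · intro s' hs' i
        exact (hs' i).trans (if_pos i.2)
  · simp only [NExpr.cost]
    have hn : 1 ≤ n := hd.trans_le (le_of_rank hA)
    have hq : n ≤ n * (m * m) := Nat.le_mul_of_pos_right n (Nat.mul_pos hm₀ hm₀)
    set q := n * (m * m)
    obtain ⟨T, rfl⟩ := Nat.exists_eq_add_of_le' hT'
    rw [Nat.add_sub_cancel, add_mul]
    have : T * (700 * q + 1 + 7) ≤ T * (800 * q) := Nat.mul_le_mul le_rfl (by omega)
    omega

end Iteration

/-! ### Preparations -/

/-- The multiples of `d` are stored in array `5`. -/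
def prepareBase : Program :=
  .seq (.setN 5 (.const 0)) (countLoop 5 (.var 1)
    (.putN 5 (.add (.var 5) (.const 1)) (.add (.get 5 (.var 5)) (.var 1))))

/-- The machine cannot multiply natural numbers, so the row offsets of the matrices are tabulated by
repeated addition. -/
theorem runs_prepareBase {s : Store} {d : ℕ} (hd : s.nvar 1 = d) (h5 : s.narr 5 0 = 0) :
    Runs prepareBase s (d * 16 + 6) fun s' => ∀ u : Fin d, s'.narr 5 u = u * d := by
  refine (Runs.seq_setN (c := d * (8 + 1 + 7) + 4) ?_).mono (by simp only [NExpr.cost]; omega)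
    fun _ h => h
  refine (Runs.countLoop (c := 8) (m := d) (lo := 0) (fun k s' => ∀ j ≤ k, s'.narr 5 j = j * d)
    (s.setN_nvar_self 5 0) ?_ (by decide) ?_ ?_).mono (by simp only [NExpr.cost]; rfl)
    fun s' h u => h u u.2.le
  · intro s' hf
    rw [NExpr.eval, hf.n 1 (by decide), zero_add, ← hd]
    rfl
  · intro j hj
    rw [Nat.le_zero.1 hj, zero_mul]
    exact h5
  · intro k hk s' hf hk' hI
    refine (Runs.putN ?_).mono (by decide) fun _ h => h
    intro j hj
    have h1 : s'.nvar 1 = d := by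
      rw [hf.n 1 (by decide), ← hd]
      rfl
    simp only [NExpr.eval, Store.setN, Store.putN, Function.update_self, hk', h1, zero_add]
    rcases hj.eq_or_lt with rfl | hj
    · rw [Function.update_self, hI k le_rfl, add_mul, one_mul]
    · rw [Function.update_of_ne hj.ne, hI j (by omega)]

/-- The initial weights. -/
def prepareWeights : Program :=
  .seq (.setN 5 (.const 0)) (countLoop 5 (.var 0)
    (.seq (.putR 3 (.var 5) (.div (.ofNat (.var 1)) (.ofNat (.var 0))))
      (.putR 1 (.var 5) (.get 3 (.var 5)))))

theorem runs_prepareWeights {s : Store} {n d : ℕ} (hn : s.nvar 0 = n) (hd : s.nvar 1 = d) :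
    Runs prepareWeights s (n * 19 + 6) fun s' =>
      ∀ i : Fin n, s'.rarr 3 i = (d : ℝ) / n ∧ s'.rarr 1 i = (d : ℝ) / n := by
  refine (Runs.seq_setN (c := n * (11 + 1 + 7) + 4) ?_).mono (by simp only [NExpr.cost]; omega)
    fun _ h => h
  refine (Runs.countLoop (c := 11) (m := n) (lo := 0) (fun k s' => ∀ j < k,
    s'.rarr 3 j = (d : ℝ) / n ∧ s'.rarr 1 j = (d : ℝ) / n)
    (s.setN_nvar_self 5 0) ?_ (by decide) ?_ ?_).mono (by simp only [NExpr.cost]; rfl)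
    fun s' h i => h i i.2
  · intro s' hf
    rw [NExpr.eval, hf.n 0 (by decide), zero_add, ← hn]
    rfl
  · intro j hj
    exact absurd hj (Nat.not_lt_zero j)
  · intro k hk s' hf hk' hI
    refine (Runs.seq_putR (c := 4) ((Runs.putR ?_).mono (by decide) fun _ h => h)).mono
      (by decide) fun _ h => h
    intro j hj
    have h0 : s'.nvar 0 = n := by
      rw [hf.n 0 (by decide), ← hn]
      rfl
    have h1 : s'.nvar 1 = d := by
      rw [hf.n 1 (by decide), ← hd]
      rfl
    rcases Nat.lt_succ_iff_lt_or_eq.1 hj with hj | rfl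
    · have := hI j hj
      simp [RExpr.eval, NExpr.eval, Store.setN, Store.putR, hk', h0, h1, hj.ne, this]
    · simp [RExpr.eval, NExpr.eval, Store.setN, Store.putR, hk', h0, h1]

/-- The number of iterates: the least `T ≥ 1` with `n / d ≤ (1 + ε) ^ T`. -/
def prepareCount : Program :=
  .seq (.setN 3 (.const 1)) (.seq (.setR 1 (.add (.ofNat (.const 1)) (.var 0)))
    (.loop (.realLT (.var 1) (.div (.ofNat (.var 0)) (.ofNat (.var 1))))
      (.seq (.setR 1 (.mul (.var 1) (.add (.ofNat (.const 1)) (.var 0))))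
        (.setN 3 (.add (.var 3) (.const 1))))))

/-- The machine has no logarithm. The powers of `1 + ε` are formed one by one, in time proportional
to the number of iterates. -/
theorem runs_prepareCount {s : Store} {n d : ℕ} {ε : ℝ} (hn : s.nvar 0 = n) (hd : s.nvar 1 = d)
    (hε : s.rvar 0 = ε) {T : ℕ} (hT : (n : ℝ) / d ≤ (1 + ε) ^ (T + 1))
    (hT' : ∀ k < T, (1 + ε) ^ (k + 1) < (n : ℝ) / d) :
    Runs prepareCount s (T * 19 + 15) fun s' => s'.nvar 3 = T + 1 := by
  refine (Runs.seq_setN (c := 5 + (T * (11 + 7 + 1) + 8)) (Runs.seq_setR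
    (c := T * (11 + 7 + 1) + 8) ?_)).mono (by simp only [NExpr.cost]; omega) fun _ h => h
  refine (Runs.loop (c := 11) T (fun k s' => s'.nvar 3 = k + 1 ∧ s'.rvar 1 = (1 + ε) ^ (k + 1))
    ?_ ?_ ?_).mono le_rfl fun _ h => h.1
  · simp [Store.setN, Store.setR, RExpr.eval, NExpr.eval, hε]
  · intro k hk s' hf ⟨h3, h1⟩
    have hn' : s'.nvar 0 = n := (hf.n 0 (by decide)).trans hn
    have hd' : s'.nvar 1 = d := (hf.n 1 (by decide)).trans hd
    have hε' : s'.rvar 0 = ε := (hf.r 0 (by decide)).trans hε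
    refine ⟨?_, ?_⟩
    · simp only [Test.Holds, RExpr.eval, NExpr.eval, hn', hd', h1]
      exact hT' k hk
    · refine (Runs.seq_setR (c := 4) ((Runs.setN ?_).mono (by decide) fun _ h => h)).mono
        (by decide) fun _ h => h
      simp [Store.setN, Store.setR, RExpr.eval, NExpr.eval, h3, h1, hε', pow_succ]
  · intro s' hf ⟨h3, h1⟩
    have hn' : s'.nvar 0 = n := (hf.n 0 (by decide)).trans hn
    have hd' : s'.nvar 1 = d := (hf.n 1 (by decide)).trans hd
    simp only [Test.Holds, RExpr.eval, NExpr.eval, hn', hd', h1, not_lt]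
    exact hT

/-- If the least exponent is `T + 1` with `T ≥ 1`, then `(1 + ε) ^ T < n / d`, and `log (1 + ε) ≥ ε
/ 2` gives `T ≤ 2 ε⁻¹ log (n / d)`. The one additional iterate turns the factor `2` into `3`. -/
theorem exists_count {n d : ℕ} {ε : ℝ} (hε : 0 < ε) (hε' : ε < 1) :
    ∃ T : ℕ, (n : ℝ) / d ≤ (1 + ε) ^ (T + 1) ∧ (∀ k < T, (1 + ε) ^ (k + 1) < (n : ℝ) / d) ∧
      ((T + 1 : ℕ) : ℝ) ≤ 3 * max 1 (ε⁻¹ * Real.log (n / d)) := by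
  classical
  have hex : ∃ T : ℕ, (n : ℝ) / d ≤ (1 + ε) ^ (T + 1) := by
    obtain ⟨T, hT⟩ := pow_unbounded_of_one_lt ((n : ℝ) / d) (show 1 < 1 + ε by linarith)
    exact ⟨T, hT.le.trans (pow_le_pow_right₀ (by linarith) (Nat.le_succ T))⟩
  refine ⟨Nat.find hex, Nat.find_spec hex, fun k hk => not_le.1 (Nat.find_min hex hk), ?_⟩
  have hmax := le_max_left (1 : ℝ) (ε⁻¹ * Real.log (n / d))
  rcases Nat.eq_zero_or_eq_succ_pred (Nat.find hex) with h | h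
  · rw [h]
    norm_num
    linarith
  · have hlt := not_le.1 (Nat.find_min hex (m := (Nat.find hex).pred) (by omega))
    rw [← Nat.succ_eq_add_one, ← h] at hlt
    set T := Nat.find hex
    have h1 : (T : ℝ) * Real.log (1 + ε) ≤ Real.log (n / d) := by
      rw [← Real.log_pow]
      exact Real.log_le_log (by positivity) hlt.le
    -- From `log x ≥ 1 - 1 / x` one gets `ε / (1 + ε)`, which is at least `ε / 2` because `ε < 1`.
    have h2 : ε / 2 ≤ Real.log (1 + ε) := by
      refine le_trans ?_ (Real.one_sub_inv_le_log_of_pos (by linarith))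
      rw [← sub_nonneg]
      have : 1 - (1 + ε)⁻¹ - ε / 2 = ε * (1 - ε) / (2 * (1 + ε)) := by
        field_simp
        ring
      rw [this]
      have : 0 < 1 - ε := by linarith
      positivity
    have h3 : (T : ℝ) ≤ 2 * (ε⁻¹ * Real.log (n / d)) := by
      have h4 : (T : ℝ) * (ε / 2) ≤ Real.log (n / d) :=
        (mul_le_mul_of_nonneg_left h2 (Nat.cast_nonneg T)).trans h1
      rw [← mul_assoc, mul_comm 2, mul_assoc, ← div_eq_inv_mul, le_div_iff₀ hε]
      linarith
    have := le_max_right (1 : ℝ) (ε⁻¹ * Real.log (n / d))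
    push_cast
    linarith

/-- The vertices are stored in array `6` in the order of their first appearance in the bags, and
the numbers of the bags in which they appear first, plus one, in array `7`. -/
def prepareOrder : Program :=
  .seq (.setN 5 (.const 0)) (countLoop 5 (.var 2) (.seq (.setN 6 (.get 3 (.var 5)))
    (countLoop 6 (.get 3 (.add (.var 5) (.const 1)))
      (.cond (.natEQ (.get 7 (.get 4 (.var 6))) (.const 0))
        (.seq (.putN 7 (.get 4 (.var 6)) (.add (.var 5) (.const 1)))
          (.seq (.putN 6 (.var 4) (.get 4 (.var 6))) (.setN 4 (.add (.var 4) (.const 1)))))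
        .skip))))

section Order

variable {d N : ℕ} {G : SimpleGraph (Fin d)}

/-- The vertices in the list `l`, ordered by their top nodes, are stored. -/
structure OrderState (D : TreeDecomposition G (Fin N)) (l : List (Fin d)) (s : Store) : Prop where
  nodup : l.Nodup
  pairwise : l.Pairwise fun a b => D.top a ≤ D.top b
  count : s.nvar 4 = l.length
  order : ∀ (k : ℕ) (hk : k < l.length), s.narr 6 k = l[k]
  top : ∀ v : Fin d, s.narr 7 v = if v ∈ l then (D.top v : ℕ) + 1 else 0

/-- The bag of the node `t` as a list. -/
def bagList (D : TreeDecomposition G (Fin N)) (t : Fin N) : List (Fin d) :=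
  (List.finRange d).filter fun u => u ∈ D.bag t

/-- The bags are scanned in the order of their numbers, so a vertex is met first in the bag of its
top node. Listing the vertices as they are met sorts them by top node in time linear in the total
size of the bags and their number. -/
theorem runs_prepareOrder {s : Store} (D : TreeDecomposition G (Fin N)) {m : ℕ}
    (hm : ∀ t, (D.bag t).card ≤ m) (hN : s.nvar 2 = N) (h4 : s.nvar 4 = 0)
    (h7 : ∀ v, s.narr 7 v = 0)
    (hnext : ∀ t : Fin N, s.narr 3 ((t : ℕ) + 1) = s.narr 3 t + (bagList D t).length)
    (hget : ∀ (t : Fin N) (k : ℕ) (hk : k < (bagList D t).length),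
      s.narr 4 (s.narr 3 t + k) = (bagList D t)[k]) :
    Runs prepareOrder s (N * (m * 40 + 30) + 6) fun s' => ∃ ord : Equiv.Perm (Fin d),
      Monotone (D.top ∘ ord) ∧ (∀ q : Fin d, s'.narr 6 q = ord q) ∧
      ∀ v : Fin d, s'.narr 7 v = D.top v + 1 := by
  refine (Runs.seq_setN (c := N * (m * 40 + 20 + 1 + 7) + 4) ?_).mono ?_ fun _ h => h
  swap
  · simp only [NExpr.cost]
    have : N * (m * 40 + 20 + 1 + 7) ≤ N * (m * 40 + 30) := Nat.mul_le_mul le_rfl (by omega)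
    omega
  refine (Runs.countLoop (c := m * 40 + 20) (m := N) (lo := 0) (fun t s' =>
    ∃ l, (∀ v, v ∈ l ↔ (D.top v : ℕ) < t) ∧ OrderState D l s')
    (s.setN_nvar_self 5 0) ?_ (by decide) ⟨[], by simp, List.nodup_nil, List.Pairwise.nil, h4,
      by simp, fun v => (h7 v).trans (by simp)⟩ ?_).mono (by simp only [NExpr.cost]; rfl) ?_
  · intro s' hf
    rw [NExpr.eval, hf.n 2 (by decide), zero_add, ← hN]
    rfl
  · rintro t ht s₁ hf₁ ht₁ ⟨l, hl, hs₁⟩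
    rw [zero_add] at ht₁
    have h3₁ : s₁.narr 3 = s.narr 3 := hf₁.na 3 (by decide)
    have h4₁ : s₁.narr 4 = s.narr 4 := hf₁.na 4 (by decide)
    have hlen : (bagList D ⟨t, ht⟩).length ≤ m := by
      rw [bagList, TreeDecomposition.length_filter_finRange]
      exact hm _
    refine (Runs.seq_setN (c := (bagList D ⟨t, ht⟩).length * (28 + 4 + 7) + 7) ?_).mono ?_
      fun _ h => h
    · simp only [NExpr.eval, ht₁, h3₁]
      refine (Runs.listLoop (bagList D ⟨t, ht⟩) (c := 28) (lo := s.narr 3 t) (fun pre s' =>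
        ∃ l, (∀ v, v ∈ l ↔ (D.top v : ℕ) < t ∨ v ∈ pre) ∧ OrderState D l s')
        (s₁.setN_nvar_self _ _) ?_ (by decide) ⟨l, by simpa using hl, hs₁.1, hs₁.2,
          by simpa [Store.setN] using hs₁.3, hs₁.4, hs₁.5⟩ ?_).mono
          (by simp only [NExpr.cost]; rfl) ?_
      · intro s' hf
        have h5 : s'.nvar 5 = t := (hf.n 5 (by decide)).trans ht₁
        have h3 : s'.narr 3 = s.narr 3 := (hf.na 3 (by decide)).trans h3₁
        simp only [NExpr.eval, h5, h3]
        exact hnext ⟨t, ht⟩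
      · rintro k hk s₂ hf₂ hk₂ ⟨l, hl, hs₂⟩
        set u := (bagList D ⟨t, ht⟩)[k] with hu
        have hub : u ∈ D.bag ⟨t, ht⟩ := by
          have : u ∈ bagList D ⟨t, ht⟩ := List.getElem_mem hk
          simpa [bagList] using this
        have h5 : s₂.nvar 5 = t := (hf₂.n 5 (by decide)).trans ht₁
        have hu₂ : s₂.narr 4 (s₂.nvar 6) = u := by
          rw [hf₂.na 4 (by decide), hk₂]
          exact (congrFun h4₁ _).trans (hget ⟨t, ht⟩ k hk)
        refine (Runs.cond (c := 19) (fun hb => ?_) fun hb => ?_).mono (by decide) fun _ h => h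
        · simp only [Test.Holds, NExpr.eval, hu₂, hs₂.top] at hb
          have hul : u ∉ l := fun h => by simp [h] at hb
          have hnot := (not_congr (hl u)).1 hul
          -- The entry `0` marks a vertex not met before, whose top node is therefore at least `t`;
          -- it is at most `t` because `u` is in this bag. Storing the number plus one keeps node
          -- `0` apart from the mark.
          have htop : (D.top u : ℕ) = t := by
            have := D.top_le hub
            rw [Fin.le_def] at this
            simp only at this
            omega
          refine (Runs.seq_putN (c := 5 + 5) (Runs.mono (Runs.seq_putN (c := 5) (Runs.mono
            (Runs.setN ?_) (by decide) fun _ h => h)) (by decide) fun _ h => h)).mono (by decide)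
            fun _ h => h
          refine ⟨l ++ [u], fun v => ?_, ?_, ?_, ?_, ?_, ?_⟩
          · rw [List.mem_append, List.mem_append, hl]
            tauto
          · exact hs₂.nodup.append (List.nodup_singleton u) (by simpa using hul)
          · rw [List.pairwise_append]
            refine ⟨hs₂.pairwise, List.pairwise_singleton _ _, fun a ha b hb => ?_⟩
            rw [List.mem_singleton.1 hb, Fin.le_def, htop]
            rcases (hl a).1 ha with h | h
            · exact h.le
            · have : a ∈ bagList D ⟨t, ht⟩ := List.mem_of_mem_take h
              exact D.top_le (t := ⟨t, ht⟩) (by simpa [bagList] using this)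
          · simp [Store.setN, Store.putN, NExpr.eval, hs₂.count]
          · intro j hj
            rw [List.length_append, List.length_singleton] at hj
            simp only [Store.setN, Store.putN, NExpr.eval, hs₂.count, hu₂]
            by_cases hjl : j = l.length
            · subst hjl
              simp [hu₂]
            · have hj' : j < l.length := by omega
              simp [hjl, List.getElem_append_left hj', hs₂.order j hj']
          · intro v
            simp only [Store.setN, Store.putN, NExpr.eval, hu₂, h5]
            by_cases hv : v = u
            · simp [hv, htop]
            · have hne : (v : ℕ) ≠ u := fun h => hv (Fin.ext h)
              simp [hv, hne, hs₂.top]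
        · simp only [Test.Holds, NExpr.eval, hu₂, hs₂.top] at hb
          have hul : u ∈ l := by
            by_contra h
            simp [h] at hb
          refine (Runs.skip ?_).mono (by decide) fun _ h => h
          refine ⟨l, fun v => ?_, hs₂.1, hs₂.2, hs₂.3, hs₂.4, hs₂.5⟩
          rw [List.mem_append, List.mem_singleton, hl, ← or_assoc]
          have := (hl u).1 hul
          constructor
          · exact Or.inl
          · rintro (h | rfl)
            · exact h
            · exact this
      · rintro s' ⟨l, hl, hs'⟩
        refine ⟨l, fun v => ?_, hs'.1, hs'.2, hs'.3, hs'.4, hs'.5⟩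
        rw [hl]
        constructor
        · rintro (h | h)
          · omega
          · have := D.top_le (v := v) (t := ⟨t, ht⟩) (by simpa [bagList] using h)
            rw [Fin.le_def] at this
            simp only at this
            omega
        · intro h
          by_cases hlt : (D.top v : ℕ) < t
          · exact Or.inl hlt
          · have : D.top v = ⟨t, ht⟩ := Fin.ext (by simp only; omega)
            right
            have hv := D.mem_bag_top v
            rw [this] at hv
            simpa [bagList] using hv
    · simp only [NExpr.cost]
      have : (bagList D ⟨t, ht⟩).length * (28 + 4 + 7) ≤ m * 40 := Nat.mul_le_mul hlen (by omega)
      omega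
  · rintro s' ⟨l, hl, hs'⟩
    -- Every vertex lies in some bag, so the list without repetitions is a permutation of all
    -- vertices.
    have hall : ∀ v, v ∈ l := fun v => (hl v).2 (D.top v).2
    have hlen : l.length = d := by
      rw [← List.toFinset_card_of_nodup hs'.nodup, Finset.eq_univ_iff_forall.2 fun v =>
        List.mem_toFinset.2 (hall v), Finset.card_univ, Fintype.card_fin]
    have hinj : Function.Injective fun q : Fin d => l[q] := fun a b h =>
      Fin.ext ((hs'.nodup.getElem_inj_iff).1 h)
    refine ⟨Equiv.ofBijective _ (Finite.injective_iff_bijective.1 hinj), ?_,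
      fun q => ?_, fun v => ?_⟩
    · intro a b hab
      rcases hab.eq_or_lt with rfl | hab
      · exact le_rfl
      · exact List.pairwise_iff_getElem.1 hs'.pairwise a b _ _ hab
    · exact hs'.order q (by omega)
    · rw [hs'.top, if_pos (hall v)]

end Order

/-! ### The input -/

theorem listStart_succ {α : Type} (l : List (List α)) {k : ℕ} (hk : k < l.length) :
    listStart l (k + 1) = listStart l k + l[k].length := by
  rw [listStart, listStart, ← List.take_append_getElem hk, List.map_append, List.sum_append]
  simp only [List.map_cons, List.map_nil, List.sum_singleton]

theorem flatten_getElem?_listStart {α : Type} (l : List (List α)) {k j : ℕ} (hk : k < l.length)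
    (hj : j < l[k].length) : l.flatten[listStart l k + j]? = some l[k][j] := by
  induction l generalizing k with
  | nil => simp at hk
  | cons a l ih =>
    cases k with
    | zero =>
      have hj' : j < a.length := hj
      simp [listStart, List.getElem?_append_left hj']
    | succ k =>
      have h : listStart (a :: l) (k + 1) = a.length + listStart l k := by simp [listStart]
      rw [h, List.flatten_cons, add_assoc, List.getElem?_append_right (Nat.le_add_right _ _),
        Nat.add_sub_cancel_left]
      simpa using ih (k := k) (by simpa using hk) (by simpa using hj)

section Input

variable {n d N : ℕ} {A : Matrix (Fin n) (Fin d) ℝ}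

theorem share_of_ne_zero (D : TreeDecomposition (columnGraph A) (Fin N)) {i : Fin n} {u v : Fin d}
    (hu : A i u ≠ 0) (hv : A i v ≠ 0) : D.Share u v := by
  by_cases h : u = v
  · obtain ⟨t, ht⟩ := D.cover u
    exact ⟨t, ht, h ▸ ht⟩
  · exact D.edge_mem u v ⟨h, i, hu, hv⟩

/-- The support of a row is a clique of the pattern, so it lies in the bag of its vertex that is
eliminated first. -/
theorem length_rowSupport_le {ord : Equiv.Perm (Fin d)} {bagOf : Fin d → List (Fin d)}
    {P : Fin d → Fin d → Prop} (hE : ElimPattern ord bagOf P)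
    (hP : ∀ i u v, A i u ≠ 0 → A i v ≠ 0 → P u v) {m : ℕ} (hm : ∀ v, (bagOf v).length ≤ m)
    (i : Fin n) : (rowSupport A i).length ≤ m := by
  by_cases hne : (rowSupport A i).toFinset.Nonempty
  · obtain ⟨v, hv, hmax⟩ := Finset.exists_max_image _ ord.symm hne
    rw [← List.toFinset_card_of_nodup (nodup_rowSupport A i)]
    refine le_trans (Finset.card_le_card fun u hu => ?_)
      ((List.toFinset_card_le (bagOf v)).trans (hm v))
    rw [List.mem_toFinset]
    refine hE.later v u (hmax u hu) (hP i u v ?_ ?_)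
    · exact mem_rowSupport.1 (List.mem_toFinset.1 hu)
    · exact mem_rowSupport.1 (List.mem_toFinset.1 hv)
  · rw [Finset.not_nonempty_iff_eq_empty, List.toFinset_eq_empty_iff] at hne
    simp [hne]

theorem row_next (A : Matrix (Fin n) (Fin d) ℝ) (i : Fin n) :
    listStart (rowSupports A) ((i : ℕ) + 1) =
      listStart (rowSupports A) i + (rowSupport A i).length := by
  rw [listStart_succ _ (by simp [rowSupports])]
  simp [rowSupports, rowSupport]

theorem row_col (A : Matrix (Fin n) (Fin d) ℝ) (i : Fin n) (k : ℕ)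
    (hk : k < (rowSupport A i).length) :
    ((rowSupports A).flatten.map Fin.val).getD (listStart (rowSupports A) i + k) 0 =
      (rowSupport A i)[k] := by
  have h := flatten_getElem?_listStart (rowSupports A) (k := i) (j := k) (by simp [rowSupports])
    (by simpa [rowSupports, rowSupport] using hk)
  rw [List.getD_eq_getElem?_getD, List.getElem?_map, h]
  simp [rowSupports, rowSupport]

theorem row_val (A : Matrix (Fin n) (Fin d) ℝ) (i : Fin n) (k : ℕ)
    (hk : k < (rowSupport A i).length) :
    (nonzeroEntries A).getD (listStart (rowSupports A) i + k) 0 = A i (rowSupport A i)[k] := by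
  set l := (List.finRange n).map fun i => (rowSupport A i).map (A i) with hl
  have h1 : nonzeroEntries A = l.flatten := by
    rw [nonzeroEntries, List.flatMap_def]
    rfl
  -- Columns and values of a row are equally many, so one array of row starts serves both.
  have h2 : listStart (rowSupports A) i = listStart l i := by
    simp only [listStart, hl, rowSupports, ← List.map_take, List.map_map]
    congr 2
    ext i
    simp [rowSupport]
  have h := flatten_getElem?_listStart l (k := i) (j := k) (by simp [hl]) (by simpa [hl] using hk)
  rw [h1, h2, List.getD_eq_getElem?_getD, h]
  simp [hl]

theorem bag_next (D : TreeDecomposition (columnGraph A) (Fin N)) (t : Fin N) :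
    listStart (bagLists D) ((t : ℕ) + 1) = listStart (bagLists D) t + (bagList D t).length := by
  rw [listStart_succ _ (by simp [bagLists])]
  simp [bagLists, bagList]

theorem bag_get (D : TreeDecomposition (columnGraph A) (Fin N)) (t : Fin N) (k : ℕ)
    (hk : k < (bagList D t).length) :
    ((bagLists D).flatten.map Fin.val).getD (listStart (bagLists D) t + k) 0 =
      (bagList D t)[k] := by
  have h := flatten_getElem?_listStart (bagLists D) (k := t) (j := k) (by simp [bagLists])
    (by simpa [bagLists, bagList] using hk)
  rw [List.getD_eq_getElem?_getD, List.getElem?_map, h]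
  simp [bagLists, bagList]

/-- The whole program. -/
def johnProgram : Program :=
  .seq prepareBase (.seq prepareWeights (.seq prepareCount (.seq prepareOrder iteration)))

theorem runs_johnProgram (hd : 0 < d) (hA : A.rank = d)
    (D : TreeDecomposition (columnGraph A) (Fin N)) (hN : N ≤ n) (hD : D.RootedOrder) {ε : ℝ}
    {T : ℕ} (hT : (n : ℝ) / d ≤ (1 + ε) ^ (T + 1))
    (hT' : ∀ k < T, (1 + ε) ^ (k + 1) < (n : ℝ) / d) :
    Runs johnProgram (inputStore A D ε)
      ((T + 1) * (1000 * (n * ((D.width + 1) * (D.width + 1))))) fun s' =>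
        output n s' = average A (T + 1) ∧
        IsIterationOutput A (D.width + 1) (T + 1) (average A (T + 1)) := by
  set s := inputStore A D ε with hs
  set m := D.width + 1 with hm
  have hm₀ : 1 ≤ m := Nat.le_add_left 1 _
  refine (Runs.seq (c := d * 16 + 6) (c' := (n * 19 + 6) + ((T * 19 + 15) +
    ((N * (m * 40 + 30) + 6) + (T + 1) * (800 * (n * (m * m)))))) (runs_prepareBase (d := d) rfl ?_)
    fun s₁ h₁ hf₁ => ?_).mono ?_ fun _ h => h
  · simp [hs, inputStore]
  · refine (runs_prepareWeights (n := n) (d := d) ((hf₁.n 0 (by decide)).trans rfl)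
      ((hf₁.n 1 (by decide)).trans rfl)).seq fun s₂ h₂ hf₂ => ?_
    refine (runs_prepareCount (n := n) (d := d) (ε := ε)
      (((hf₂.n 0 (by decide)).trans (hf₁.n 0 (by decide))).trans rfl)
      (((hf₂.n 1 (by decide)).trans (hf₁.n 1 (by decide))).trans rfl)
      (((hf₂.r 0 (by decide)).trans (hf₁.r 0 (by decide))).trans rfl) hT hT').seq
      fun s₃ h₃ hf₃ => ?_
    have n₃ : ∀ x, x ≠ 3 → x ≠ 5 → s₃.nvar x = s.nvar x := fun x hx hx' => by
      rw [hf₃.n x (by simp [prepareCount, Program.wN, hx]),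
        hf₂.n x (by simp [prepareWeights, countLoop, Program.wN, hx']),
        hf₁.n x (by simp [prepareBase, countLoop, Program.wN, hx'])]
    have na₃ : ∀ x, x ≠ 5 → s₃.narr x = s.narr x := fun x hx => by
      rw [hf₃.na x (by simp [prepareCount, Program.wNA]),
        hf₂.na x (by simp [prepareWeights, countLoop, Program.wNA]),
        hf₁.na x (by simp [prepareBase, countLoop, Program.wNA, hx])]
    have na₅ : s₃.narr 5 = s₁.narr 5 := by
      rw [hf₃.na 5 (by decide), hf₂.na 5 (by decide)]
    have ra₃ : ∀ x, x ≠ 1 → x ≠ 3 → s₃.rarr x = s.rarr x := fun x hx hx' => by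
      rw [hf₃.ra x (by simp [prepareCount, Program.wRA]),
        hf₂.ra x (by simp [prepareWeights, countLoop, Program.wRA, hx, hx']),
        hf₁.ra x (by simp [prepareBase, countLoop, Program.wRA])]
    have ra₃' : ∀ i : Fin n, s₃.rarr 3 i = (d : ℝ) / n ∧ s₃.rarr 1 i = (d : ℝ) / n := by
      rw [hf₃.ra 3 (by decide), hf₃.ra 1 (by decide)]
      exact h₂
    refine (runs_prepareOrder (N := N) (s := s₃) D (m := m) D.card_bag_le ?_ ?_ ?_ ?_ ?_).seq
      fun s₄ h₄ hf₄ => ?_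
    · rw [n₃ 2 (by decide) (by decide)]
      rfl
    · rw [n₃ 4 (by decide) (by decide)]
      rfl
    · intro v
      rw [na₃ 7 (by decide)]
      rfl
    · rw [na₃ 3 (by decide)]
      exact bag_next D
    · rw [na₃ 3 (by decide), na₃ 4 (by decide)]
      exact bag_get D
    · obtain ⟨ord, hord, h6, h7⟩ := h₄
      have na₄ : ∀ x, x ≠ 5 → x ≠ 6 → x ≠ 7 → s₄.narr x = s.narr x := fun x hx hx' hx'' => by
        rw [hf₄.na x (by simp [prepareOrder, countLoop, Program.wNA, hx', hx'']), na₃ x hx]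
      have ra₄ : s₄.rarr = s₃.rarr := funext fun x =>
        hf₄.ra x (by simp [prepareOrder, countLoop, Program.wRA])
      have hE := hD.elimPattern hord
      have hP : ∀ i u v, A i u ≠ 0 → A i v ≠ 0 → D.Share u v :=
        fun i u v => share_of_ne_zero D
      have hstatic : Static A ord D.topBag s₄ := by
        refine ⟨?_, ?_, ?_, ?_, ?_, fun v => ?_, fun v k hk => ?_, fun u => ?_, h6⟩
        · rw [hf₄.n 0 (by decide), n₃ 0 (by decide) (by decide)]
          rfl
        · rw [hf₄.n 1 (by decide), n₃ 1 (by decide) (by decide)]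
          rfl
        · rw [na₄ 0 (by decide) (by decide) (by decide)]
          exact row_next A
        · rw [na₄ 0 (by decide) (by decide) (by decide), na₄ 1 (by decide) (by decide) (by decide)]
          exact row_col A
        · rw [na₄ 0 (by decide) (by decide) (by decide), ra₄, ra₃ 0 (by decide) (by decide)]
          exact row_val A
        · rw [na₄ 3 (by decide) (by decide) (by decide), h7, Nat.add_sub_cancel]
          exact bag_next D _
        · rw [na₄ 3 (by decide) (by decide) (by decide), na₄ 4 (by decide) (by decide) (by decide),
            h7, Nat.add_sub_cancel]
          exact bag_get D _ k hk
        · rw [hf₄.na 5 (by decide), na₅]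
          exact h₁ u
      -- The matrix arrays `2` and `4` have not been touched and still have the zeros of the initial
      -- memory.
      have hiter : IterState A D.topBag 0 s₄ := by
        refine ⟨?_, fun u v _ => ?_, fun i => ?_, fun i => ?_⟩
        · ext u v
          rw [Store.mat, ra₄, ra₃ 2 (by decide) (by decide)]
          rfl
        · rw [Store.mat, ra₄, ra₃ 4 (by decide) (by decide)]
          rfl
        · rw [ra₄]
          exact (ra₃' i).1
        · rw [ra₄, (ra₃' i).2]
          simp [iterate]
      refine (runs_iteration hstatic hE hd hA hP hm₀ D.length_topBag_le
        (length_rowSupport_le hE hP D.length_topBag_le) ?_ (Nat.le_add_left 1 T) hiter).mono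
        le_rfl fun s₅ h₅ => ⟨funext h₅, ?_⟩
      · rw [hf₄.n 3 (by decide), h₃]
      · exact isIterationOutput_average hd hA hE hP D.length_topBag_le _
  · have hdn := le_of_rank hA
    have hn : 1 ≤ n := hd.trans_le hdn
    have hq : n ≤ n * (m * m) := Nat.le_mul_of_pos_right n (Nat.mul_pos hm₀ hm₀)
    have hNq : N * (m * 40 + 30) ≤ 70 * (n * (m * m)) := by
      have h1 : m * 40 + 30 ≤ 70 * (m * m) := by nlinarith
      calc N * (m * 40 + 30) ≤ n * (70 * (m * m)) := Nat.mul_le_mul hN h1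
        _ = 70 * (n * (m * m)) := by ring
    set q := n * (m * m)
    -- The iteration takes `800 q` for each iterate. The preparations take at most `138 q + 19 T`,
    -- which fits into the remaining `200 q` for each iterate.
    have : T * (800 * q + 19) ≤ T * (1000 * q) := Nat.mul_le_mul le_rfl (by omega)
    have h1 : (T + 1) * (1000 * q) = T * (1000 * q) + 1000 * q := by ring
    have h2 : (T + 1) * (800 * q) = T * (800 * q) + 800 * q := by ring
    have h3 : T * (800 * q + 19) = T * (800 * q) + T * 19 := by ring
    omega

end Input

end

end JohnEllipsoid

open JohnEllipsoid in
theorem theorem7p4 :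
    ∃ (P : Program) (C : ℝ),
      ∀ (n d : ℕ) (A : Matrix (Fin n) (Fin d) ℝ), 0 < d → A.rank = d →
        (∃ (N : ℕ) (D : TreeDecomposition (columnGraph A) (Fin N)),
          N ≤ d ∧ D.RootedOrder ∧ D.width = treewidth (columnGraph A)) ∧
        ∀ (N : ℕ) (D : TreeDecomposition (columnGraph A) (Fin N)), N ≤ n → D.RootedOrder →
          ∀ ε : ℝ, 0 < ε → ε < 1 →
            ∃ (s : Store) (t T : ℕ),
              Exec P (inputStore A D ε) s t ∧
              (t : ℝ) ≤ C * (n * (max D.width 1 : ℕ) ^ 2 * max 1 (ε⁻¹ * Real.log (n / d))) ∧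
              1 ≤ T ∧ (T : ℝ) ≤ C * max 1 (ε⁻¹ * Real.log (n / d)) ∧
              IsIterationOutput A (D.width + 1) T (output n s) ∧
              IsApproxJohn A ε (output n s) := by
  refine ⟨johnProgram, 12000, fun n d A hd hA => ⟨?_, fun N D hN hD ε hε hε' => ?_⟩⟩
  · obtain ⟨D, hD, hw⟩ := exists_treeDecomposition_width_eq (columnGraph A) hd
    exact ⟨d, D, le_rfl, hD, hw⟩
  · obtain ⟨T, hT, hT', hTle⟩ := exists_count (n := n) (d := d) hε hε'
    obtain ⟨s, t, hexec, ht, hout, hiter⟩ := runs_johnProgram hd hA D hN hD hT hT'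
    have hmax := le_max_left (1 : ℝ) (ε⁻¹ * Real.log (n / d))
    refine ⟨s, t, T + 1, hexec, ?_, Nat.le_add_left 1 T, by linarith, hout ▸ hiter,
      hout ▸ isApproxJohn_average hd hA (Nat.le_add_left 1 T) hε hT⟩
    -- This costs a factor `4`; with `1000` from the program and `3` from the number of iterates it
    -- gives the constant `12000`.
    have hw : ((D.width + 1) * (D.width + 1) : ℕ) ≤ 4 * (max D.width 1) ^ 2 := by
      have h1 : D.width + 1 ≤ 2 * max D.width 1 := by omega
      calc (D.width + 1) * (D.width + 1) ≤ (2 * max D.width 1) * (2 * max D.width 1) :=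
            Nat.mul_le_mul h1 h1
        _ = 4 * (max D.width 1) ^ 2 := by ring
    have ht' : t ≤ (T + 1) * (4000 * (n * (max D.width 1) ^ 2)) := ht.trans <| by
      refine Nat.mul_le_mul le_rfl ?_
      calc 1000 * (n * ((D.width + 1) * (D.width + 1)))
          ≤ 1000 * (n * (4 * (max D.width 1) ^ 2)) :=
            Nat.mul_le_mul le_rfl (Nat.mul_le_mul le_rfl hw)
        _ = 4000 * (n * (max D.width 1) ^ 2) := by ring
    calc (t : ℝ) ≤ (((T + 1) * (4000 * (n * (max D.width 1) ^ 2)) : ℕ) : ℝ) := by exact_mod_cast ht'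
      _ = ((T + 1 : ℕ) : ℝ) * (4000 * (n * ((max D.width 1 : ℕ) : ℝ) ^ 2)) := by push_cast; ring
      _ ≤ (3 * max 1 (ε⁻¹ * Real.log (n / d))) * (4000 * (n * ((max D.width 1 : ℕ) : ℝ) ^ 2)) :=
          mul_le_mul_of_nonneg_right hTle (by positivity)
      _ = 12000 * (n * ((max D.width 1 : ℕ) : ℝ) ^ 2 * max 1 (ε⁻¹ * Real.log (n / d))) := by ring
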